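/- Let $\mathcal H_X,\mathcal H_Y$ be separable real Hilbert spaces (of dimensions $d_X,d_Y\in\{0,1,2,\dots\}\cup\{\infty\}$), let $\mathcal Z$ be a measurable space, and let $\mathcal P_0$ be the set of all distributions $P$ of $(X,Y,Z)$ on $\mathcal H_X\times\mathcal H_Y\times\mathcal Z$ under which $X$ and $Y$ are conditionally independent given $Z$. For $P$ with $\mathbb E_P\|X\|<\infty$ and $\mathbb E_P\|Y\|<\infty$ put $$f_P(z)=\mathbb E_P(X\mid Z=z),\quad g_P(z)=\mathbb E_P(Y\mid Z=z),\quad \varepsilon_P=X-f_P(Z),\quad \xi_P=Y-g_P(Z),$$ $$u_P(z)=\mathbb E_P(\|\varepsilon_P\|^2\mid Z=z)\in[0,\infty],\qquad v_P(z)=\mathbb E_P(\|\xi_P\|^2\mid Z=z)\in[0,\infty].$$ Write $g\otimes h$ for the operator $x\mapsto\langle x,g\rangle h$, and $\otimes_{\mathrm{HS}}$ for the outer product on the Hilbert space of Hilbert--Schmidt operators $\mathcal H_X\to\mathcal H_Y$. The data $(x_i,y_i,z_i)_{i=1}^n$ are i.i.d. from $P$; $\mathbb P_P$ denotes their law. For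 each $n$, a regression method produces from $(x_i,z_i)_{i=1}^n$ a fitted function $\hat f^{(n)}:\mathcal Z\to\mathcal H_X$, and another produces from $(y_i,z_i)_{i=1}^n$ a fitted function $\hat g^{(n)}:\mathcal Z\to\mathcal H_Y$; the fitted values $\hat f^{(n)}(z_i)$, $\hat g^{(n)}(z_i)$ are assumed to be measurable functions of the data. Let $\hat\varepsilon_i=x_i-\hat f^{(n)}(z_i)$, $\hat\xi_i=y_i-\hat g^{(n)}(z_i)$, $\mathscr R_i=\hat\varepsilon_i\otimes\hat\xi_i$, $\bar{\mathscr R}=\frac1n\sum_i\mathscr R_i$, $$T_n=\|\sqrt n\,\bar{\mathscr R}\|_{\mathrm{HS}}^2,\qquad \hat{\mathscr C}=\frac1{n-1}\sum_{i=1}^n(\mathscr R_i-\bar{\mathscr R})\otimes_{\mathrm{HS}}(\mathscr R_i-\bar{\mathscr R}).$$ For $\alpha\in(0,1)$ the $\alpha$-level GHCM test is $\psi_n=\mathbf 1\{T_n\ge q_\alpha\}$, where $q_\alpha$ is the $1-\alpha$ quantile of $\sum_{k=1}^d\lambda_kW_k$, with $\lambda_1,\dots,\lambda_d$ the non-zero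 eigenvalues of $\hat{\mathscr C}$ (with multiplicity) and $W_1,\dots,W_d$ independent $\chi^2_1$ variables. Let $$M^f_{n,P}=\frac1n\sum_{i=1}^n\|f_P(z_i)-\hat f^{(n)}(z_i)\|^2,\qquad \tilde M^f_{n,P}=\frac1n\sum_{i=1}^n\|f_P(z_i)-\hat f^{(n)}(z_i)\|^2v_P(z_i),$$ $$M^g_{n,P}=\frac1n\sum_{i=1}^n\|g_P(z_i)-\hat g^{(n)}(z_i)\|^2,\qquad \tilde M^g_{n,P}=\frac1n\sum_{i=1}^n\|g_P(z_i)-\hat g^{(n)}(z_i)\|^2u_P(z_i).$$ For non-negative $W_{n,P}$, write $W_{n,P}\overset{P}{\rightrightarrows}0$ if $\lim_{n\to\infty}\sup_{P\in\tilde{\mathcal P}_0}\mathbb P_P(W_{n,P}\ge\delta)=0$ for every $\delta>0$. **Theorem.** Let $\tilde{\mathcal P}_0\subseteq\mathcal P_0$ be a set of distributions with $\mathbb E_P\|X\|<\infty$ and $\mathbb E_P\|Y\|<\infty$ for all $P\in\tilde{\mathcal P}_0$, such that 1. $nM^f_{n,P}M^g_{n,P}\overset{P}{\rightrightarrows}0$;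 2. $\tilde M^f_{n,P}\overset{P}{\rightrightarrows}0$ and $\tilde M^g_{n,P}\overset{P}{\rightrightarrows}0$; 3. $\inf_{P\in\tilde{\mathcal P}_0}\mathbb E_P(\|\varepsilon_P\|^2\|\xi_P\|^2)>0$, and $\sup_{P\in\tilde{\mathcal P}_0}\mathbb E_P(\|\varepsilon_P\|^{2+\eta}\|\xi_P\|^{2+\eta})<\infty$ for some $\eta>0$; 4. for some orthonormal bases $(e_{X,i})_{i=1}^{d_X}$ of $\mathcal H_X$ and $(e_{Y,j})_{j=1}^{d_Y}$ of $\mathcal H_Y$, $$\lim_{K\to\infty}\sup_{P\in\tilde{\mathcal P}_0}\sum_{(i,j):\,i+j\ge K}\mathbb E_P\big(\langle e_{X,i},\varepsilon_P\rangle^2\langle e_{Y,j},\xi_P\rangle^2\big)=0;$$ 5. $\inf_{P\in\tilde{\mathcal P}_0}\|\mathscr C_P\|_{\mathrm{op}}>0$, where $\mathscr C_P=\mathbb E_P\{(\varepsilon_P\otimes\xi_P)\otimes_{\mathrm{HS}}(\varepsilon_P\otimes\xi_P)\}$. Then for each $\alpha\in(0,1)$ the $\alpha$-level GHCM test satisfies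 $$\lim_{n\to\infty}\sup_{P\in\tilde{\mathcal P}_0}\big|\mathbb P_P(\psi_n=1)-\alpha\big|=0.$$ -/

import Mathlib

open MeasureTheory ProbabilityTheory Filter Topology
open scoped ENNReal

noncomputable section

/-! ### Hilbert–Schmidt operators between real Hilbert spaces -/

section HilbertSchmidt

variable (E F : Type*) [NormedAddCommGroup E] [InnerProductSpace ℝ E] [CompleteSpace E]
  [NormedAddCommGroup F] [InnerProductSpace ℝ F]

/-- The index set of a chosen orthonormal basis of `E`. -/
def HSBasisSet : Set E := (exists_hilbertBasis ℝ E).choose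

/-- A chosen orthonormal basis of `E`. -/
def hsBasis : HilbertBasis (HSBasisSet E) ℝ E := (exists_hilbertBasis ℝ E).choose_spec.choose

/-- The bounded operators `A : E → F` with `∑ i, ‖A (e i)‖ ^ 2 < ∞` for the orthonormal basis `e`
chosen above (the sum does not depend on the basis, see `HilbertSchmidt.hasSum_norm_sq`). -/
def hilbertSchmidtSubmodule : Submodule ℝ (E →L[ℝ] F) where
  carrier := {A | Memℓp (fun i => A (hsBasis E i)) 2}
  zero_mem' := by
    exact (zero_memℓp : Memℓp (0 : HSBasisSet E → F) 2)
  add_mem' := fun {A B} hA hB => hA.add hB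
  smul_mem' := fun c A hA => hA.const_smul c

/-- The space of Hilbert–Schmidt operators `E → F`.  It carries the Hilbert–Schmidt (not the
operator) norm. -/
def HilbertSchmidt : Type _ := hilbertSchmidtSubmodule E F

namespace HilbertSchmidt

instance instAddCommGroup : AddCommGroup (HilbertSchmidt E F) :=
  inferInstanceAs (AddCommGroup (hilbertSchmidtSubmodule E F))

instance instModule : Module ℝ (HilbertSchmidt E F) :=
  inferInstanceAs (Module ℝ (hilbertSchmidtSubmodule E F))

/-- The bounded operator underlying a Hilbert–Schmidt operator. -/
def toCLM : HilbertSchmidt E F →ₗ[ℝ] (E →L[ℝ] F) := (hilbertSchmidtSubmodule E F).subtype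

/-- The family `(A (e i))` of the values of a Hilbert–Schmidt operator on the chosen basis. -/
def toLp : HilbertSchmidt E F →ₗ[ℝ] lp (fun _ : HSBasisSet E => F) 2 where
  toFun A := ⟨fun i => toCLM E F A (hsBasis E i), A.2⟩
  map_add' _ _ := rfl
  map_smul' _ _ := rfl

theorem toLp_injective : Function.Injective (toLp E F) := by
  intro A B h
  refine Subtype.ext (ContinuousLinearMap.ext_on (s := Set.range (hsBasis E)) ?_ ?_)
  · exact (Submodule.dense_iff_topologicalClosure_eq_top).2 (hsBasis E).dense_span
  · rintro _ ⟨i, rfl⟩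
    exact congrFun (congrArg Subtype.val h) i

instance instNormedAddCommGroup : NormedAddCommGroup (HilbertSchmidt E F) :=
  NormedAddCommGroup.induced (HilbertSchmidt E F) (lp (fun _ : HSBasisSet E => F) 2)
    (toLp E F) (toLp_injective E F)

/-- The Hilbert–Schmidt inner product `⟪A, B⟫ = ∑ i, ⟪A (e i), B (e i)⟫`. -/
instance instInnerProductSpace : InnerProductSpace ℝ (HilbertSchmidt E F) where
  norm_smul_le c A := by
    change ‖toLp E F (c • A)‖ ≤ ‖c‖ * ‖toLp E F A‖
    rw [map_smul]
    exact norm_smul_le c _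
  inner A B := inner ℝ (toLp E F A) (toLp E F B)
  norm_sq_eq_re_inner A := norm_sq_eq_re_inner (toLp E F A)
  conj_inner_symm A B := inner_conj_symm (toLp E F A) (toLp E F B)
  add_left A B C := by
    rw [map_add]
    exact inner_add_left _ _ _
  smul_left A B c := by
    rw [map_smul]
    exact inner_smul_left _ _ _

variable {E F}

theorem memℓp_rankOne (g : E) (h : F) :
    Memℓp (fun i => InnerProductSpace.rankOne ℝ h g (hsBasis E i)) 2 := by
  refine memℓp_gen ?_
  have hs := lp.memℓp ((hsBasis E).repr g)
  have hs2 := (memℓp_gen_iff (by norm_num)).1 hs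
  refine (hs2.mul_right (‖h‖ ^ (2 : ℝ≥0∞).toReal)).congr fun i => ?_
  rw [InnerProductSpace.rankOne_apply, norm_smul, HilbertBasis.repr_apply_apply,
    real_inner_comm, Real.mul_rpow (norm_nonneg _) (norm_nonneg _)]

/-- The outer product `g ⊗ h`, i.e. the operator `x ↦ ⟪x, g⟫ h`, as a Hilbert–Schmidt operator. -/
def outer (g : E) (h : F) : HilbertSchmidt E F :=
  ⟨InnerProductSpace.rankOne ℝ h g, memℓp_rankOne g h⟩

theorem toCLM_outer_apply (g : E) (h : F) (x : E) :
    toCLM E F (outer g h) x = inner ℝ x g • h := by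
  change InnerProductSpace.rankOne ℝ h g x = _
  rw [InnerProductSpace.rankOne_apply, real_inner_comm]

variable [CompleteSpace F]

theorem tsum_ofReal_inner_sq {G ι : Type*} [NormedAddCommGroup G] [InnerProductSpace ℝ G]
    (b : HilbertBasis ι ℝ G) (x : G) :
    ∑' i, ENNReal.ofReal ((inner ℝ (b i) x) ^ 2) = ENNReal.ofReal (‖x‖ ^ 2) := by
  have h := b.hasSum_inner_mul_inner x x
  have h' : HasSum (fun i => (inner ℝ (b i) x) ^ 2) (‖x‖ ^ 2) := by
    rw [← real_inner_self_eq_norm_sq]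
    refine h.congr_fun fun i => ?_
    rw [real_inner_comm, sq]
  rw [← h'.tsum_eq, ENNReal.ofReal_tsum_of_nonneg (fun i => sq_nonneg _) h'.summable]

theorem tsum_norm_sq_eq_adjoint {ι κ : Type*} (b : HilbertBasis ι ℝ E) (c : HilbertBasis κ ℝ F)
    (A : E →L[ℝ] F) :
    ∑' i, ENNReal.ofReal (‖A (b i)‖ ^ 2) =
      ∑' k, ENNReal.ofReal (‖ContinuousLinearMap.adjoint A (c k)‖ ^ 2) := by
  simp_rw [← tsum_ofReal_inner_sq c, ← tsum_ofReal_inner_sq b]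
  rw [ENNReal.tsum_comm]
  refine tsum_congr fun k => tsum_congr fun i => ?_
  rw [ContinuousLinearMap.adjoint_inner_right, real_inner_comm]

/-- The Hilbert–Schmidt norm is the usual one, computed in any orthonormal basis. -/
theorem hasSum_norm_sq {ι : Type*} (b : HilbertBasis ι ℝ E) (A : HilbertSchmidt E F) :
    HasSum (fun i => ‖toCLM E F A (b i)‖ ^ 2) (‖A‖ ^ 2) := by
  have h0 : HasSum (fun i => ‖toCLM E F A (hsBasis E i)‖ ^ 2) (‖A‖ ^ 2) := by
    have := lp.hasSum_norm (p := 2) (by norm_num) (toLp E F A)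
    simp only [ENNReal.toReal_ofNat, Real.rpow_ofNat] at this
    exact this
  have h1 : ∑' i, ENNReal.ofReal (‖toCLM E F A (b i)‖ ^ 2) = ENNReal.ofReal (‖A‖ ^ 2) := by
    rw [tsum_norm_sq_eq_adjoint b (hsBasis F), ← tsum_norm_sq_eq_adjoint (hsBasis E) (hsBasis F),
      ← h0.tsum_eq, ENNReal.ofReal_tsum_of_nonneg (fun i => sq_nonneg _) h0.summable]
  have hs : Summable fun i => ‖toCLM E F A (b i)‖ ^ 2 := by
    have := ENNReal.summable_toReal (h1.trans_ne ENNReal.ofReal_ne_top)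
    exact this.congr fun i => ENNReal.toReal_ofReal (sq_nonneg _)
  rw [← ENNReal.ofReal_tsum_of_nonneg (fun i => sq_nonneg _) hs,
    ENNReal.ofReal_eq_ofReal_iff (tsum_nonneg fun i => sq_nonneg _) (sq_nonneg _)] at h1
  exact h1 ▸ hs.hasSum

theorem toLp_surjective : Function.Surjective (toLp E F) := by
  classical
  intro g
  have hpq : (2 : ℝ).HolderConjugate 2 := by
    rw [Real.holderConjugate_iff]; norm_num
  have hg := lp.hasSum_norm (p := 2) (by norm_num) g
  have hx (x : E) := lp.hasSum_norm (p := 2) (by norm_num) ((hsBasis E).repr x)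
  simp only [ENNReal.toReal_ofNat] at hg hx
  have hcm (x : E) := Real.summable_mul_of_Lp_Lq_of_nonneg hpq
    (f := fun i => ‖(hsBasis E).repr x i‖) (g := fun i => ‖g i‖)
    (fun i => norm_nonneg _) (fun i => norm_nonneg _) (hx x).summable hg.summable
  have hcs (x : E) := Real.inner_le_Lp_mul_Lq_tsum_of_nonneg hpq
    (f := fun i => ‖(hsBasis E).repr x i‖) (g := fun i => ‖g i‖)
    (fun i => norm_nonneg _) (fun i => norm_nonneg _) (hx x).summable hg.summable
  have hsn (x : E) : Summable fun i => ‖(hsBasis E).repr x i • g i‖ := by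
    simpa only [norm_smul] using (hcm x)
  have hs (x : E) : Summable fun i => (hsBasis E).repr x i • g i := (hsn x).of_norm
  let T : E →ₗ[ℝ] F :=
    { toFun := fun x => ∑' i, (hsBasis E).repr x i • g i
      map_add' := fun x y => by
        rw [← (hs x).tsum_add (hs y)]
        simp [add_smul]
      map_smul' := fun c x => by
        rw [RingHom.id_apply, ← (hs x).tsum_const_smul c]
        simp [mul_smul] }
  have hT (x : E) : ‖T x‖ ≤ ‖g‖ * ‖x‖ := by
    refine (norm_tsum_le_tsum_norm (hsn x)).trans ?_
    simp only [norm_smul]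
    refine (hcs x).trans_eq ?_
    rw [(hx x).tsum_eq, hg.tsum_eq, ← Real.rpow_mul (norm_nonneg _),
      ← Real.rpow_mul (norm_nonneg _), LinearIsometryEquiv.norm_map]
    norm_num [mul_comm]
  have hTb (i : HSBasisSet E) : T.mkContinuous ‖g‖ hT (hsBasis E i) = g i := by
    change ∑' j, (hsBasis E).repr (hsBasis E i) j • g j = g i
    rw [HilbertBasis.repr_self, tsum_eq_single i]
    · simp
    · intro j hj
      simp [hj]
  refine ⟨⟨T.mkContinuous ‖g‖ hT, ?_⟩, ?_⟩
  · change Memℓp (fun i => T.mkContinuous ‖g‖ hT (hsBasis E i)) 2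
    simp_rw [hTb]
    exact lp.memℓp g
  · ext i
    exact hTb i

instance instCompleteSpace : CompleteSpace (HilbertSchmidt E F) := by
  let e : HilbertSchmidt E F ≃ₗᵢ[ℝ] lp (fun _ : HSBasisSet E => F) 2 :=
    { LinearEquiv.ofBijective (toLp E F) ⟨toLp_injective E F, toLp_surjective⟩ with
      norm_map' := fun _ => rfl }
  exact e.toIsometryEquiv.completeSpace

end HilbertSchmidt

end HilbertSchmidt

/-! ### Covariance operators, weighted chi-squared quantiles -/

section Operators

variable {H : Type*} [NormedAddCommGroup H] [InnerProductSpace ℝ H]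

/-- The outer product `g ⊗ h : x ↦ ⟪x, g⟫ h` on a Hilbert space `H`, as a bounded operator. -/
def outerOp (g h : H) : H →L[ℝ] H := InnerProductSpace.rankOne ℝ h g

/-- Index set of the non-zero eigenvalues of `A`, each repeated according to its multiplicity. -/
abbrev NonzeroEigIndex (A : H →L[ℝ] H) : Type :=
  Σ l : {l : ℝ // l ≠ 0}, Fin (Module.finrank ℝ (Module.End.eigenspace (A : Module.End ℝ H) l.1))

/-- The empirical mean `(1/n) ∑ R_i`. -/
def empMean {n : ℕ} (R : Fin n → H) : H := (n : ℝ)⁻¹ • ∑ i, R i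

/-- The empirical covariance operator `(1/(n-1)) ∑ (R_i - R̄) ⊗ (R_i - R̄)`. -/
def empCov {n : ℕ} (R : Fin n → H) : H →L[ℝ] H :=
  ((n : ℝ) - 1)⁻¹ • ∑ i, outerOp (R i - empMean R) (R i - empMean R)

end Operators

/-- The `χ²` distribution with one degree of freedom. -/
def chiSqOne : Measure ℝ := (gaussianReal 0 1).map fun x => x ^ 2

instance instIsProbabilityMeasureChiSqOne : IsProbabilityMeasure chiSqOne :=
  Measure.isProbabilityMeasure_map (by fun_prop)

/-- The `p`-quantile of `∑ k, w k * W k`, with `W k` independent and `χ²₁`-distributed. -/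
def weightedChiSqQuantile {κ : Type*} (w : κ → ℝ) (p : ℝ) : ℝ :=
  sInf {x : ℝ | p ≤ (Measure.infinitePi fun _ : κ => chiSqOne).real {W | ∑' k, w k * W k ≤ x}}

/-! ### The GHCM test -/

section Test

variable {E F : Type*} [NormedAddCommGroup E] [InnerProductSpace ℝ E] [CompleteSpace E]
  [NormedAddCommGroup F] [InnerProductSpace ℝ F]

/-- The products `R_i = ε̂_i ⊗ ξ̂_i` of the residuals. -/
def residualProd {n : ℕ} (e : Fin n → E) (x : Fin n → F) (i : Fin n) : HilbertSchmidt E F :=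
  HilbertSchmidt.outer (e i) (x i)

/-- The test statistic `T_n = ‖√n R̄‖²_HS`. -/
def ghcmStat {n : ℕ} (e : Fin n → E) (x : Fin n → F) : ℝ :=
  ‖√(n : ℝ) • empMean (residualProd e x)‖ ^ 2

/-- The critical value: the `1 - α` quantile of the chi-squared sum weighted by the non-zero
eigenvalues (with multiplicity) of the empirical covariance operator of the `R_i`. -/
def ghcmCritical (α : ℝ) {n : ℕ} (e : Fin n → E) (x : Fin n → F) : ℝ :=
  weightedChiSqQuantile
    (fun k : NonzeroEigIndex (empCov (residualProd e x)) => (k.1 : ℝ)) (1 - α)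

open Classical in
/-- The `α`-level GHCM test computed from residuals: `1` means rejection. -/
def ghcmTest (α : ℝ) {n : ℕ} (e : Fin n → E) (x : Fin n → F) : ℕ :=
  if ghcmCritical α e x ≤ ghcmStat e x then 1 else 0

end Test

/-! ### The statistical model -/

section Model

variable {E F 𝒵 : Type*}
  [NormedAddCommGroup E] [InnerProductSpace ℝ E] [CompleteSpace E] [SecondCountableTopology E]
  [MeasurableSpace E] [BorelSpace E]
  [NormedAddCommGroup F] [InnerProductSpace ℝ F] [CompleteSpace F] [SecondCountableTopology F]
  [MeasurableSpace F] [BorelSpace F]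
  [MeasurableSpace 𝒵]

/-- Law of `n` i.i.d. observations from `P`. -/
def sampleLaw {Ω : Type*} [MeasurableSpace Ω] (P : ProbabilityMeasure Ω) (n : ℕ) :
    Measure (Fin n → Ω) :=
  Measure.pi fun _ => (P : Measure Ω)

/-- `W n → 0` in probability, uniformly over `P ∈ S`, for `[0, ∞]`-valued statistics
`W n P` of `n` i.i.d. observations from `P`. -/
def UnifTendstoZeroInProb {Ω : Type*} [MeasurableSpace Ω] (S : Set (ProbabilityMeasure Ω))
    (W : (n : ℕ) → ProbabilityMeasure Ω → (Fin n → Ω) → ℝ≥0∞) : Prop :=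
  ∀ δ : ℝ≥0∞, 0 < δ →
    Tendsto (fun n => ⨆ P ∈ S, sampleLaw P n {d | δ ≤ W n P d}) atTop (𝓝 0)

/-- `E_P(V | Z = z)` for a Hilbert space valued `V`. -/
def condMean {Ω G : Type*} [MeasurableSpace Ω] [NormedAddCommGroup G] [InnerProductSpace ℝ G]
    [CompleteSpace G] [SecondCountableTopology G] [MeasurableSpace G] [BorelSpace G]
    (V : Ω → G) (Z : Ω → 𝒵) (P : ProbabilityMeasure Ω) (z : 𝒵) : G :=
  ∫ v, v ∂(condDistrib V Z (P : Measure Ω) z)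

/-- `E_P(V | Z = z)` for a `[0, ∞]`-valued `V`. -/
def condLMean {Ω : Type*} [MeasurableSpace Ω] (V : Ω → ℝ≥0∞) (Z : Ω → 𝒵)
    (P : ProbabilityMeasure Ω) (z : 𝒵) : ℝ≥0∞ :=
  ∫⁻ v, v ∂(condDistrib V Z (P : Measure Ω) z)

/-- The `σ`-algebra generated by `Z` on the space of triplets `(x, y, z)`. -/
@[reducible] def sigmaZ (E F 𝒵 : Type*) [m : MeasurableSpace 𝒵] : MeasurableSpace (E × F × 𝒵) :=
  MeasurableSpace.comap (fun p => p.2.2) m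

/-- The conditional independence null: all laws of `(X, Y, Z)` under which `X` and `Y` are
conditionally independent given `Z`, that is, `E(a(X) b(Y) | Z) = E(a(X) | Z) E(b(Y) | Z)` a.s.
for all bounded measurable `a` and `b`. -/
def condIndepNull (E F 𝒵 : Type*) [MeasurableSpace E] [MeasurableSpace F] [MeasurableSpace 𝒵] :
    Set (ProbabilityMeasure (E × F × 𝒵)) :=
  {P | ∀ (a : E → ℝ) (b : F → ℝ), Measurable a → Measurable b →
    (∃ C, ∀ x, |a x| ≤ C) → (∃ C, ∀ y, |b y| ≤ C) →
    condExp (sigmaZ E F 𝒵) (P : Measure (E × F × 𝒵)) (fun p => a p.1 * b p.2.1)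
      =ᵐ[(P : Measure (E × F × 𝒵))]
        condExp (sigmaZ E F 𝒵) (P : Measure (E × F × 𝒵)) (fun p => a p.1) *
          condExp (sigmaZ E F 𝒵) (P : Measure (E × F × 𝒵)) (fun p => b p.2.1)}

/-- `f_P(z) = E_P(X | Z = z)`. -/
def regX (P : ProbabilityMeasure (E × F × 𝒵)) : 𝒵 → E :=
  condMean (fun p : E × F × 𝒵 => p.1) (fun p => p.2.2) P

/-- `g_P(z) = E_P(Y | Z = z)`. -/
def regY (P : ProbabilityMeasure (E × F × 𝒵)) : 𝒵 → F :=
  condMean (fun p : E × F × 𝒵 => p.2.1) (fun p => p.2.2) P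

/-- `ε_P = X - f_P(Z)`. -/
def noiseX (P : ProbabilityMeasure (E × F × 𝒵)) (p : E × F × 𝒵) : E := p.1 - regX P p.2.2

/-- `ξ_P = Y - g_P(Z)`. -/
def noiseY (P : ProbabilityMeasure (E × F × 𝒵)) (p : E × F × 𝒵) : F := p.2.1 - regY P p.2.2

/-- `u_P(z) = E_P(‖ε_P‖² | Z = z)`. -/
def condVarX (P : ProbabilityMeasure (E × F × 𝒵)) : 𝒵 → ℝ≥0∞ :=
  condLMean (fun p => ‖noiseX P p‖ₑ ^ 2) (fun p => p.2.2) P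

/-- `v_P(z) = E_P(‖ξ_P‖² | Z = z)`. -/
def condVarY (P : ProbabilityMeasure (E × F × 𝒵)) : 𝒵 → ℝ≥0∞ :=
  condLMean (fun p => ‖noiseY P p‖ₑ ^ 2) (fun p => p.2.2) P

/-- The covariance operator `C_P = E_P[(ε_P ⊗ ξ_P) ⊗_HS (ε_P ⊗ ξ_P)]` on the space of
Hilbert–Schmidt operators (a Bochner integral). -/
def covOp (P : ProbabilityMeasure (E × F × 𝒵)) :
    HilbertSchmidt E F →L[ℝ] HilbertSchmidt E F :=
  ∫ p, outerOp (HilbertSchmidt.outer (noiseX P p) (noiseY P p))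
    (HilbertSchmidt.outer (noiseX P p) (noiseY P p)) ∂(P : Measure (E × F × 𝒵))

/-- A regression method: for every sample size `n`, it turns responses `(x_i)` and covariates
`(z_i)` into a fitted regression function. -/
abbrev RegMethod (G 𝒵 : Type*) : Type _ := (n : ℕ) → (Fin n → G) → (Fin n → 𝒵) → 𝒵 → G

/-- The fitted values at the covariates of the sample are random variables. -/
def RegMethod.MeasurableFit {G 𝒵 : Type*} [MeasurableSpace G] [MeasurableSpace 𝒵]
    (r : RegMethod G 𝒵) : Prop :=
  ∀ (n : ℕ) (i : Fin n), Measurable fun d : (Fin n → G) × (Fin n → 𝒵) => r n d.1 d.2 (d.2 i)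

/-- `f̂⁽ⁿ⁾(z_i)`, where `f̂⁽ⁿ⁾` regresses the `x_i` on the `z_i`. -/
def fitX (fhat : RegMethod E 𝒵) {n : ℕ} (d : Fin n → E × F × 𝒵) (i : Fin n) : E :=
  fhat n (fun j => (d j).1) (fun j => (d j).2.2) (d i).2.2

/-- `ĝ⁽ⁿ⁾(z_i)`, where `ĝ⁽ⁿ⁾` regresses the `y_i` on the `z_i`. -/
def fitY (ghat : RegMethod F 𝒵) {n : ℕ} (d : Fin n → E × F × 𝒵) (i : Fin n) : F :=
  ghat n (fun j => (d j).2.1) (fun j => (d j).2.2) (d i).2.2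

/-- `M_{n,P}^f`, the in-sample mean squared prediction error. -/
def mspeX (fhat : RegMethod E 𝒵) (n : ℕ) (P : ProbabilityMeasure (E × F × 𝒵))
    (d : Fin n → E × F × 𝒵) : ℝ≥0∞ :=
  (n : ℝ≥0∞)⁻¹ * ∑ i, ‖regX P (d i).2.2 - fitX fhat d i‖ₑ ^ 2

/-- `M_{n,P}^g`. -/
def mspeY (ghat : RegMethod F 𝒵) (n : ℕ) (P : ProbabilityMeasure (E × F × 𝒵))
    (d : Fin n → E × F × 𝒵) : ℝ≥0∞ :=
  (n : ℝ≥0∞)⁻¹ * ∑ i, ‖regY P (d i).2.2 - fitY ghat d i‖ₑ ^ 2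

/-- The weighted error of `f̂`, with weights `v_P(z_i)`. -/
def weightedMspeX (fhat : RegMethod E 𝒵) (n : ℕ) (P : ProbabilityMeasure (E × F × 𝒵))
    (d : Fin n → E × F × 𝒵) : ℝ≥0∞ :=
  (n : ℝ≥0∞)⁻¹ * ∑ i, ‖regX P (d i).2.2 - fitX fhat d i‖ₑ ^ 2 * condVarY P (d i).2.2

/-- The weighted error of `ĝ`, with weights `u_P(z_i)`. -/
def weightedMspeY (ghat : RegMethod F 𝒵) (n : ℕ) (P : ProbabilityMeasure (E × F × 𝒵))
    (d : Fin n → E × F × 𝒵) : ℝ≥0∞ :=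
  (n : ℝ≥0∞)⁻¹ * ∑ i, ‖regY P (d i).2.2 - fitY ghat d i‖ₑ ^ 2 * condVarX P (d i).2.2

/-- The indices `1, …, d` (all positive integers if `d = ∞`) of a basis of a `d`-dimensional
separable Hilbert space. -/
abbrev BasisIndex (d : ℕ∞) : Type := {i : ℕ // 1 ≤ i ∧ (i : ℕ∞) ≤ d}

/-- The conditions on a set `S` of laws under which the operator-valued statistic is asymptotically
Gaussian, uniformly over `S`. -/
structure GHCMConditions (fhat : RegMethod E 𝒵) (ghat : RegMethod F 𝒵)
    (S : Set (ProbabilityMeasure (E × F × 𝒵))) : Prop where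
  prod_error : UnifTendstoZeroInProb S fun n P d => n * mspeX fhat n P d * mspeY ghat n P d
  weighted_errorX : UnifTendstoZeroInProb S (weightedMspeX fhat)
  weighted_errorY : UnifTendstoZeroInProb S (weightedMspeY ghat)
  moment_lower : 0 < ⨅ P ∈ S,
    ∫⁻ p, ‖noiseX P p‖ₑ ^ 2 * ‖noiseY P p‖ₑ ^ 2 ∂(P : Measure (E × F × 𝒵))
  moment_upper : ∃ η : ℝ, 0 < η ∧ (⨆ P ∈ S,
    ∫⁻ p, ‖noiseX P p‖ₑ ^ (2 + η) * ‖noiseY P p‖ₑ ^ (2 + η) ∂(P : Measure (E × F × 𝒵))) < ∞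
  tail : ∃ (dX dY : ℕ∞) (eX : HilbertBasis (BasisIndex dX) ℝ E)
    (eY : HilbertBasis (BasisIndex dY) ℝ F),
    Tendsto (fun K : ℕ => ⨆ P ∈ S,
      ∑' ij : {ij : BasisIndex dX × BasisIndex dY // K ≤ (ij.1 : ℕ) + (ij.2 : ℕ)},
        ∫⁻ p, ENNReal.ofReal (inner ℝ (eX ij.1.1) (noiseX P p) ^ 2 *
          inner ℝ (eY ij.1.2) (noiseY P p) ^ 2) ∂(P : Measure (E × F × 𝒵)))
      atTop (𝓝 0)

end Model

end

/-! Uniformity is reduced to sequences: it suffices to pick laws `P n` in `S` that nearly attain the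
supremum and to show that the rejection probability under `P n` tends to `α`. Along such a sequence
no Gaussian limit is identified. The law of the statistic is compared directly with the
data-dependent law that defines the critical value.

For fixed data the weighted chi-squared law is that of `‖∑ i, g i • a i‖ ^ 2`, where the `g i` are
independent standard Gaussian multipliers and the `a i` are the centred residual products divided by
`√(n - 1)`. This is a spectral computation, `infinitePi_chiSqOne_real_eq`. The critical value is
thus a quantile of a Gaussian multiplier bootstrap, and two facts are needed: the conditional
multiplier law and the law of `T_n` merge in probability, and their common limits have no atoms.

Merging is tested on `exp (-k ‖x‖ ^ 2)` for natural `k`. Such a function is smooth with derivatives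
bounded independently of the dimension, so a Lindeberg exchange works in any inner product space and
needs only moments of order above two. Exchanging single sums controls the mean of the conditional
Laplace transform. Exchanging pairs in `H × H` controls its mean square, because the square involves
two multiplier copies over one sample. Together they give concentration
(`integral_multLaplace_sub_sq_le`). The expectations for varying `k` are the moments of the `[0,
1]`-valued variable `exp (-T_n)`, so Weierstrass approximation passes to all continuous functions.

The exchange concerns the i.i.d. products `ε ⊗ ξ`. Replacing them by residual products costs three
remainders. In the two mixed ones the regression error is a function of `(X, Z)` (respectively `(Y,
Z)`) and multiplies noise that conditional independence keeps centred given these variables, so the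
summands are orthogonal (`IsCenteredGiven.lintegral_norm_sq_sum_outer_le`). The product of the two
errors is bounded by Cauchy–Schwarz (`smallInProb_remainders`).

Limits are taken along ultrafilters, where the laws of `exp (-T_n)` converge to some `ν` on `[0, 1]`
by compactness. An atom at `0` would mean that `T_n` escapes to infinity, which the second moment
forbids. At other points, the lower bound on the covariance operator gives a multiplier sum with an
eigenvalue bounded below, hence anti-concentration (`nullSingletonClass_limit`). With a continuous
limiting distribution function the empirical quantile is squeezed between deterministic levels
(`tendsto_measureReal_reject_of_limit`). -/

set_option linter.unusedSectionVars false

noncomputable section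

/-! ### A smooth test function on an inner product space and the Lindeberg exchange method -/

section Lindeberg

variable {H : Type*} [NormedAddCommGroup H] [InnerProductSpace ℝ H]

/-- The test function `x ↦ exp (-‖x‖ ^ 2)`. -/
def expNegSq (x : H) : ℝ := Real.exp (-‖x‖ ^ 2)

theorem expNegSq_pos (x : H) : 0 < expNegSq x := Real.exp_pos _

theorem expNegSq_le_one (x : H) : expNegSq x ≤ 1 :=
  Real.exp_le_one_iff.2 (neg_nonpos.2 (sq_nonneg _))

theorem abs_expNegSq_le_one (x : H) : |expNegSq x| ≤ 1 := by
  rw [abs_of_pos (expNegSq_pos x)]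
  exact expNegSq_le_one x

theorem continuous_expNegSq : Continuous (expNegSq : H → ℝ) := by
  unfold expNegSq
  fun_prop

theorem abs_sub_le_of_hasDerivAt_unit {F F' : ℝ → ℝ} {C : ℝ}
    (hF : ∀ t, HasDerivAt F (F' t) t) (hC : ∀ t ∈ Set.Icc (0 : ℝ) 1, |F' t| ≤ C)
    {t : ℝ} (ht : t ∈ Set.Icc (0 : ℝ) 1) : |F t - F 0| ≤ C := by
  have h := (convex_Icc (0 : ℝ) 1).norm_image_sub_le_of_norm_hasDerivWithin_le
    (fun s _ => (hF s).hasDerivWithinAt) hC (Set.left_mem_Icc.2 zero_le_one) ht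
  have hC0 : 0 ≤ C := (abs_nonneg _).trans (hC t ht)
  rw [Real.norm_eq_abs, sub_zero, Real.norm_eq_abs, abs_of_nonneg ht.1] at h
  exact h.trans (mul_le_of_le_one_right hC0 ht.2)

/-- This and the next two bounds absorb the powers of `‖x‖` produced by differentiating `expNegSq`,
which makes the derivative bounds uniform in `x`. -/
theorem sq_mul_exp_neg_sq_le (r : ℝ) : r ^ 2 * Real.exp (-r ^ 2) ≤ 1 := by
  rw [Real.exp_neg, ← div_eq_mul_inv, div_le_one (Real.exp_pos _)]
  linarith [Real.add_one_le_exp (r ^ 2)]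

theorem mul_exp_neg_sq_le (r : ℝ) : r * Real.exp (-r ^ 2) ≤ 1 := by
  rw [Real.exp_neg, ← div_eq_mul_inv, div_le_one (Real.exp_pos _)]
  nlinarith [Real.add_one_le_exp (r ^ 2), sq_nonneg (r - 1)]

theorem cube_mul_exp_neg_sq_le (r : ℝ) : r ^ 3 * Real.exp (-r ^ 2) ≤ 1 := by
  rw [Real.exp_neg, ← div_eq_mul_inv, div_le_one (Real.exp_pos _)]
  nlinarith [Real.quadratic_le_exp_of_nonneg (sq_nonneg r), mul_nonneg (sq_nonneg r) (sq_nonneg (r - 1)),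
    sq_nonneg r]

/-- Second order Taylor polynomial of `expNegSq` at `x`. -/
def expNegSqTaylor (x v : H) : ℝ :=
  expNegSq x - 2 * inner ℝ x v * expNegSq x + (2 * inner ℝ x v ^ 2 - ‖v‖ ^ 2) * expNegSq x

/-- Along the segment from `x` to `x + v` the second and third derivatives are polynomials in `⟪x +
t v, v⟫` and `‖v‖` times the exponential, hence `O(‖v‖ ^ 2)` and `O(‖v‖ ^ 3)` with absolute
constants. Having both orders inside the minimum is what later allows moments of any order between
two and three. -/
theorem abs_expNegSq_add_sub_taylor_le (x v : H) :
    |expNegSq (x + v) - expNegSqTaylor x v| ≤ 20 * min (‖v‖ ^ 2) (‖v‖ ^ 3) := by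
  set φ : ℝ → ℝ := fun t => expNegSq (x + t • v) with hφ
  set b : ℝ → ℝ := fun t => inner ℝ (x + t • v) v with hb
  have hbt : ∀ t, HasDerivAt b (‖v‖ ^ 2) t := by
    intro t
    have h1 : b = fun t => inner ℝ x v + t * ‖v‖ ^ 2 := by
      funext t
      simp [hb, inner_add_left, real_inner_smul_left]
    rw [h1]
    simpa using ((hasDerivAt_id t).mul_const (‖v‖ ^ 2)).const_add (inner ℝ x v)
  have hn : ∀ t : ℝ, HasDerivAt (fun t : ℝ => ‖x + t • v‖ ^ 2) (2 * b t) t := by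
    intro t
    have h1 : HasDerivAt (fun t : ℝ => x + t • v) v t := by
      simpa using ((hasDerivAt_id t).smul_const v).const_add x
    exact h1.norm_sq
  have h0 : ∀ t, HasDerivAt φ (-2 * b t * φ t) t := by
    intro t
    have := (hn t).neg.exp
    refine this.congr_deriv ?_
    simp only [hφ, expNegSq, Pi.neg_apply]
    ring
  have h1 : ∀ t, HasDerivAt (fun t => -2 * b t * φ t) ((4 * b t ^ 2 - 2 * ‖v‖ ^ 2) * φ t) t := by
    intro t
    refine (((hbt t).const_mul (-2)).mul (h0 t)).congr_deriv ?_
    ring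
  have h2 : ∀ t, HasDerivAt (fun t => (4 * b t ^ 2 - 2 * ‖v‖ ^ 2) * φ t)
      ((12 * ‖v‖ ^ 2 * b t - 8 * b t ^ 3) * φ t) t := by
    intro t
    refine (((((hbt t).pow 2).const_mul 4).sub_const (2 * ‖v‖ ^ 2)).mul (h0 t)).congr_deriv ?_
    simp only [Pi.pow_apply]
    ring
  have hφ0 : ∀ t, 0 < φ t := fun t => expNegSq_pos _
  have hbb : ∀ t, |b t| ≤ ‖x + t • v‖ * ‖v‖ := fun t => abs_real_inner_le_norm _ _
  have b2 : ∀ t, |(4 * b t ^ 2 - 2 * ‖v‖ ^ 2) * φ t| ≤ 6 * ‖v‖ ^ 2 := by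
    intro t
    rw [abs_mul, abs_of_pos (hφ0 t)]
    have e1 : |4 * b t ^ 2 - 2 * ‖v‖ ^ 2| ≤ (4 * ‖x + t • v‖ ^ 2 + 2) * ‖v‖ ^ 2 := by
      have : b t ^ 2 ≤ (‖x + t • v‖ * ‖v‖) ^ 2 := sq_le_sq' (by linarith [neg_abs_le (b t), hbb t])
        ((le_abs_self _).trans (hbb t))
      rw [abs_le]
      constructor <;> nlinarith [sq_nonneg (b t), sq_nonneg ‖v‖, sq_nonneg (‖x + t • v‖ * ‖v‖)]
    have e2 := sq_mul_exp_neg_sq_le ‖x + t • v‖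
    have e3 : φ t ≤ 1 := expNegSq_le_one _
    calc _ ≤ (4 * ‖x + t • v‖ ^ 2 + 2) * ‖v‖ ^ 2 * φ t :=
          mul_le_mul_of_nonneg_right e1 (hφ0 t).le
      _ = (4 * (‖x + t • v‖ ^ 2 * φ t) + 2 * φ t) * ‖v‖ ^ 2 := by ring
      _ ≤ 6 * ‖v‖ ^ 2 := by
          refine mul_le_mul_of_nonneg_right ?_ (sq_nonneg _)
          have : ‖x + t • v‖ ^ 2 * φ t ≤ 1 := e2
          linarith
  have b3 : ∀ t, |(12 * ‖v‖ ^ 2 * b t - 8 * b t ^ 3) * φ t| ≤ 20 * ‖v‖ ^ 3 := by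
    intro t
    rw [abs_mul, abs_of_pos (hφ0 t)]
    set r := ‖x + t • v‖ with hr
    have e1 : |12 * ‖v‖ ^ 2 * b t - 8 * b t ^ 3| ≤ (12 * r + 8 * r ^ 3) * ‖v‖ ^ 3 := by
      calc _ ≤ |12 * ‖v‖ ^ 2 * b t| + |8 * b t ^ 3| := abs_sub _ _
        _ = 12 * ‖v‖ ^ 2 * |b t| + 8 * |b t| ^ 3 := by
          rw [abs_mul, abs_mul, abs_mul, abs_pow, abs_pow, abs_norm]
          norm_num
        _ ≤ 12 * ‖v‖ ^ 2 * (r * ‖v‖) + 8 * (r * ‖v‖) ^ 3 := by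
          gcongr <;> exact hbb t
        _ = _ := by ring
    have e2 : r * φ t ≤ 1 := mul_exp_neg_sq_le r
    have e3 : r ^ 3 * φ t ≤ 1 := cube_mul_exp_neg_sq_le r
    calc _ ≤ (12 * r + 8 * r ^ 3) * ‖v‖ ^ 3 * φ t :=
          mul_le_mul_of_nonneg_right e1 (hφ0 t).le
      _ = (12 * (r * φ t) + 8 * (r ^ 3 * φ t)) * ‖v‖ ^ 3 := by ring
      _ ≤ 20 * ‖v‖ ^ 3 := by
          refine mul_le_mul_of_nonneg_right ?_ (by positivity)
          linarith
  have hone : (1 : ℝ) ∈ Set.Icc (0 : ℝ) 1 := ⟨zero_le_one, le_rfl⟩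
  set p1 : ℝ := -2 * b 0 * φ 0 with hp1
  set p2 : ℝ := (4 * b 0 ^ 2 - 2 * ‖v‖ ^ 2) * φ 0 with hp2
  have second : |φ 1 - φ 0 - p1| ≤ 6 * ‖v‖ ^ 2 := by
    have := abs_sub_le_of_hasDerivAt_unit (F := fun t => φ t - t * p1)
      (F' := fun t => -2 * b t * φ t - p1)
      (fun t => ((h0 t).sub ((hasDerivAt_id t).mul_const p1)).congr_deriv (by simp))
      (fun t ht => abs_sub_le_of_hasDerivAt_unit h1 (fun s _ => b2 s) ht) hone
    simp only [one_mul, zero_mul, sub_zero] at this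
    convert this using 2
    ring
  -- The mean value inequality is applied three times, each time after subtracting the next Taylor
  -- term; the factor `1/6` is given away. The constant is `12 + 8` from the third derivative.
  have third : |φ 1 - φ 0 - p1 - p2 / 2| ≤ 20 * ‖v‖ ^ 3 := by
    have := abs_sub_le_of_hasDerivAt_unit (F := fun t => φ t - t * p1 - t ^ 2 / 2 * p2)
      (F' := fun t => -2 * b t * φ t - p1 - t * p2) (C := 20 * ‖v‖ ^ 3)
      (fun t => by
        have := ((h0 t).sub ((hasDerivAt_id t).mul_const p1)).sub
          ((((hasDerivAt_id t).pow 2).div_const 2).mul_const p2)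
        refine this.congr_deriv ?_
        simp)
      (fun t ht => by
        have := abs_sub_le_of_hasDerivAt_unit (F := fun t => -2 * b t * φ t - t * p2)
          (F' := fun t => (4 * b t ^ 2 - 2 * ‖v‖ ^ 2) * φ t - p2) (C := 20 * ‖v‖ ^ 3)
          (fun t => ((h1 t).sub ((hasDerivAt_id t).mul_const p2)).congr_deriv (by simp))
          (fun t ht => abs_sub_le_of_hasDerivAt_unit h2 (fun s _ => b3 s) ht) ht
        simp only [zero_mul, sub_zero] at this
        convert this using 2
        ring) hone
    norm_num at this
    convert this using 2
    ring
  have key : expNegSq (x + v) - expNegSqTaylor x v = φ 1 - φ 0 - p1 - p2 / 2 := by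
    simp only [hφ, hp1, hp2, hb, expNegSqTaylor]
    simp
    ring
  rw [key, mul_min_of_nonneg _ _ (by norm_num : (0 : ℝ) ≤ 20), le_min_iff]
  refine ⟨?_, third⟩
  have hp2' : |p2 / 2| ≤ 3 * ‖v‖ ^ 2 := by
    rw [abs_div, abs_two]
    linarith [b2 0]
  calc _ ≤ |φ 1 - φ 0 - p1| + |p2 / 2| := abs_sub _ _
    _ ≤ 6 * ‖v‖ ^ 2 + 3 * ‖v‖ ^ 2 := add_le_add second hp2'
    _ ≤ 20 * ‖v‖ ^ 2 := by nlinarith [sq_nonneg ‖v‖]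

theorem min_sq_cube_le_rpow {r p : ℝ} (hr : 0 ≤ r) (hp : p ∈ Set.Icc (2 : ℝ) 3) :
    min (r ^ 2) (r ^ 3) ≤ r ^ p := by
  rcases le_total r 1 with h | h
  · refine (min_le_right _ _).trans ?_
    rcases hr.eq_or_lt with rfl | h0
    · simpa using Real.rpow_nonneg le_rfl p
    rw [← Real.rpow_natCast r 3]
    exact Real.rpow_le_rpow_of_exponent_ge h0 h (by exact_mod_cast hp.2)
  · refine (min_le_left _ _).trans ?_
    rw [← Real.rpow_natCast r 2]
    exact Real.rpow_le_rpow_of_exponent_le h (by exact_mod_cast hp.1)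

theorem sq_le_one_add_rpow {r p : ℝ} (hr : 0 ≤ r) (hp : 2 ≤ p) : r ^ 2 ≤ 1 + r ^ p := by
  rcases le_total r 1 with h | h
  · have := Real.rpow_nonneg hr p
    nlinarith
  · rw [← Real.rpow_natCast r 2]
    have := Real.rpow_le_rpow_of_exponent_le h (y := ((2 : ℕ) : ℝ)) (by exact_mod_cast hp)
    linarith

variable {Ω Ω' : Type*} [MeasurableSpace Ω] [MeasurableSpace Ω']

theorem integrable_norm_sq_of_rpow {μ : Measure Ω} [IsFiniteMeasure μ] {X : Ω → H}
    (hX : StronglyMeasurable X) {p : ℝ} (hp : 2 ≤ p) (hXp : Integrable (fun ω => ‖X ω‖ ^ p) μ) :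
    Integrable (fun ω => ‖X ω‖ ^ 2) μ := by
  refine ((integrable_const (1 : ℝ)).add hXp).mono' (hX.norm.pow 2).aestronglyMeasurable
    (ae_of_all _ fun ω => ?_)
  rw [Real.norm_eq_abs, abs_of_nonneg (sq_nonneg _)]
  exact sq_le_one_add_rpow (norm_nonneg _) hp

theorem integrable_inner_of_norm_sq {μ : Measure Ω} [IsFiniteMeasure μ] {X : Ω → H}
    (hX : StronglyMeasurable X) (h2 : Integrable (fun ω => ‖X ω‖ ^ 2) μ) (x : H) :
    Integrable (fun ω => inner ℝ x (X ω)) μ := by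
  refine ((integrable_const (‖x‖ ^ 2)).add h2).mono'
    (stronglyMeasurable_const.inner hX).aestronglyMeasurable (ae_of_all _ fun ω => ?_)
  refine (abs_real_inner_le_norm _ _).trans ?_
  simp only [Pi.add_apply]
  nlinarith [sq_nonneg (‖x‖ - ‖X ω‖), sq_nonneg ‖x‖, sq_nonneg ‖X ω‖]

theorem integrable_inner_sq_of_norm_sq {μ : Measure Ω} {X : Ω → H}
    (hX : StronglyMeasurable X) (h2 : Integrable (fun ω => ‖X ω‖ ^ 2) μ) (x : H) :
    Integrable (fun ω => inner ℝ x (X ω) ^ 2) μ := by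
  refine (h2.const_mul (‖x‖ ^ 2)).mono'
    ((stronglyMeasurable_const.inner hX).pow 2).aestronglyMeasurable (ae_of_all _ fun ω => ?_)
  rw [Real.norm_eq_abs, abs_of_nonneg (sq_nonneg _), ← mul_pow, ← sq_abs]
  exact pow_le_pow_left₀ (abs_nonneg _) (abs_real_inner_le_norm _ _) 2

theorem integrable_expNegSq {μ : Measure Ω} [IsFiniteMeasure μ] {X : Ω → H}
    (hX : StronglyMeasurable X) : Integrable (fun ω => expNegSq (X ω)) μ :=
  (integrable_const (1 : ℝ)).mono' (continuous_expNegSq.comp_stronglyMeasurable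
    hX).aestronglyMeasurable (ae_of_all _ fun _ => abs_expNegSq_le_one _)

theorem integrable_expNegSqTaylor {μ : Measure Ω} [IsFiniteMeasure μ] {X : Ω → H}
    (hX : StronglyMeasurable X) (h2 : Integrable (fun ω => ‖X ω‖ ^ 2) μ) (x : H) :
    Integrable (fun ω => expNegSqTaylor x (X ω)) μ :=
  ((integrable_const _).sub (((integrable_inner_of_norm_sq hX h2 x).const_mul 2).mul_const _)).add
    ((((integrable_inner_sq_of_norm_sq hX h2 x).const_mul 2).sub h2).mul_const _)

/-- The law of `X` enters only through the mean of `⟪x, X⟫`, the mean of its square and the mean of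
`‖X‖ ^ 2`; these are the quantities that two exchanged vectors must share. -/
theorem integral_expNegSqTaylor {μ : Measure Ω} [IsProbabilityMeasure μ] {X : Ω → H}
    (hX : StronglyMeasurable X) (h2 : Integrable (fun ω => ‖X ω‖ ^ 2) μ) (x : H) :
    ∫ ω, expNegSqTaylor x (X ω) ∂μ = expNegSq x - 2 * (∫ ω, inner ℝ x (X ω) ∂μ) * expNegSq x +
      (2 * (∫ ω, inner ℝ x (X ω) ^ 2 ∂μ) - ∫ ω, ‖X ω‖ ^ 2 ∂μ) * expNegSq x := by
  have i1 := integrable_inner_of_norm_sq hX h2 x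
  have i2 := integrable_inner_sq_of_norm_sq hX h2 x
  have j1 : Integrable (fun ω => 2 * inner ℝ x (X ω) * expNegSq x) μ :=
    (i1.const_mul 2).mul_const _
  have j2 : Integrable (fun ω => 2 * inner ℝ x (X ω) ^ 2 - ‖X ω‖ ^ 2) μ := (i2.const_mul 2).sub h2
  have j0 : Integrable (fun ω => expNegSq x - 2 * inner ℝ x (X ω) * expNegSq x) μ :=
    (integrable_const _).sub j1
  unfold expNegSqTaylor
  rw [integral_add j0 (j2.mul_const _), integral_sub (integrable_const _) j1, integral_mul_const,
    integral_const_mul, integral_mul_const, integral_sub (i2.const_mul 2) h2, integral_const_mul]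
  simp

theorem abs_integral_expNegSq_sub_taylor_le {μ : Measure Ω} [IsProbabilityMeasure μ] {X : Ω → H}
    (hX : StronglyMeasurable X) {p : ℝ} (hp : p ∈ Set.Icc (2 : ℝ) 3)
    (hXp : Integrable (fun ω => ‖X ω‖ ^ p) μ) (x : H) :
    |∫ ω, expNegSq (x + X ω) ∂μ - ∫ ω, expNegSqTaylor x (X ω) ∂μ| ≤ 20 * ∫ ω, ‖X ω‖ ^ p ∂μ := by
  have h2 := integrable_norm_sq_of_rpow hX hp.1 hXp
  have hi : Integrable (fun ω => expNegSq (x + X ω)) μ :=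
    integrable_expNegSq (stronglyMeasurable_const.add hX)
  rw [← integral_sub hi (integrable_expNegSqTaylor hX h2 x),
    ← integral_const_mul (20 : ℝ) (fun ω => ‖X ω‖ ^ p)]
  rw [← Real.norm_eq_abs]
  refine norm_integral_le_of_norm_le (hXp.const_mul 20) (ae_of_all _ fun ω => ?_)
  refine (abs_expNegSq_add_sub_taylor_le x (X ω)).trans ?_
  exact mul_le_mul_of_nonneg_left (min_sq_cube_le_rpow (norm_nonneg _) hp) (by norm_num)

/-- One exchange step: random vectors with equal first and second moments. -/
theorem abs_integral_expNegSq_sub_le {μ : Measure Ω} {ν : Measure Ω'} [IsProbabilityMeasure μ]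
    [IsProbabilityMeasure ν] {X : Ω → H} {Y : Ω' → H}
    (hX : StronglyMeasurable X) (hY : StronglyMeasurable Y) {p : ℝ} (hp : p ∈ Set.Icc (2 : ℝ) 3)
    (hXp : Integrable (fun ω => ‖X ω‖ ^ p) μ) (hYp : Integrable (fun ω => ‖Y ω‖ ^ p) ν)
    (h1 : ∀ x, ∫ ω, inner ℝ x (X ω) ∂μ = ∫ ω, inner ℝ x (Y ω) ∂ν)
    (h2 : ∀ x, ∫ ω, inner ℝ x (X ω) ^ 2 ∂μ = ∫ ω, inner ℝ x (Y ω) ^ 2 ∂ν)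
    (h3 : ∫ ω, ‖X ω‖ ^ 2 ∂μ = ∫ ω, ‖Y ω‖ ^ 2 ∂ν) (x : H) :
    |∫ ω, expNegSq (x + X ω) ∂μ - ∫ ω, expNegSq (x + Y ω) ∂ν| ≤
      20 * (∫ ω, ‖X ω‖ ^ p ∂μ + ∫ ω, ‖Y ω‖ ^ p ∂ν) := by
  have e : ∫ ω, expNegSqTaylor x (X ω) ∂μ = ∫ ω, expNegSqTaylor x (Y ω) ∂ν := by
    rw [integral_expNegSqTaylor hX (integrable_norm_sq_of_rpow hX hp.1 hXp),
      integral_expNegSqTaylor hY (integrable_norm_sq_of_rpow hY hp.1 hYp), h1, h2, h3]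
  have a1 := abs_integral_expNegSq_sub_taylor_le hX hp hXp x
  have a2 := abs_integral_expNegSq_sub_taylor_le hY hp hYp x
  rw [abs_le] at *
  constructor <;> linarith

theorem abs_integral_le_of_abs_le {μ : Measure Ω} [IsProbabilityMeasure μ] {F : Ω → ℝ} {C : ℝ}
    (h : ∀ ω, |F ω| ≤ C) : |∫ ω, F ω ∂μ| ≤ C := by
  have := norm_integral_le_of_norm_le_const (μ := μ) (f := F) (C := C) (ae_of_all _ h)
  rwa [probReal_univ, mul_one] at this

theorem stronglyMeasurable_sum_eval {X : Ω → H} (hX : StronglyMeasurable X) (n : ℕ) :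
    StronglyMeasurable fun ω : Fin n → Ω => ∑ i, X (ω i) :=
  Finset.stronglyMeasurable_fun_sum _ fun i _ => hX.comp_measurable (measurable_pi_apply i)

theorem integral_expNegSq_sum_succ {μ : Measure Ω} [IsProbabilityMeasure μ] (X : Ω → H)
    (n : ℕ) (x : H) :
    ∫ ω : Fin (n + 1) → Ω, expNegSq (x + ∑ i, X (ω i)) ∂(Measure.pi fun _ => μ) =
      ∫ q : Ω × (Fin n → Ω), expNegSq (x + X q.1 + ∑ i, X (q.2 i))
        ∂(μ.prod (Measure.pi fun _ => μ)) := by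
  rw [← (measurePreserving_piFinSuccAbove (fun _ : Fin (n + 1) => μ) 0).integral_comp'
    (fun q : Ω × (Fin n → Ω) => expNegSq (x + X q.1 + ∑ i, X (q.2 i)))]
  refine integral_congr_ae (ae_of_all _ fun ω => ?_)
  simp only [Fin.sum_univ_succ, MeasurableEquiv.piFinSuccAbove_apply, add_assoc]
  rfl

/-- The Lindeberg exchange bound for sums of i.i.d. vectors. -/
theorem abs_integral_expNegSq_sum_sub_le {μ : Measure Ω} {ν : Measure Ω'} [IsProbabilityMeasure μ]
    [IsProbabilityMeasure ν] {X : Ω → H} {Y : Ω' → H}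
    (hX : StronglyMeasurable X) (hY : StronglyMeasurable Y) {δ : ℝ}
    (hδ : ∀ x, |∫ ω, expNegSq (x + X ω) ∂μ - ∫ ω, expNegSq (x + Y ω) ∂ν| ≤ δ) (n : ℕ) (x : H) :
    |∫ ω : Fin n → Ω, expNegSq (x + ∑ i, X (ω i)) ∂(Measure.pi fun _ => μ) -
      ∫ ω : Fin n → Ω', expNegSq (x + ∑ i, Y (ω i)) ∂(Measure.pi fun _ => ν)| ≤ n * δ := by
  induction n generalizing x with
  | zero => simp
  | succ n ih =>
    rw [integral_expNegSq_sum_succ, integral_expNegSq_sum_succ]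
    have hS := stronglyMeasurable_sum_eval hX n
    have hT := stronglyMeasurable_sum_eval hY n
    have hXi : Integrable (fun q : Ω × (Fin n → Ω) => expNegSq (x + X q.1 + ∑ i, X (q.2 i)))
        (μ.prod (Measure.pi fun _ => μ)) := integrable_expNegSq
      ((stronglyMeasurable_const.add (hX.comp_measurable measurable_fst)).add
        (hS.comp_measurable measurable_snd))
    have hYi : Integrable (fun q : Ω' × (Fin n → Ω') => expNegSq (x + Y q.1 + ∑ i, Y (q.2 i)))
        (ν.prod (Measure.pi fun _ => ν)) := integrable_expNegSq
      ((stronglyMeasurable_const.add (hY.comp_measurable measurable_fst)).add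
        (hT.comp_measurable measurable_snd))
    have hZi : Integrable (fun q : Ω' × (Fin n → Ω) => expNegSq (x + Y q.1 + ∑ i, X (q.2 i)))
        (ν.prod (Measure.pi fun _ => μ)) := integrable_expNegSq
      ((stronglyMeasurable_const.add (hY.comp_measurable measurable_fst)).add
        (hS.comp_measurable measurable_snd))
    have hmid := integral_prod _ hZi
    rw [integral_prod_symm _ hXi, integral_prod _ hYi]
    have hmid' := integral_prod_symm _ hZi
    -- The hybrid with one `Y` and `n` variables `X` sits in between. First the leading summand is
    -- exchanged with the others frozen; then the induction hypothesis is applied at the shifted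
    -- point `x + Y y`.
    have A : |∫ y : Fin n → Ω, ∫ ω, expNegSq (x + X ω + ∑ i, X (y i)) ∂μ
          ∂(Measure.pi fun _ => μ) -
        ∫ y : Fin n → Ω, ∫ ω, expNegSq (x + Y ω + ∑ i, X (y i)) ∂ν
          ∂(Measure.pi fun _ => μ)| ≤ δ := by
      rw [← integral_sub hXi.integral_prod_right hZi.integral_prod_right]
      refine abs_integral_le_of_abs_le fun y => ?_
      convert hδ (x + ∑ i, X (y i)) using 5 <;> abel_nf
    have B : |∫ ω, ∫ y : Fin n → Ω, expNegSq (x + Y ω + ∑ i, X (y i)) ∂(Measure.pi fun _ => μ)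
          ∂ν - ∫ ω, ∫ y : Fin n → Ω', expNegSq (x + Y ω + ∑ i, Y (y i))
            ∂(Measure.pi fun _ => ν) ∂ν| ≤ n * δ := by
      rw [← integral_sub hZi.integral_prod_left hYi.integral_prod_left]
      refine abs_integral_le_of_abs_le fun y => ?_
      exact ih (x + Y y)
    rw [← hmid, hmid'] at B
    push_cast
    rw [abs_le] at *
    constructor <;> linarith

end Lindeberg

/-! ### Gaussian multipliers -/

section Multipliers

theorem integral_sq_gaussianReal : ∫ x, x ^ 2 ∂(gaussianReal 0 1) = 1 := by
  have h := variance_fun_id_gaussianReal (μ := 0) (v := 1)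
  rw [variance_of_integral_eq_zero (by fun_prop) (by simp)] at h
  simpa using h

theorem integrable_id_gaussianReal : Integrable (fun x : ℝ => x) (gaussianReal 0 1) :=
  memLp_one_iff_integrable.1 (memLp_id_gaussianReal 1)

theorem integrable_sq_gaussianReal : Integrable (fun x : ℝ => x ^ 2) (gaussianReal 0 1) :=
  (memLp_id_gaussianReal 2).integrable_sq

theorem integrable_cube_gaussianReal : Integrable (fun x : ℝ => |x| ^ 3) (gaussianReal 0 1) := by
  have := (memLp_id_gaussianReal (μ := 0) (v := 1) 3).integrable_norm_pow (by norm_num)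
  simpa using this

/-- A common bound for the absolute moments of order between `2` and `3` of `N(0, 1)`. -/
def gaussMomentBound : ℝ := 1 + ∫ x, |x| ^ 3 ∂(gaussianReal 0 1)

theorem rpow_le_one_add_cube {r p : ℝ} (hr : 0 ≤ r) (hp : p ∈ Set.Icc (2 : ℝ) 3) :
    r ^ p ≤ 1 + r ^ 3 := by
  rcases le_total r 1 with h | h
  · have := Real.rpow_le_one hr h (by linarith [hp.1] : 0 ≤ p)
    have : 0 ≤ r ^ 3 := by positivity
    linarith
  · rw [← Real.rpow_natCast r 3]
    have := Real.rpow_le_rpow_of_exponent_le h (z := ((3 : ℕ) : ℝ)) (by exact_mod_cast hp.2)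
    linarith

theorem integrable_abs_rpow_gaussianReal {p : ℝ} (hp : p ∈ Set.Icc (2 : ℝ) 3) :
    Integrable (fun x : ℝ => |x| ^ p) (gaussianReal 0 1) := by
  refine ((integrable_const (1 : ℝ)).add integrable_cube_gaussianReal).mono'
    (measurable_id.abs.pow_const p).aestronglyMeasurable (ae_of_all _ fun x => ?_)
  rw [Real.norm_eq_abs, abs_of_nonneg (Real.rpow_nonneg (abs_nonneg _) _)]
  exact rpow_le_one_add_cube (abs_nonneg _) hp

theorem integral_abs_rpow_gaussianReal_le {p : ℝ} (hp : p ∈ Set.Icc (2 : ℝ) 3) :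
    ∫ x, |x| ^ p ∂(gaussianReal 0 1) ≤ gaussMomentBound := by
  have h := integral_mono (integrable_abs_rpow_gaussianReal hp)
    ((integrable_const (1 : ℝ)).add integrable_cube_gaussianReal)
    (fun x => rpow_le_one_add_cube (abs_nonneg x) hp)
  refine h.trans_eq ?_
  simp only [Pi.add_apply]
  rw [integral_add (integrable_const _) integrable_cube_gaussianReal]
  simp [gaussMomentBound]

theorem gaussMomentBound_nonneg : 0 ≤ gaussMomentBound :=
  add_nonneg zero_le_one (integral_nonneg fun _ => by positivity)

/-- The sum is at most twice the larger term and `2 ^ p ≤ 8`. Used for the norm of a pair in `H ×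
H`. -/
theorem add_rpow_le_eight {a b p : ℝ} (ha : 0 ≤ a) (hb : 0 ≤ b) (hp : p ∈ Set.Icc (2 : ℝ) 3) :
    (a + b) ^ p ≤ 8 * (a ^ p + b ^ p) := by
  wlog h : b ≤ a generalizing a b
  · rw [add_comm a b, add_comm (a ^ p)]
    exact this hb ha (le_of_not_ge h)
  have hp0 : 0 ≤ p := by linarith [hp.1]
  calc (a + b) ^ p ≤ (2 * a) ^ p := Real.rpow_le_rpow (by positivity) (by linarith) hp0
    _ = 2 ^ p * a ^ p := Real.mul_rpow (by norm_num) ha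
    _ ≤ 8 * a ^ p := by
        refine mul_le_mul_of_nonneg_right ?_ (Real.rpow_nonneg ha _)
        calc (2 : ℝ) ^ p ≤ 2 ^ (3 : ℝ) := Real.rpow_le_rpow_of_exponent_le (by norm_num) hp.2
          _ = 8 := by norm_num
    _ ≤ _ := by linarith [Real.rpow_nonneg hb p]

variable {H : Type*} [NormedAddCommGroup H] [InnerProductSpace ℝ H]
variable {Ω : Type*} [MeasurableSpace Ω]

/-- `E exp (-‖∑ i, g i • v i‖ ^ 2)` for independent standard Gaussian multipliers `g i`. -/
def multLaplace {n : ℕ} (v : Fin n → H) : ℝ :=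
  ∫ g : Fin n → ℝ, expNegSq (∑ i, g i • v i) ∂(Measure.pi fun _ => gaussianReal 0 1)

theorem abs_multLaplace_le_one {n : ℕ} (v : Fin n → H) : |multLaplace v| ≤ 1 :=
  abs_integral_le_of_abs_le fun _ => abs_expNegSq_le_one _

theorem stronglyMeasurable_mult {X : Ω → H} (hX : StronglyMeasurable X) (n : ℕ) :
    StronglyMeasurable fun q : (Fin n → Ω) × (Fin n → ℝ) => ∑ i, q.2 i • X (q.1 i) :=
  Finset.stronglyMeasurable_fun_sum _ fun i _ =>
    ((measurable_pi_apply i).comp measurable_snd).stronglyMeasurable.smul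
      (hX.comp_measurable ((measurable_pi_apply i).comp measurable_fst))

theorem stronglyMeasurable_multLaplace {X : Ω → H} (hX : StronglyMeasurable X) (n : ℕ) :
    StronglyMeasurable fun d : Fin n → Ω => multLaplace fun i => X (d i) :=
  StronglyMeasurable.integral_prod_right'
    (f := fun q : (Fin n → Ω) × (Fin n → ℝ) => expNegSq (∑ i, q.2 i • X (q.1 i)))
    (continuous_expNegSq.comp_stronglyMeasurable (stronglyMeasurable_mult hX n))

theorem integral_pi_prod {α β : Type*} [MeasurableSpace α] [MeasurableSpace β] {μ : Measure α}
    {ν : Measure β} [SigmaFinite μ] [SigmaFinite ν] {n : ℕ}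
    (F : (Fin n → α) × (Fin n → β) → ℝ) :
    ∫ ω : Fin n → α × β, F (fun i => (ω i).1, fun i => (ω i).2) ∂(Measure.pi fun _ => μ.prod ν) =
      ∫ q, F q ∂((Measure.pi fun _ => μ).prod (Measure.pi fun _ => ν)) :=
  (measurePreserving_arrowProdEquivProdArrow α β (Fin n) (fun _ => μ) fun _ => ν).integral_comp' F

/-! ### Exchanging a sum for its multiplier version, in mean and in mean square -/

section Moments

variable {μ : Measure Ω} [IsProbabilityMeasure μ] {X : Ω → H} (hX : StronglyMeasurable X)
  {p : ℝ} (hp : p ∈ Set.Icc (2 : ℝ) 3) (hXp : Integrable (fun ω => ‖X ω‖ ^ p) μ)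
  (h0 : ∀ x, ∫ ω, inner ℝ x (X ω) ∂μ = 0)

include hX hp hXp h0

/-- For a standard Gaussian `g` independent of the centred `X`, the vector `g • X` has the same mean
and the same second moments as `X`, so one exchange per summand applies. -/
theorem abs_integral_multLaplace_sub_le (n : ℕ) :
    |∫ d : Fin n → Ω, multLaplace (fun i => X (d i)) ∂(Measure.pi fun _ => μ) -
      ∫ d : Fin n → Ω, expNegSq (∑ i, X (d i)) ∂(Measure.pi fun _ => μ)| ≤
      n * (20 * (1 + gaussMomentBound) * ∫ ω, ‖X ω‖ ^ p ∂μ) := by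
  set Y : Ω × ℝ → H := fun q => q.2 • X q.1 with hYdef
  have hY : StronglyMeasurable Y := measurable_snd.stronglyMeasurable.smul
    (hX.comp_measurable measurable_fst)
  have hp0 : 0 ≤ p := by linarith [hp.1]
  have hXY : (fun q => ‖Y q‖ ^ p) = fun q : Ω × ℝ => ‖X q.1‖ ^ p * |q.2| ^ p := by
    funext q
    rw [hYdef, norm_smul, Real.mul_rpow (norm_nonneg _) (norm_nonneg _), mul_comm]
    rfl
  have hYp : Integrable (fun q => ‖Y q‖ ^ p) (μ.prod (gaussianReal 0 1)) := by
    rw [hXY]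
    exact hXp.mul_prod (integrable_abs_rpow_gaussianReal hp)
  have hYle : ∫ q, ‖Y q‖ ^ p ∂(μ.prod (gaussianReal 0 1)) ≤
      gaussMomentBound * ∫ ω, ‖X ω‖ ^ p ∂μ := by
    rw [hXY, integral_prod_mul (fun ω => ‖X ω‖ ^ p) (fun x : ℝ => |x| ^ p), mul_comm]
    exact mul_le_mul_of_nonneg_right (integral_abs_rpow_gaussianReal_le hp)
      (integral_nonneg fun _ => Real.rpow_nonneg (norm_nonneg _) _)
  have step := abs_integral_expNegSq_sub_le (ν := μ.prod (gaussianReal 0 1)) hX hY hp hXp hYp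
    (fun x => by
      simp only [hYdef, real_inner_smul_right, mul_comm (Prod.snd _)]
      rw [integral_prod_mul (fun ω => inner ℝ x (X ω)) (fun x : ℝ => x), h0]
      simp)
    (fun x => by
      simp only [hYdef, real_inner_smul_right, mul_pow, mul_comm (Prod.snd _ ^ 2)]
      rw [integral_prod_mul (fun ω => inner ℝ x (X ω) ^ 2) (fun x : ℝ => x ^ 2),
        integral_sq_gaussianReal, mul_one])
    (by
      simp only [hYdef, norm_smul, mul_pow, Real.norm_eq_abs, sq_abs, mul_comm (Prod.snd _ ^ 2)]
      rw [integral_prod_mul (fun ω => ‖X ω‖ ^ 2) (fun x : ℝ => x ^ 2),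
        integral_sq_gaussianReal, mul_one])
  have h := abs_integral_expNegSq_sum_sub_le hX hY step n 0
  simp only [zero_add] at h
  have e := integral_pi_prod (μ := μ) (ν := gaussianReal 0 1) (n := n)
    (fun q => expNegSq (∑ i, q.2 i • X (q.1 i)))
  have hi : Integrable (fun q : (Fin n → Ω) × (Fin n → ℝ) => expNegSq (∑ i, q.2 i • X (q.1 i)))
    ((Measure.pi fun _ => μ).prod (Measure.pi fun _ => gaussianReal 0 1)) :=
    integrable_expNegSq (stronglyMeasurable_mult hX n)
  rw [integral_prod _ hi] at e
  change ∫ ω : Fin n → Ω × ℝ, expNegSq (∑ i, Y (ω i)) ∂_ = _ at e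
  rw [e, abs_sub_comm] at h
  refine h.trans (mul_le_mul_of_nonneg_left ?_ (Nat.cast_nonneg n))
  linarith

/-- The squared conditional transform is an expectation over two independent multiplier vectors on
the same data. In `H × H` the exchange compares `(X, X')`, two independent copies, with `(g • X, g'
• X)`. The cross moments vanish on the first side because `X` is centred, and on the second because
`E (g g') = 0`. -/
theorem abs_integral_multLaplace_sq_sub_le (n : ℕ) :
    |∫ d : Fin n → Ω, multLaplace (fun i => X (d i)) ^ 2 ∂(Measure.pi fun _ => μ) -
      (∫ d : Fin n → Ω, expNegSq (∑ i, X (d i)) ∂(Measure.pi fun _ => μ)) ^ 2| ≤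
      n * (320 * (1 + gaussMomentBound) * ∫ ω, ‖X ω‖ ^ p ∂μ) := by
  have hp0 : 0 ≤ p := by linarith [hp.1]
  have hpair {Ω' : Type _} [MeasurableSpace Ω'] {A B : Ω' → H} (hA : StronglyMeasurable A)
      (hB : StronglyMeasurable B) :
      StronglyMeasurable fun ω => WithLp.toLp 2 (A ω, B ω) :=
    (WithLp.prod_continuous_toLp 2 H H).comp_stronglyMeasurable (hA.prodMk hB)
  have hnsq (a b : H) : ‖WithLp.toLp 2 (a, b)‖ ^ 2 = ‖a‖ ^ 2 + ‖b‖ ^ 2 := by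
    rw [← real_inner_self_eq_norm_sq, WithLp.prod_inner_apply]
    simp
  have hnle (a b : H) : ‖WithLp.toLp 2 (a, b)‖ ≤ ‖a‖ + ‖b‖ := by
    refine abs_le_of_sq_le_sq' ?_ (by positivity) |>.2
    rw [hnsq]
    nlinarith [norm_nonneg a, norm_nonneg b]
  have hnp (a b : H) : ‖WithLp.toLp 2 (a, b)‖ ^ p ≤ 8 * (‖a‖ ^ p + ‖b‖ ^ p) :=
    (Real.rpow_le_rpow (norm_nonneg _) (hnle a b) hp0).trans
      (add_rpow_le_eight (norm_nonneg _) (norm_nonneg _) hp)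
  have hexp (a b : H) : expNegSq (WithLp.toLp 2 (a, b)) = expNegSq a * expNegSq b := by
    simp only [expNegSq, hnsq, neg_add, Real.exp_add]
  have hin (x : WithLp 2 (H × H)) (a b : H) :
      inner ℝ x (WithLp.toLp 2 (a, b)) = inner ℝ x.fst a + inner ℝ x.snd b := by
    rw [WithLp.prod_inner_apply]
    rfl
  set γ := gaussianReal 0 1 with hγ
  set M := ∫ ω, ‖X ω‖ ^ p ∂μ with hM
  have hM0 : 0 ≤ M := integral_nonneg fun _ => Real.rpow_nonneg (norm_nonneg _) _
  have i2 := integrable_norm_sq_of_rpow hX hp.1 hXp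
  have j1 := fun x => integrable_inner_of_norm_sq hX i2 x
  have j2 := fun x => integrable_inner_sq_of_norm_sq hX i2 x
  set A : Ω × Ω → WithLp 2 (H × H) := fun q => WithLp.toLp 2 (X q.1, X q.2) with hAdef
  set B : Ω × (ℝ × ℝ) → WithLp 2 (H × H) :=
    fun q => WithLp.toLp 2 (q.2.1 • X q.1, q.2.2 • X q.1) with hBdef
  have hA : StronglyMeasurable A :=
    hpair (hX.comp_measurable measurable_fst) (hX.comp_measurable measurable_snd)
  have hB : StronglyMeasurable B :=
    hpair ((measurable_fst.comp measurable_snd).stronglyMeasurable.smul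
      (hX.comp_measurable measurable_fst))
      ((measurable_snd.comp measurable_snd).stronglyMeasurable.smul
      (hX.comp_measurable measurable_fst))
  have hAb : Integrable (fun q : Ω × Ω => 8 * (‖X q.1‖ ^ p + ‖X q.2‖ ^ p)) (μ.prod μ) :=
    ((hXp.comp_fst μ).add (hXp.comp_snd μ)).const_mul 8
  have hAp : Integrable (fun q => ‖A q‖ ^ p) (μ.prod μ) := by
    refine hAb.mono' (hA.norm.measurable.pow_const p).aestronglyMeasurable
      (ae_of_all _ fun q => ?_)
    rw [Real.norm_eq_abs, abs_of_nonneg (Real.rpow_nonneg (norm_nonneg _) _)]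
    exact hnp _ _
  have hAle : ∫ q, ‖A q‖ ^ p ∂(μ.prod μ) ≤ 16 * M := by
    refine (integral_mono hAp hAb fun q => hnp _ _).trans_eq ?_
    rw [integral_const_mul, integral_add (hXp.comp_fst μ) (hXp.comp_snd μ),
      integral_fun_fst (fun ω => ‖X ω‖ ^ p), integral_fun_snd (fun ω => ‖X ω‖ ^ p)]
    simp only [probReal_univ, one_smul]
    ring
  have g1 : Integrable (fun x : ℝ × ℝ => |x.1| ^ p + |x.2| ^ p) (γ.prod γ) :=
    ((integrable_abs_rpow_gaussianReal hp).comp_fst γ).add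
      ((integrable_abs_rpow_gaussianReal hp).comp_snd γ)
  have hBb : Integrable (fun q : Ω × (ℝ × ℝ) => ‖X q.1‖ ^ p * (8 * (|q.2.1| ^ p + |q.2.2| ^ p)))
      (μ.prod (γ.prod γ)) := hXp.mul_prod (g1.const_mul 8)
  have hBpt (q : Ω × (ℝ × ℝ)) : ‖B q‖ ^ p ≤ ‖X q.1‖ ^ p * (8 * (|q.2.1| ^ p + |q.2.2| ^ p)) := by
    refine (hnp _ _).trans_eq ?_
    rw [norm_smul, norm_smul, Real.mul_rpow (norm_nonneg _) (norm_nonneg _),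
      Real.mul_rpow (norm_nonneg _) (norm_nonneg _), Real.norm_eq_abs, Real.norm_eq_abs]
    ring
  have hBp : Integrable (fun q => ‖B q‖ ^ p) (μ.prod (γ.prod γ)) := by
    refine hBb.mono' (hB.norm.measurable.pow_const p).aestronglyMeasurable
      (ae_of_all _ fun q => ?_)
    rw [Real.norm_eq_abs, abs_of_nonneg (Real.rpow_nonneg (norm_nonneg _) _)]
    exact hBpt q
  have hBle : ∫ q, ‖B q‖ ^ p ∂(μ.prod (γ.prod γ)) ≤ 16 * gaussMomentBound * M := by
    refine (integral_mono hBp hBb hBpt).trans ?_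
    rw [integral_prod_mul (fun ω => ‖X ω‖ ^ p)
      (fun x : ℝ × ℝ => 8 * (|x.1| ^ p + |x.2| ^ p)), integral_const_mul,
      integral_add ((integrable_abs_rpow_gaussianReal hp).comp_fst γ)
      ((integrable_abs_rpow_gaussianReal hp).comp_snd γ),
      integral_fun_fst (fun x : ℝ => |x| ^ p), integral_fun_snd (fun x : ℝ => |x| ^ p)]
    simp only [probReal_univ, one_smul]
    have := mul_le_mul_of_nonneg_left (integral_abs_rpow_gaussianReal_le hp) hM0
    linarith
  -- The three moment conditions follow: linear functionals, their squares, squared norms.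
  have step := abs_integral_expNegSq_sub_le (μ := μ.prod μ) (ν := μ.prod (γ.prod γ)) hA hB hp
    hAp hBp
    (fun x => by
      simp only [hAdef, hBdef, hin, real_inner_smul_right]
      rw [integral_add ((j1 _).comp_fst μ) ((j1 _).comp_snd μ),
        integral_fun_fst (fun ω => inner ℝ x.fst (X ω)),
        integral_fun_snd (fun ω => inner ℝ x.snd (X ω)), h0, h0]
      have k1 := (j1 x.fst).mul_prod (integrable_id_gaussianReal.comp_fst γ)
      have k2 := (j1 x.snd).mul_prod (integrable_id_gaussianReal.comp_snd γ)
      simp only [mul_comm (Prod.fst _), mul_comm (Prod.snd _)]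
      rw [integral_add k1 k2,
        integral_prod_mul (fun ω => inner ℝ x.fst (X ω)) (fun x : ℝ × ℝ => x.1),
        integral_prod_mul (fun ω => inner ℝ x.snd (X ω)) (fun x : ℝ × ℝ => x.2), h0, h0]
      simp)
    (fun x => by
      have e1 (q : Ω × Ω) : inner ℝ x (A q) ^ 2 = inner ℝ x.fst (X q.1) ^ 2 +
          inner ℝ x.snd (X q.2) ^ 2 + 2 * (inner ℝ x.fst (X q.1) * inner ℝ x.snd (X q.2)) := by
        simp only [hAdef, hin]
        ring
      have e2 (q : Ω × (ℝ × ℝ)) : inner ℝ x (B q) ^ 2 =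
          inner ℝ x.fst (X q.1) ^ 2 * q.2.1 ^ 2 + inner ℝ x.snd (X q.1) ^ 2 * q.2.2 ^ 2 +
          2 * ((inner ℝ x.fst (X q.1) * inner ℝ x.snd (X q.1)) * (q.2.1 * q.2.2)) := by
        simp only [hBdef, hin, real_inner_smul_right]
        ring
      have j12 : Integrable (fun ω => inner ℝ x.fst (X ω) * inner ℝ x.snd (X ω)) μ := by
        refine ((j2 x.fst).add (j2 x.snd)).mono' (((stronglyMeasurable_const.inner hX).mul
          (stronglyMeasurable_const.inner hX)).aestronglyMeasurable) (ae_of_all _ fun ω => ?_)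
        simp only [Pi.add_apply, Real.norm_eq_abs]
        rw [abs_le]
        constructor <;> nlinarith [sq_nonneg (inner ℝ x.fst (X ω) - inner ℝ x.snd (X ω)),
          sq_nonneg (inner ℝ x.fst (X ω) + inner ℝ x.snd (X ω)),
          sq_nonneg (inner ℝ x.fst (X ω)), sq_nonneg (inner ℝ x.snd (X ω))]
      simp only [e1, e2]
      have k1 := (j2 x.fst).mul_prod (integrable_sq_gaussianReal.comp_fst γ)
      have k2 := (j2 x.snd).mul_prod (integrable_sq_gaussianReal.comp_snd γ)
      have k3 := (j12.mul_prod
        (integrable_id_gaussianReal.mul_prod integrable_id_gaussianReal)).const_mul 2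
      have l1 := (j2 x.fst).comp_fst μ
      have l2 := (j2 x.snd).comp_snd μ
      have l3 := ((j1 x.fst).mul_prod (j1 x.snd)).const_mul 2
      have l12 : Integrable (fun q : Ω × Ω => inner ℝ x.fst (X q.1) ^ 2 +
        inner ℝ x.snd (X q.2) ^ 2) (μ.prod μ) := l1.add l2
      have k12 : Integrable (fun q : Ω × (ℝ × ℝ) => inner ℝ x.fst (X q.1) ^ 2 * q.2.1 ^ 2 +
        inner ℝ x.snd (X q.1) ^ 2 * q.2.2 ^ 2) (μ.prod (γ.prod γ)) := k1.add k2
      rw [integral_add l12 l3, integral_add l1 l2, integral_add k12 k3,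
        integral_add k1 k2, integral_const_mul, integral_const_mul,
        integral_prod_mul (fun ω => inner ℝ x.fst (X ω)) (fun ω => inner ℝ x.snd (X ω)),
        integral_prod_mul (fun ω => inner ℝ x.fst (X ω) ^ 2) (fun x : ℝ × ℝ => x.1 ^ 2),
        integral_prod_mul (fun ω => inner ℝ x.snd (X ω) ^ 2) (fun x : ℝ × ℝ => x.2 ^ 2),
        integral_prod_mul (fun ω => inner ℝ x.fst (X ω) * inner ℝ x.snd (X ω))
          (fun x : ℝ × ℝ => x.1 * x.2), integral_prod_mul (fun x : ℝ => x) (fun x : ℝ => x),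
        integral_fun_fst (fun ω => inner ℝ x.fst (X ω) ^ 2),
        integral_fun_snd (fun ω => inner ℝ x.snd (X ω) ^ 2),
        integral_fun_fst (fun x : ℝ => x ^ 2), integral_fun_snd (fun x : ℝ => x ^ 2), h0, h0,
        integral_sq_gaussianReal]
      simp [hγ])
    (by
      simp only [hAdef, hBdef, hnsq, norm_smul, mul_pow, Real.norm_eq_abs, sq_abs]
      have k1 := i2.mul_prod (integrable_sq_gaussianReal.comp_fst γ)
      have k2 := i2.mul_prod (integrable_sq_gaussianReal.comp_snd γ)
      simp only [mul_comm (Prod.fst _ ^ 2), mul_comm (Prod.snd _ ^ 2)]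
      rw [integral_add (i2.comp_fst μ) (i2.comp_snd μ), integral_add k1 k2,
        integral_prod_mul (fun ω => ‖X ω‖ ^ 2) (fun x : ℝ × ℝ => x.1 ^ 2),
        integral_prod_mul (fun ω => ‖X ω‖ ^ 2) (fun x : ℝ × ℝ => x.2 ^ 2),
        integral_fun_fst (fun ω => ‖X ω‖ ^ 2), integral_fun_snd (fun ω => ‖X ω‖ ^ 2),
        integral_fun_fst (fun x : ℝ => x ^ 2), integral_fun_snd (fun x : ℝ => x ^ 2),
        integral_sq_gaussianReal]
      simp)
  have h := abs_integral_expNegSq_sum_sub_le hA hB step n 0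
  simp only [zero_add] at h
  have hsum {ι : Type} [Fintype ι] (a b : ι → H) :
      ∑ i, WithLp.toLp 2 (a i, b i) = WithLp.toLp 2 (∑ i, a i, ∑ i, b i) := by
    rw [← WithLp.toLp_sum]
    congr 1
    exact Prod.ext (Prod.fst_sum ..) (Prod.snd_sum ..)
  have eA : ∫ ω : Fin n → Ω × Ω, expNegSq (∑ i, A (ω i)) ∂(Measure.pi fun _ => μ.prod μ) =
      (∫ d : Fin n → Ω, expNegSq (∑ i, X (d i)) ∂(Measure.pi fun _ => μ)) ^ 2 := by
    simp only [hAdef, hsum, hexp]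
    rw [integral_pi_prod (μ := μ) (ν := μ) (n := n)
      (fun q => expNegSq (∑ i, X (q.1 i)) * expNegSq (∑ i, X (q.2 i))),
      integral_prod_mul (fun d : Fin n → Ω => expNegSq (∑ i, X (d i)))
        (fun d : Fin n → Ω => expNegSq (∑ i, X (d i))), sq]
  have eB : ∫ ω : Fin n → Ω × (ℝ × ℝ), expNegSq (∑ i, B (ω i))
        ∂(Measure.pi fun _ => μ.prod (γ.prod γ)) =
      ∫ d : Fin n → Ω, multLaplace (fun i => X (d i)) ^ 2 ∂(Measure.pi fun _ => μ) := by
    simp only [hBdef, hsum, hexp]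
    rw [integral_pi_prod (μ := μ) (ν := γ.prod γ) (n := n)
      (fun q => expNegSq (∑ i, (q.2 i).1 • X (q.1 i)) * expNegSq (∑ i, (q.2 i).2 • X (q.1 i))),
      integral_prod]
    · refine integral_congr_ae (ae_of_all _ fun d => ?_)
      simp only
      rw [integral_pi_prod (μ := γ) (ν := γ) (n := n)
        (fun q => expNegSq (∑ i, q.1 i • X (d i)) * expNegSq (∑ i, q.2 i • X (d i))),
        integral_prod_mul (fun g : Fin n → ℝ => expNegSq (∑ i, g i • X (d i)))
          (fun g : Fin n → ℝ => expNegSq (∑ i, g i • X (d i))), sq]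
      rfl
    · have m1 : StronglyMeasurable fun q : (Fin n → Ω) × (Fin n → ℝ × ℝ) =>
          ∑ i, (q.2 i).1 • X (q.1 i) :=
        Finset.stronglyMeasurable_fun_sum _ fun i _ =>
          (measurable_fst.comp ((measurable_pi_apply i).comp measurable_snd)).stronglyMeasurable.smul
            (hX.comp_measurable ((measurable_pi_apply i).comp measurable_fst))
      have m2 : StronglyMeasurable fun q : (Fin n → Ω) × (Fin n → ℝ × ℝ) =>
          ∑ i, (q.2 i).2 • X (q.1 i) :=
        Finset.stronglyMeasurable_fun_sum _ fun i _ =>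
          (measurable_snd.comp ((measurable_pi_apply i).comp measurable_snd)).stronglyMeasurable.smul
            (hX.comp_measurable ((measurable_pi_apply i).comp measurable_fst))
      simp only [← hexp]
      exact integrable_expNegSq (hpair m1 m2)
  rw [eA, eB, abs_sub_comm] at h
  refine h.trans (mul_le_mul_of_nonneg_left ?_ (Nat.cast_nonneg n))
  nlinarith [gaussMomentBound_nonneg]

/-- The conditional Laplace transform of the multiplier sum concentrates at the Laplace transform
of the original sum. -/
theorem integral_multLaplace_sub_sq_le (n : ℕ) :
    ∫ d : Fin n → Ω, (multLaplace (fun i => X (d i)) -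
      ∫ d : Fin n → Ω, expNegSq (∑ i, X (d i)) ∂(Measure.pi fun _ => μ)) ^ 2
        ∂(Measure.pi fun _ => μ) ≤
      n * (360 * (1 + gaussMomentBound) * ∫ ω, ‖X ω‖ ^ p ∂μ) := by
  have a1 := abs_integral_multLaplace_sub_le hX hp hXp h0 n
  have a2 := abs_integral_multLaplace_sq_sub_le hX hp hXp h0 n
  set m := ∫ d : Fin n → Ω, expNegSq (∑ i, X (d i)) ∂(Measure.pi fun _ => μ) with hm
  have hm1 : |m| ≤ 1 := abs_integral_le_of_abs_le fun _ => abs_expNegSq_le_one _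
  have hL := stronglyMeasurable_multLaplace hX n
  have i1 : Integrable (fun d : Fin n → Ω => multLaplace fun i => X (d i))
      (Measure.pi fun _ => μ) :=
    (integrable_const (1 : ℝ)).mono' hL.aestronglyMeasurable
      (ae_of_all _ fun d => abs_multLaplace_le_one _)
  have i2 : Integrable (fun d : Fin n → Ω => (multLaplace fun i => X (d i)) ^ 2)
      (Measure.pi fun _ => μ) :=
    (integrable_const (1 : ℝ)).mono' (hL.pow 2).aestronglyMeasurable
      (ae_of_all _ fun d => by
        simpa using pow_le_one₀ (n := 2) (abs_nonneg _) (abs_multLaplace_le_one fun i => X (d i)))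
  -- Expanding around `m` leaves one defect from the mean square and `2 m` times one from the mean.
  -- Since `|m| ≤ 1`, the constant is `360 = 320 + 2 * 20`.
  have e : ∫ d : Fin n → Ω, (multLaplace (fun i => X (d i)) - m) ^ 2 ∂(Measure.pi fun _ => μ) =
      (∫ d : Fin n → Ω, multLaplace (fun i => X (d i)) ^ 2 ∂(Measure.pi fun _ => μ) - m ^ 2) -
        2 * m * (∫ d : Fin n → Ω, multLaplace (fun i => X (d i)) ∂(Measure.pi fun _ => μ) - m) := by
    have : ∀ d : Fin n → Ω, (multLaplace (fun i => X (d i)) - m) ^ 2 =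
        multLaplace (fun i => X (d i)) ^ 2 - 2 * m * multLaplace (fun i => X (d i)) + m ^ 2 :=
      fun d => by ring
    simp only [this]
    have i3 : Integrable (fun d : Fin n → Ω => multLaplace (fun i => X (d i)) ^ 2 -
      2 * m * multLaplace (fun i => X (d i))) (Measure.pi fun _ => μ) := i2.sub (i1.const_mul _)
    rw [integral_add i3 (integrable_const _),
      integral_sub i2 (i1.const_mul _), integral_const_mul]
    simp only [integral_const, probReal_univ, one_smul]
    ring
  rw [e]
  set s := ∫ d : Fin n → Ω, multLaplace (fun i => X (d i)) ∂(Measure.pi fun _ => μ) - m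
  have : |2 * m * s| ≤ 2 * |s| := by
    rw [abs_mul, abs_mul, abs_two]
    nlinarith [abs_nonneg s]
  have b1 := (abs_le.1 this).1
  have b2 := (abs_le.1 a2).2
  linarith

end Moments

end Multipliers

/-! ### Spectral form of the law of a Gaussian multiplier sum -/

section Spectral

variable {H : Type*} [NormedAddCommGroup H] [InnerProductSpace ℝ H]

theorem continuous_norm_sq_multiplier {n : ℕ} (a : Fin n → H) :
    Continuous fun g : Fin n → ℝ => ‖∑ i, g i • a i‖ ^ 2 := by
  fun_prop

/-- The operator `∑ i, a i ⊗ a i`. -/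
def sumOuterOp {ι : Type*} [Fintype ι] (a : ι → H) : H →L[ℝ] H := ∑ i, outerOp (a i) (a i)

section

variable {ι : Type*} [Fintype ι] (a : ι → H)

theorem sumOuterOp_apply (x : H) : sumOuterOp a x = ∑ i, inner ℝ (a i) x • a i := by
  simp [sumOuterOp, outerOp]

theorem inner_sumOuterOp (x y : H) :
    inner ℝ (sumOuterOp a x) y = ∑ i, inner ℝ (a i) x * inner ℝ (a i) y := by
  simp [sumOuterOp_apply, sum_inner, real_inner_smul_left]

theorem isSymmetric_sumOuterOp : (sumOuterOp a).IsSymmetric := by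
  intro x y
  change inner ℝ (sumOuterOp a x) y = inner ℝ x (sumOuterOp a y)
  rw [real_inner_comm (sumOuterOp a y) x, inner_sumOuterOp, inner_sumOuterOp]
  exact Finset.sum_congr rfl fun i _ => mul_comm _ _

theorem isCompactOperator_sumOuterOp : IsCompactOperator (sumOuterOp a) := by
  have h1 : ∀ i, IsCompactOperator (outerOp (a i) (a i)) := by
    intro i
    have := isCompactOperator_of_locallyCompactSpace_rng
      (ContinuousLinearMap.toSpanSingleton ℝ (a i))
    exact this.comp_clm (innerSL ℝ (a i))
  unfold sumOuterOp
  have : ∀ s : Finset ι, IsCompactOperator ⇑(∑ i ∈ s, outerOp (a i) (a i)) := by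
    classical
    intro s
    induction s using Finset.induction_on with
    | empty => simpa using isCompactOperator_zero
    | insert i s hi ih =>
      rw [Finset.sum_insert hi]
      exact (h1 i).add ih
  exact this _

variable [CompleteSpace H]

instance finiteDimensional_eigenspace_sumOuterOp (l : {l : ℝ // l ≠ 0}) :
    FiniteDimensional ℝ (Module.End.eigenspace (sumOuterOp a : Module.End ℝ H) l.1) :=
  ContinuousLinearMap.finite_dimensional_eigenspace (isCompactOperator_sumOuterOp a) l.1 l.2

/-- An orthonormal family of eigenvectors for the non-zero eigenvalues of `∑ i, a i ⊗ a i`. -/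
def eigVec (k : NonzeroEigIndex (sumOuterOp a)) : H :=
  (stdOrthonormalBasis ℝ (Module.End.eigenspace (sumOuterOp a : Module.End ℝ H) k.1.1) k.2 : H)

theorem sumOuterOp_eigVec (k : NonzeroEigIndex (sumOuterOp a)) :
    sumOuterOp a (eigVec a k) = k.1.1 • eigVec a k :=
  Module.End.mem_eigenspace_iff.1 (Subtype.coe_prop (stdOrthonormalBasis ℝ
    (Module.End.eigenspace (sumOuterOp a : Module.End ℝ H) k.1.1) k.2))

theorem orthonormal_eigVec : Orthonormal ℝ (eigVec a) := by
  have h1 := (isSymmetric_sumOuterOp a).orthogonalFamily_eigenspaces.comp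
    (f := fun l : {l : ℝ // l ≠ 0} => l.1) Subtype.val_injective
  exact h1.orthonormal_sigma_orthonormal fun l => (stdOrthonormalBasis ℝ
    (Module.End.eigenspace (sumOuterOp a : Module.End ℝ H) l.1)).orthonormal

instance finite_nonzeroEigIndex : Finite (NonzeroEigIndex (sumOuterOp a)) := by
  refine LinearIndependent.finite_of_le_span_finite (R := ℝ) (eigVec a)
    (orthonormal_eigVec a).linearIndependent (Set.range a) ?_
  rintro _ ⟨k, rfl⟩
  have h : eigVec a k = k.1.1⁻¹ • sumOuterOp a (eigVec a k) := by
    rw [sumOuterOp_eigVec, smul_smul, inv_mul_cancel₀ k.1.2, one_smul]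
  rw [h, sumOuterOp_apply]
  exact Submodule.smul_mem _ _ (Submodule.sum_mem _ fun i _ =>
    Submodule.smul_mem _ _ (Submodule.subset_span ⟨i, rfl⟩))

instance fintype_nonzeroEigIndex : Fintype (NonzeroEigIndex (sumOuterOp a)) :=
  Fintype.ofFinite _

theorem sum_inner_eigVec_mul (k l : NonzeroEigIndex (sumOuterOp a)) [Decidable (k = l)] :
    ∑ i, inner ℝ (a i) (eigVec a k) * inner ℝ (a i) (eigVec a l) =
      if k = l then k.1.1 else 0 := by
  rw [← inner_sumOuterOp, sumOuterOp_eigVec, real_inner_smul_left]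
  split_ifs with h
  · subst h
    rw [real_inner_self_eq_norm_sq, (orthonormal_eigVec a).1]
    simp
  · rw [(orthonormal_eigVec a).2 h, mul_zero]

/-- The eigenvalue equals `∑ i, ⟪a i, e_k⟫ ^ 2`, and zero is excluded by the index type. -/
theorem eigenvalue_pos (k : NonzeroEigIndex (sumOuterOp a)) : 0 < k.1.1 := by
  classical
  refine lt_of_le_of_ne ?_ (Ne.symm k.1.2)
  have h := sum_inner_eigVec_mul a k k
  rw [if_pos rfl] at h
  rw [← h]
  exact Finset.sum_nonneg fun i _ => mul_self_nonneg _

/-- Each `a i` lies in the span of the eigenvectors for non-zero eigenvalues. By the spectral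
theorem for compact symmetric operators it is enough that the residual is orthogonal to every
eigenspace. -/
theorem sum_inner_smul_eigVec (i : ι) :
    ∑ k, inner ℝ (a i) (eigVec a k) • eigVec a k = a i := by
  set y := a i - ∑ k, inner ℝ (a i) (eigVec a k) • eigVec a k with hy
  suffices h : y ∈ (⨆ μ, Module.End.eigenspace (sumOuterOp a : Module.End ℝ H) μ)ᗮ by
    rw [ContinuousLinearMap.orthogonalComplement_iSup_eigenspaces_eq_bot
      (isCompactOperator_sumOuterOp a) (isSymmetric_sumOuterOp a), Submodule.mem_bot] at h
    exact (sub_eq_zero.1 h).symm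
  rw [Submodule.mem_orthogonal]
  intro x hx
  have hle : (⨆ μ, Module.End.eigenspace (sumOuterOp a : Module.End ℝ H) μ) ≤
      LinearMap.ker (innerSL ℝ y : H →L[ℝ] ℝ).toLinearMap := by
    refine iSup_le fun μ x hx => ?_
    have hTx : sumOuterOp a x = μ • x := Module.End.mem_eigenspace_iff.1 hx
    change inner ℝ y x = 0
    by_cases hμ : μ = 0
    · subst hμ
      -- On the kernel, `0 = ⟪T x, x⟫ = ∑ j, ⟪a j, x⟫ ^ 2`, so `x` is orthogonal to every `a j`.
      have h0 : ∀ j, inner ℝ (a j) x = 0 := by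
        have hs := inner_sumOuterOp a x x
        rw [hTx, zero_smul, inner_zero_left] at hs
        intro j
        have := (Finset.sum_eq_zero_iff_of_nonneg fun j _ => mul_self_nonneg _).1 hs.symm j
          (Finset.mem_univ j)
        exact mul_self_eq_zero.1 this
      have h1 : ∀ k, inner ℝ (eigVec a k) x = 0 := by
        intro k
        have h2 : inner ℝ (sumOuterOp a (eigVec a k)) x = 0 := by
          rw [inner_sumOuterOp]
          simp [h0]
        rw [sumOuterOp_eigVec, real_inner_smul_left] at h2
        exact (mul_eq_zero.1 h2).resolve_left k.1.2
      simp [hy, inner_sub_left, sum_inner, real_inner_smul_left, h0, h1]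
    · have hk : ∀ k, inner ℝ y (eigVec a k) = 0 := by
        intro k
        rw [hy, inner_sub_left, (orthonormal_eigVec a).inner_left_fintype]
        simp
      have := finiteDimensional_eigenspace_sumOuterOp a ⟨μ, hμ⟩
      set b := stdOrthonormalBasis ℝ (Module.End.eigenspace (sumOuterOp a : Module.End ℝ H)
        (⟨μ, hμ⟩ : {l : ℝ // l ≠ 0}).1) with hb
      have hx' : x = ∑ j, b.repr ⟨x, hx⟩ j • (b j : H) := by
        have := congrArg Subtype.val (b.sum_repr ⟨x, hx⟩)
        simpa using this.symm
      rw [hx', inner_sum]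
      refine Finset.sum_eq_zero fun j _ => ?_
      rw [real_inner_smul_right]
      have := hk ⟨⟨μ, hμ⟩, j⟩
      change inner ℝ y (b j : H) = 0 at this
      rw [this, mul_zero]
  have := hle hx
  rw [real_inner_comm]
  exact this

theorem norm_sq_sum_smul (g : ι → ℝ) :
    ‖∑ i, g i • a i‖ ^ 2 = ∑ k, (∑ i, g i * inner ℝ (a i) (eigVec a k)) ^ 2 := by
  have h : ∑ i, g i • a i = ∑ k, (∑ i, g i * inner ℝ (a i) (eigVec a k)) • eigVec a k := by
    simp_rw [Finset.sum_smul, mul_smul]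
    rw [Finset.sum_comm]
    refine Finset.sum_congr rfl fun i _ => ?_
    rw [← Finset.smul_sum, sum_inner_smul_eigVec]
  rw [h, ← real_inner_self_eq_norm_sq, (orthonormal_eigVec a).inner_sum]
  exact Finset.sum_congr rfl fun k _ => by simp [sq]

/-- The largest non-zero eigenvalue dominates the quadratic form. -/
theorem exists_le_eigenvalue {c : ℝ} (hc : 0 < c) {A : H} (hA : ‖A‖ ≤ 1)
    (h : c ≤ ∑ i, inner ℝ (a i) A ^ 2) : ∃ k : NonzeroEigIndex (sumOuterOp a), c ≤ k.1.1 := by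
  classical
  by_contra hcon
  push Not at hcon
  have h1 : ∑ i, inner ℝ (a i) A ^ 2 = ∑ k, k.1.1 * inner ℝ (eigVec a k) A ^ 2 := by
    have h2 : sumOuterOp a A = ∑ k, inner ℝ (eigVec a k) (sumOuterOp a A) • eigVec a k := by
      rw [sumOuterOp_apply]
      simp_rw [inner_sum, Finset.sum_smul]
      rw [Finset.sum_comm]
      refine Finset.sum_congr rfl fun i _ => ?_
      conv_lhs => rw [← sum_inner_smul_eigVec a i, Finset.smul_sum]
      refine Finset.sum_congr rfl fun k _ => ?_
      rw [sum_inner_smul_eigVec, real_inner_smul_right, smul_smul, real_inner_comm (a i)]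
    have h3 : ∑ i, inner ℝ (a i) A ^ 2 = inner ℝ (sumOuterOp a A) A := by
      rw [inner_sumOuterOp]
      exact Finset.sum_congr rfl fun i _ => sq _
    rw [h3, h2, sum_inner]
    refine Finset.sum_congr rfl fun k _ => ?_
    have : inner ℝ (eigVec a k) (sumOuterOp a A) = k.1.1 * inner ℝ (eigVec a k) A := by
      have := (isSymmetric_sumOuterOp a) (eigVec a k) A
      change inner ℝ (sumOuterOp a (eigVec a k)) A = inner ℝ (eigVec a k) (sumOuterOp a A) at this
      rw [← this, sumOuterOp_eigVec, real_inner_smul_left]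
    rw [real_inner_smul_left, this]
    ring
  -- By Bessel, the diagonalised form is at most the largest eigenvalue times `‖A‖ ^ 2 ≤ 1`. If all
  -- coordinates of `A` vanish, the form is zero and `0 < c` gives the contradiction.
  have hB := (orthonormal_eigVec a).sum_inner_products_le (x := A) (s := Finset.univ)
  simp only [Real.norm_eq_abs, sq_abs] at hB
  have h4 : ∑ k, k.1.1 * inner ℝ (eigVec a k) A ^ 2 ≤ ∑ k, c * inner ℝ (eigVec a k) A ^ 2 :=
    Finset.sum_le_sum fun k _ => mul_le_mul_of_nonneg_right (hcon k).le (sq_nonneg _)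
  by_cases h0 : ∀ k, inner ℝ (eigVec a k) A = 0
  · rw [h1] at h
    simp only [h0] at h
    norm_num at h
    linarith
  push Not at h0
  obtain ⟨k0, hk0⟩ := h0
  have h5 : ∑ k, k.1.1 * inner ℝ (eigVec a k) A ^ 2 < ∑ k, c * inner ℝ (eigVec a k) A ^ 2 :=
    Finset.sum_lt_sum (fun k _ => mul_le_mul_of_nonneg_right (hcon k).le (sq_nonneg _))
      ⟨k0, Finset.mem_univ _, mul_lt_mul_of_pos_right (hcon k0) (by positivity)⟩
  rw [← Finset.mul_sum] at h5
  have h6 : ‖A‖ ^ 2 ≤ 1 := pow_le_one₀ (norm_nonneg _) hA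
  nlinarith

end

/-- Coordinates of a standard Gaussian vector along an orthonormal family are again independent
standard Gaussian variables. -/
theorem map_pi_gaussianReal_inner {n : ℕ} {κ : Type*} [Fintype κ]
    (w : κ → EuclideanSpace ℝ (Fin n)) (hw : Orthonormal ℝ w) :
    (Measure.pi fun _ : Fin n => gaussianReal 0 1).map
      (fun g k => ∑ i, g i * w k i) = Measure.pi fun _ : κ => gaussianReal 0 1 := by
  set L : EuclideanSpace ℝ (Fin n) → EuclideanSpace ℝ κ :=
    fun x => WithLp.toLp 2 fun k => inner ℝ x (w k) with hL
  have hLm : Measurable L := by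
    refine (WithLp.measurable_toLp 2 _).comp ?_
    fun_prop
  -- The characteristic function of a standard Gaussian depends only on the norm of its argument,
  -- and `t ↦ ∑ k, t k • w k` is isometric.
  have key : (stdGaussian (EuclideanSpace ℝ (Fin n))).map L =
      stdGaussian (EuclideanSpace ℝ κ) := by
    apply Measure.ext_of_charFun
    ext t
    have hin : ∀ x, inner ℝ (L x) t = inner ℝ x (∑ k, t k • w k) := by
      intro x
      rw [inner_sum, PiLp.inner_apply]
      refine Finset.sum_congr rfl fun k _ => ?_
      rw [real_inner_smul_right]
      simp [hL]
    have hn : ‖∑ k, t k • w k‖ ^ 2 = ‖t‖ ^ 2 := by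
      rw [← real_inner_self_eq_norm_sq, hw.inner_sum, EuclideanSpace.real_norm_sq_eq]
      exact Finset.sum_congr rfl fun k _ => by simp [sq]
    rw [charFun_apply, integral_map hLm.aemeasurable (by fun_prop)]
    simp_rw [hin]
    rw [← charFun_apply, charFun_stdGaussian, charFun_stdGaussian]
    congr 2
    rw [← Complex.ofReal_pow, ← Complex.ofReal_pow, hn]
  have h2 := congrArg (fun m => m.map (WithLp.ofLp : EuclideanSpace ℝ κ → κ → ℝ)) key
  simp only at h2
  rw [← map_pi_eq_stdGaussian, ← map_pi_eq_stdGaussian,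
    Measure.map_map (WithLp.measurable_ofLp 2 _) hLm,
    Measure.map_map ((WithLp.measurable_ofLp 2 _).comp hLm) (WithLp.measurable_toLp 2 _),
    Measure.map_map (WithLp.measurable_ofLp 2 _) (WithLp.measurable_toLp 2 _)] at h2
  have e2 : (WithLp.ofLp : EuclideanSpace ℝ κ → κ → ℝ) ∘ (WithLp.toLp 2) = id := rfl
  rw [e2, Measure.map_id] at h2
  rw [← h2]
  congr 1
  funext g k
  simp [hL, PiLp.inner_apply, mul_comm]

variable [CompleteSpace H]

/-- The squared norm of the multiplier sum `∑ i, g i • a i` is distributed as `∑ k, λ k * h k ^ 2`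
with `λ` the non-zero eigenvalues of `∑ i, a i ⊗ a i` and `h` independent standard Gaussian. -/
theorem map_norm_sq_multiplier {n : ℕ} (a : Fin n → H) :
    (Measure.pi fun _ : Fin n => gaussianReal 0 1).map (fun g => ‖∑ i, g i • a i‖ ^ 2) =
      (Measure.pi fun _ : NonzeroEigIndex (sumOuterOp a) => gaussianReal 0 1).map
        (fun h => ∑ k, k.1.1 * h k ^ 2) := by
  classical
  -- The right singular vectors of `g ↦ ∑ i, g i • a i`; the Gram matrix of the unnormalised
  -- coordinate vectors is diagonal with the eigenvalues as entries.
  set w : NonzeroEigIndex (sumOuterOp a) → EuclideanSpace ℝ (Fin n) :=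
    fun k => WithLp.toLp 2 fun i => (√k.1.1)⁻¹ * inner ℝ (a i) (eigVec a k) with hwdef
  have hw : Orthonormal ℝ w := by
    rw [orthonormal_iff_ite]
    intro k l
    have : inner ℝ (w k) (w l) = (√k.1.1)⁻¹ * (√l.1.1)⁻¹ *
        ∑ i, inner ℝ (a i) (eigVec a k) * inner ℝ (a i) (eigVec a l) := by
      rw [PiLp.inner_apply, Finset.mul_sum]
      refine Finset.sum_congr rfl fun i _ => ?_
      simp only [hwdef, RCLike.inner_apply, conj_trivial]
      ring
    rw [this, sum_inner_eigVec_mul]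
    split_ifs with h
    · subst h
      have h0 := eigenvalue_pos a k
      rw [← mul_inv, Real.mul_self_sqrt h0.le, inv_mul_cancel₀ h0.ne']
    · rw [mul_zero]
  have hm : Measurable fun (g : Fin n → ℝ) k => ∑ i, g i * w k i := by fun_prop
  rw [← map_pi_gaussianReal_inner w hw, Measure.map_map (by fun_prop) hm]
  congr 1
  funext g
  rw [norm_sq_sum_smul]
  refine Finset.sum_congr rfl fun k _ => ?_
  have h0 := eigenvalue_pos a k
  have e : ∑ i, g i * w k i = (√k.1.1)⁻¹ * ∑ i, g i * inner ℝ (a i) (eigVec a k) := by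
    rw [Finset.mul_sum]
    refine Finset.sum_congr rfl fun i _ => ?_
    simp only [hwdef]
    ring
  simp only
  rw [e, mul_pow, inv_pow, Real.sq_sqrt h0.le, ← mul_assoc, mul_inv_cancel₀ h0.ne', one_mul]

/-- The distribution function in the definition of the weighted chi-squared quantile, in terms of
Gaussian multipliers. -/
theorem infinitePi_chiSqOne_real_eq {n : ℕ} (a : Fin n → H) (x : ℝ) :
    (Measure.infinitePi fun _ : NonzeroEigIndex (sumOuterOp a) => chiSqOne).real
        {W | ∑' k, (k.1 : ℝ) * W k ≤ x} =
      (Measure.pi fun _ : Fin n => gaussianReal 0 1).real {g | ‖∑ i, g i • a i‖ ^ 2 ≤ x} := by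
  have h1 : (Measure.infinitePi fun _ : NonzeroEigIndex (sumOuterOp a) => chiSqOne) =
      (Measure.pi fun _ : NonzeroEigIndex (sumOuterOp a) => gaussianReal 0 1).map
        (fun h k => h k ^ 2) := by
    rw [Measure.infinitePi_eq_pi, Measure.pi_map_pi (f := fun _ (t : ℝ) => t ^ 2)]
    · rfl
    · intro k
      fun_prop
  simp only [tsum_fintype, measureReal_def]
  congr 1
  have m1 : MeasurableSet {W : NonzeroEigIndex (sumOuterOp a) → ℝ | ∑ k, (k.1 : ℝ) * W k ≤ x} :=
    measurableSet_le (by fun_prop) measurable_const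
  rw [h1, Measure.map_apply (by fun_prop) m1]
  have h2 : _ = _ := congrArg (fun m => m (Set.Iic x)) (map_norm_sq_multiplier a)
  rw [Measure.map_apply (continuous_norm_sq_multiplier a).measurable measurableSet_Iic,
    Measure.map_apply (by fun_prop) measurableSet_Iic] at h2
  exact h2.symm

end Spectral

/-! ### Resampling one coordinate of an i.i.d. sample -/

section Update

variable {ι Ω : Type*} [Fintype ι] [DecidableEq ι] [MeasurableSpace Ω]

theorem measurable_update_prod (j : ι) :
    Measurable fun q : Ω × (ι → Ω) => Function.update q.2 j q.1 := by
  refine measurable_pi_iff.2 fun i => ?_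
  by_cases h : i = j
  · subst h
    simpa using measurable_fst
  · simp only [Function.update_of_ne h]
    exact (measurable_pi_apply i).comp measurable_snd

/-- Resampling one coordinate preserves a product law. -/
theorem measurePreserving_update (μ : Measure Ω) [IsProbabilityMeasure μ] (j : ι) :
    MeasurePreserving (fun q : Ω × (ι → Ω) => Function.update q.2 j q.1)
      (μ.prod (Measure.pi fun _ => μ)) (Measure.pi fun _ => μ) := by
  refine ⟨measurable_update_prod j, (Measure.pi_eq fun s hs => ?_).symm⟩
  rw [Measure.map_apply (measurable_update_prod j) (MeasurableSet.univ_pi hs)]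
  have : (fun q : Ω × (ι → Ω) => Function.update q.2 j q.1) ⁻¹' Set.univ.pi s =
      s j ×ˢ Set.univ.pi (Function.update s j Set.univ) := by
    ext q
    simp only [Set.mem_preimage, Set.mem_pi, Set.mem_univ, true_implies, Set.mem_prod]
    constructor
    · intro h
      refine ⟨by simpa using h j, fun i => ?_⟩
      by_cases hi : i = j
      · subst hi
        simp
      · simpa [Function.update_of_ne hi] using h i
    · rintro ⟨h1, h2⟩ i
      by_cases hi : i = j
      · subst hi
        simpa using h1
      · simpa [Function.update_of_ne hi] using h2 i
  rw [this, Measure.prod_prod, Measure.pi_pi, ← Finset.mul_prod_erase _ _ (Finset.mem_univ j),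
    ← Finset.mul_prod_erase Finset.univ (fun i => μ (s i)) (Finset.mem_univ j)]
  simp only [Function.update_self, measure_univ, one_mul]
  congr 1
  refine Finset.prod_congr rfl fun i hi => ?_
  rw [Function.update_of_ne (Finset.ne_of_mem_erase hi)]

end Update

/-! ### Anti-concentration of Gaussian multiplier sums -/

section AntiConcentration

theorem gaussianReal_le_volume (s : Set ℝ) : gaussianReal 0 1 s ≤ volume s := by
  rw [gaussianReal_apply 0 one_ne_zero]
  refine (lintegral_mono (g := fun _ => 1) fun x => ?_).trans_eq (setLIntegral_one s)
  rw [gaussianPDF_def, ← ENNReal.ofReal_one]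
  refine ENNReal.ofReal_le_ofReal ?_
  rw [gaussianPDFReal_def]
  have h1 : (√(2 * Real.pi * ((1 : NNReal) : ℝ)))⁻¹ ≤ 1 := by
    refine inv_le_one_of_one_le₀ (Real.one_le_sqrt.2 ?_)
    have := Real.pi_gt_three
    simp only [NNReal.coe_one]
    linarith
  refine mul_le_one₀ h1 (Real.exp_pos _).le (Real.exp_le_one_iff.2 ?_)
  rw [neg_div]
  exact neg_nonpos.2 (by positivity)

/-- The set lies in two intervals of length `√(2 * η)`, and the standard Gaussian density is at most
one. -/
theorem gaussianReal_sq_near_le (y : ℝ) {η : ℝ} (hη : 0 ≤ η) :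
    gaussianReal 0 1 {t | |t ^ 2 - y| ≤ η} ≤ ENNReal.ofReal (2 * √(2 * η)) := by
  refine (gaussianReal_le_volume _).trans ?_
  set s := √(y - η) with hs
  set r := √(2 * η) with hr
  have hr0 : 0 ≤ r := Real.sqrt_nonneg _
  have hs0 : 0 ≤ s := Real.sqrt_nonneg _
  have hsub : {t : ℝ | |t ^ 2 - y| ≤ η} ⊆ Set.Icc s (s + r) ∪ Set.Icc (-(s + r)) (-s) := by
    intro t ht
    rw [Set.mem_ofPred_eq, abs_le] at ht
    have h1 : s ≤ |t| := Real.sqrt_le_iff.2 ⟨abs_nonneg _, by rw [sq_abs]; linarith⟩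
    have h2 : |t| ≤ s + r := by
      refine abs_le_of_sq_le_sq' ?_ (by positivity) |>.2
      rw [sq_abs]
      -- Valid also for `y < η`, where the real square root is zero.
      have h3 : y - η ≤ s ^ 2 := Real.sq_sqrt' (x := y - η) ▸ le_max_left _ _
      have h4 : r ^ 2 = 2 * η := Real.sq_sqrt (by positivity)
      nlinarith [mul_nonneg hs0 hr0]
    rcases abs_cases t with ⟨e, _⟩ | ⟨e, _⟩
    · exact Or.inl ⟨by linarith, by linarith⟩
    · exact Or.inr ⟨by linarith, by linarith⟩
  refine (measure_mono hsub).trans ((measure_union_le _ _).trans ?_)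
  rw [Real.volume_Icc, Real.volume_Icc, ← ENNReal.ofReal_add (by linarith) (by linarith)]
  exact ENNReal.ofReal_le_ofReal (by linarith)

variable {H : Type*} [NormedAddCommGroup H] [InnerProductSpace ℝ H] [CompleteSpace H]

/-- A Gaussian multiplier sum with a non-degenerate direction is not concentrated. -/
theorem measure_norm_sq_multiplier_near_le {n : ℕ} (a : Fin n → H) {c : ℝ} (hc : 0 < c) {A : H}
    (hA : ‖A‖ ≤ 1) (h : c ≤ ∑ i, inner ℝ (a i) A ^ 2) (x : ℝ) {δ : ℝ} (hδ : 0 ≤ δ) :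
    (Measure.pi fun _ : Fin n => gaussianReal 0 1) {g | |‖∑ i, g i • a i‖ ^ 2 - x| ≤ δ} ≤
      ENNReal.ofReal (2 * √(2 * (δ / c))) := by
  classical
  obtain ⟨k, hk⟩ := exists_le_eigenvalue a hc hA h
  have hk0 := eigenvalue_pos a k
  have hS : MeasurableSet {y : ℝ | |y - x| ≤ δ} := measurableSet_le (by fun_prop) measurable_const
  have h2 : _ = _ := congrArg (fun m => m {y : ℝ | |y - x| ≤ δ}) (map_norm_sq_multiplier a)
  rw [Measure.map_apply (continuous_norm_sq_multiplier a).measurable hS,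
    Measure.map_apply (by fun_prop) hS] at h2
  refine h2.trans_le ?_
  set S : Set (NonzeroEigIndex (sumOuterOp a) → ℝ) :=
    (fun h => ∑ k, k.1.1 * h k ^ 2) ⁻¹' {y : ℝ | |y - x| ≤ δ} with hSdef
  have hSm : MeasurableSet S := hS.preimage (by fun_prop)
  -- Only the coordinate `k` with eigenvalue at least `c` is resampled. With the others frozen, its
  -- square must lie within `δ / c` of a fixed number.
  rw [← (measurePreserving_update (gaussianReal 0 1) k).measure_preimage hSm.nullMeasurableSet,
    Measure.prod_apply_symm ((measurable_update_prod k) hSm)]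
  refine (lintegral_mono (g := fun _ => ENNReal.ofReal (2 * √(2 * (δ / c)))) fun d => ?_).trans_eq
    (by simp)
  set r := ∑ l ∈ Finset.univ.erase k, l.1.1 * d l ^ 2 with hr
  refine (measure_mono ?_).trans (gaussianReal_sq_near_le ((x - r) / k.1.1) (div_nonneg hδ hc.le))
  intro t ht
  have ht' : |∑ l, l.1.1 * (Function.update d k t) l ^ 2 - x| ≤ δ := ht
  rw [← Finset.add_sum_erase _ _ (Finset.mem_univ k), Function.update_self,
    Finset.sum_congr rfl (g := fun l => l.1.1 * d l ^ 2) (fun l hl => by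
      rw [Function.update_of_ne (Finset.ne_of_mem_erase hl)]), ← hr] at ht'
  have e : t ^ 2 - (x - r) / k.1.1 = (k.1.1 * t ^ 2 + r - x) / k.1.1 := by
    field_simp
    ring
  rw [Set.mem_ofPred_eq, e, abs_div, abs_of_pos hk0]
  exact div_le_div₀ hδ ht' hc hk

end AntiConcentration

/-! ### Outer products as Hilbert–Schmidt operators -/

namespace HilbertSchmidt

variable {E F : Type*} [NormedAddCommGroup E] [InnerProductSpace ℝ E] [CompleteSpace E]
  [NormedAddCommGroup F] [InnerProductSpace ℝ F]

theorem ext_toCLM {A B : HilbertSchmidt E F} (h : ∀ x, toCLM E F A x = toCLM E F B x) : A = B :=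
  Subtype.ext (ContinuousLinearMap.ext h)

theorem outer_add_left (a a' : E) (b : F) : outer (a + a') b = outer a b + outer a' b :=
  ext_toCLM fun x => by
    rw [map_add]
    simp only [add_apply, toCLM_outer_apply, inner_add_right, add_smul]

theorem outer_add_right (a : E) (b b' : F) : outer a (b + b') = outer a b + outer a b' :=
  ext_toCLM fun x => by
    rw [map_add]
    simp only [add_apply, toCLM_outer_apply, smul_add]

theorem outer_smul_left (c : ℝ) (a : E) (b : F) : outer (c • a) b = c • outer a b :=
  ext_toCLM fun x => by
    rw [map_smul]
    simp only [smul_apply, toCLM_outer_apply, real_inner_smul_right, mul_smul]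

theorem outer_smul_right (c : ℝ) (a : E) (b : F) : outer a (c • b) = c • outer a b :=
  ext_toCLM fun x => by
    rw [map_smul]
    simp only [smul_apply, toCLM_outer_apply, smul_smul, mul_comm]

/-- Expanding `a` in the chosen basis turns the Hilbert–Schmidt series into `⟪A a, b⟫`. This
converts pairings with `ε ⊗ ξ` into pairings of `ξ` with a function of the other variables. -/
theorem inner_outer_right (A : HilbertSchmidt E F) (a : E) (b : F) :
    inner ℝ A (outer a b) = inner ℝ (toCLM E F A a) b := by
  have h1 : inner ℝ A (outer a b) = ∑' i, inner ℝ (hsBasis E i) a *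
      inner ℝ (toCLM E F A (hsBasis E i)) b := by
    change inner ℝ (toLp E F A) (toLp E F (outer a b)) = _
    rw [lp.inner_eq_tsum]
    refine tsum_congr fun i => ?_
    change inner ℝ (toCLM E F A (hsBasis E i)) (toCLM E F (outer a b) (hsBasis E i)) = _
    rw [toCLM_outer_apply, real_inner_smul_right]
  have h2 := (hsBasis E).hasSum_repr a
  have h3 := (h2.mapL (toCLM E F A)).mapL (innerSL ℝ b : F →L[ℝ] ℝ)
  rw [h1, real_inner_comm]
  refine HasSum.tsum_eq (h3.congr_fun fun i => ?_)
  simp only [map_smul, innerSL_apply_apply, smul_eq_mul, HilbertBasis.repr_apply_apply]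
  rw [real_inner_comm b]

theorem inner_outer_outer (a c : E) (b d : F) :
    inner ℝ (outer a b) (outer c d) = inner ℝ a c * inner ℝ b d := by
  rw [inner_outer_right, toCLM_outer_apply, real_inner_smul_left, real_inner_comm]

theorem norm_outer (a : E) (b : F) : ‖outer a b‖ = ‖a‖ * ‖b‖ := by
  have h : ‖outer a b‖ ^ 2 = (‖a‖ * ‖b‖) ^ 2 := by
    rw [← real_inner_self_eq_norm_sq, inner_outer_outer, real_inner_self_eq_norm_sq,
      real_inner_self_eq_norm_sq, mul_pow]
  exact (sq_eq_sq₀ (norm_nonneg _) (by positivity)).1 h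

/-- The outer product as a bounded bilinear map. -/
def outerL : E →L[ℝ] F →L[ℝ] HilbertSchmidt E F :=
  LinearMap.mkContinuous₂
    (LinearMap.mk₂ ℝ outer outer_add_left outer_smul_left outer_add_right outer_smul_right) 1
    fun a b => by rw [one_mul]; exact (norm_outer a b).le

theorem continuous_outer : Continuous fun q : E × F => outer q.1 q.2 :=
  (outerL (E := E) (F := F)).continuous₂

theorem norm_sq_sum_outer {ι : Type*} [Fintype ι] (a : ι → E) (b : ι → F) :
    ‖∑ i, outer (a i) (b i)‖ ^ 2 = ∑ i, ∑ j, inner ℝ (a i) (a j) * inner ℝ (b i) (b j) := by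
  rw [← real_inner_self_eq_norm_sq, sum_inner]
  simp_rw [inner_sum, inner_outer_outer]

end HilbertSchmidt

/-! ### Consequences of conditional independence -/

section CondIndep

variable {Ω E F 𝒵 𝒰 : Type*} [MeasurableSpace Ω] [MeasurableSpace E] [mZ : MeasurableSpace 𝒵]
  [MeasurableSpace 𝒰]

section Law

variable [MeasurableSpace F] [StandardBorelSpace F] [Nonempty F]

/-- If `X` and `Y` are conditionally independent given `Z`, the conditional law of `Y` given
`(X, Z)` is that of `Y` given `Z`. -/
theorem compProd_condDistrib_of_condIndep (μ : Measure Ω) [IsProbabilityMeasure μ] {X : Ω → E}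
    {Y : Ω → F} {Z : Ω → 𝒵} (hX : Measurable X) (hY : Measurable Y) (hZ : Measurable Z)
    (hCI : ∀ A B, MeasurableSet A → MeasurableSet B →
      μ[fun ω => A.indicator (fun _ => (1 : ℝ)) (X ω) * B.indicator (fun _ => (1 : ℝ)) (Y ω) |
          mZ.comap Z] =ᵐ[μ]
        μ[fun ω => A.indicator (fun _ => (1 : ℝ)) (X ω) | mZ.comap Z] *
          μ[fun ω => B.indicator (fun _ => (1 : ℝ)) (Y ω) | mZ.comap Z]) :
    μ.map (fun ω => (X ω, Z ω)) ⊗ₘ ((condDistrib Y Z μ).comap Prod.snd measurable_snd) =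
      μ.map (fun ω => ((X ω, Z ω), Y ω)) := by
  have hm : mZ.comap Z ≤ _ := hZ.comap_le
  set κ := condDistrib Y Z μ with hκ
  have := Measure.isProbabilityMeasure_map (μ := μ) (hX.prodMk hZ).aemeasurable
  refine Measure.ext_prod₃_iff'.2 ?_
  intro A C B hA hC hB
  rw [Measure.map_apply ((hX.prodMk hZ).prodMk hY) ((hA.prod hC).prod hB),
    Measure.compProd_apply_prod (hA.prod hC) hB,
    setLIntegral_map (hA.prod hC) (Kernel.measurable_coe _ hB) (hX.prodMk hZ)]
  set k : Ω → ℝ := fun ω => (κ (Z ω)).real B with hk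
  set fA : Ω → ℝ := fun ω => A.indicator (fun _ => (1 : ℝ)) (X ω) with hfA
  set fB : Ω → ℝ := fun ω => B.indicator (fun _ => (1 : ℝ)) (Y ω) with hfB
  have hfAm : Measurable fA := (measurable_const.indicator hA).comp hX
  have hfBm : Measurable fB := (measurable_const.indicator hB).comp hY
  have hfA1 : ∀ ω, |fA ω| ≤ 1 := fun ω => by
    simp only [hfA, Set.indicator]
    split_ifs <;> simp
  have hfB1 : ∀ ω, |fB ω| ≤ 1 := fun ω => by
    simp only [hfB, Set.indicator]
    split_ifs <;> simp
  have hk1 : ∀ ω, |k ω| ≤ 1 := fun ω => by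
    rw [abs_of_nonneg measureReal_nonneg]
    exact measureReal_le_one
  have hkm : Measurable[mZ.comap Z] k :=
    ((Kernel.measurable_coe κ hB).ennreal_toReal).comp (comap_measurable Z)
  have iA : Integrable fA μ := (integrable_const (1 : ℝ)).mono' hfAm.aestronglyMeasurable
    (ae_of_all _ hfA1)
  have iAB : Integrable (fun ω => fA ω * fB ω) μ := (integrable_const (1 : ℝ)).mono'
    (hfAm.mul hfBm).aestronglyMeasurable (ae_of_all _ fun ω => by
      rw [Real.norm_eq_abs, abs_mul]
      exact mul_le_one₀ (hfA1 ω) (abs_nonneg _) (hfB1 ω))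
  have ikA : Integrable (k * fA) μ := (integrable_const (1 : ℝ)).mono'
    ((hkm.mono hm le_rfl).mul hfAm).aestronglyMeasurable (ae_of_all _ fun ω => by
      rw [Real.norm_eq_abs, Pi.mul_apply, abs_mul]
      exact mul_le_one₀ (hk1 ω) (abs_nonneg _) (hfA1 ω))
  have hkB : k =ᵐ[μ] μ[fB | mZ.comap Z] := condDistrib_ae_eq_condExp hZ hY hB
  have hZC : MeasurableSet[mZ.comap Z] (Z ⁻¹' C) := ⟨C, hC, rfl⟩
  -- On boxes the identity reads `E(1_A 1_B | Z) = E(1_A | Z) k = E(k 1_A | Z)` integrated over `Z ∈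
  -- C`, where `k` is the conditional probability of `B` given `Z`.
  have key : ∫ ω in Z ⁻¹' C, fA ω * fB ω ∂μ = ∫ ω in Z ⁻¹' C, k ω * fA ω ∂μ := by
    rw [← setIntegral_condExp hm iAB hZC]
    change _ = ∫ ω in Z ⁻¹' C, (k * fA) ω ∂μ
    rw [← setIntegral_condExp hm ikA hZC]
    refine setIntegral_congr_ae (hm _ hZC) ?_
    filter_upwards [hCI A B hA hB, hkB,
      condExp_mul_of_stronglyMeasurable_left hkm.stronglyMeasurable ikA iA] with ω h1 h2 h3 _
    rw [h1, h3, Pi.mul_apply, Pi.mul_apply, h2, mul_comm]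
  have eL : ∫ ω in Z ⁻¹' C, k ω * fA ω ∂μ =
      (∫⁻ ω in (fun ω => (X ω, Z ω)) ⁻¹' A ×ˢ C, κ (Z ω) B ∂μ).toReal := by
    have e1 : (fun ω => k ω * fA ω) = (X ⁻¹' A).indicator k := by
      funext ω
      by_cases h : X ω ∈ A <;> simp [hfA, Set.indicator, h]
    rw [e1, setIntegral_indicator (hX hA), Set.inter_comm,
      integral_eq_lintegral_of_nonneg_ae (ae_of_all _ fun ω => measureReal_nonneg)
        (hkm.mono hm le_rfl).aestronglyMeasurable]
    congr 1
    refine lintegral_congr fun ω => ?_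
    exact ofReal_measureReal
  have eR : ∫ ω in Z ⁻¹' C, fA ω * fB ω ∂μ =
      (μ ((fun ω => ((X ω, Z ω), Y ω)) ⁻¹' (A ×ˢ C) ×ˢ B)).toReal := by
    have e1 : (fun ω => fA ω * fB ω) = (X ⁻¹' A ∩ Y ⁻¹' B).indicator fun _ => (1 : ℝ) := by
      funext ω
      simp only [hfA, hfB, Set.indicator, Set.mem_inter_iff, Set.mem_preimage]
      by_cases h1 : X ω ∈ A <;> by_cases h2 : Y ω ∈ B <;> simp [h1, h2]
    rw [e1, setIntegral_indicator ((hX hA).inter (hY hB)), setIntegral_const, smul_eq_mul, mul_one,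
      measureReal_def]
    congr 2
    ext ω
    simp only [Set.mem_inter_iff, Set.mem_preimage, Set.mem_prod]
    tauto
  rw [eL, eR] at key
  refine ((ENNReal.toReal_eq_toReal_iff' (measure_ne_top _ _) ?_).1 key).symm
  refine ne_top_of_le_ne_top ENNReal.one_ne_top ?_
  calc _ ≤ ∫⁻ _ in (fun ω => (X ω, Z ω)) ⁻¹' A ×ˢ C, 1 ∂μ := lintegral_mono fun ω => prob_le_one
    _ ≤ 1 := by rw [setLIntegral_one]; exact prob_le_one

end Law

/-- `ξ` is centred given `U`, with conditional second moment `v U`. -/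
structure IsCenteredGiven [NormedAddCommGroup F] [InnerProductSpace ℝ F] [MeasurableSpace F]
    (μ : Measure Ω) (U : Ω → 𝒰) (ξ : Ω → F) (v : 𝒰 → ℝ≥0∞) : Prop where
  measurable_cov : Measurable U
  measurable_noise : Measurable ξ
  measurable_var : Measurable v
  lintegral_sq : ∀ φ : 𝒰 → ℝ≥0∞, Measurable φ →
    ∫⁻ ω, φ (U ω) * ‖ξ ω‖ₑ ^ 2 ∂μ = ∫⁻ ω, φ (U ω) * v (U ω) ∂μ
  integral_inner : ∀ φ : 𝒰 → F, Measurable φ → Integrable (fun ω => inner ℝ (φ (U ω)) (ξ ω)) μ →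
    ∫ ω, inner ℝ (φ (U ω)) (ξ ω) ∂μ = 0

variable [NormedAddCommGroup F] [InnerProductSpace ℝ F] [CompleteSpace F]
  [SecondCountableTopology F] [MeasurableSpace F] [BorelSpace F]

theorem measurable_condMean (P : ProbabilityMeasure Ω) (Y : Ω → F) (Z : Ω → 𝒵) :
    Measurable (condMean Y Z P) :=
  (StronglyMeasurable.integral_condDistrib (f := fun q : 𝒵 × F => q.2)
    measurable_snd.stronglyMeasurable).measurable

theorem measurable_condLMean (P : ProbabilityMeasure Ω) (V : Ω → ℝ≥0∞) (Z : Ω → 𝒵) :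
    Measurable (condLMean V Z P) :=
  Measurable.lintegral_kernel (κ := condDistrib V Z (P : Measure Ω)) measurable_id

theorem setLIntegral_condLMean (P : ProbabilityMeasure Ω) {V : Ω → ℝ≥0∞} {Z : Ω → 𝒵}
    (hV : Measurable V) (hZ : Measurable Z) {C : Set 𝒵} (hC : MeasurableSet C) :
    ∫⁻ z in C, condLMean V Z P z ∂((P : Measure Ω).map Z) =
      ∫⁻ ω in Z ⁻¹' C, V ω ∂(P : Measure Ω) := by
  have h := compProd_map_condDistrib (mβ := mZ) (μ := (P : Measure Ω)) (X := Z) hV.aemeasurable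
  have := Measure.isProbabilityMeasure_map (μ := (P : Measure Ω)) hZ.aemeasurable
  have h1 := Measure.setLIntegral_compProd (μ := (P : Measure Ω).map Z)
    (κ := condDistrib V Z (P : Measure Ω)) (f := fun q : 𝒵 × ℝ≥0∞ => q.2) measurable_snd hC
    MeasurableSet.univ
  rw [h, setLIntegral_map (hC.prod MeasurableSet.univ) measurable_snd (hZ.prodMk hV)] at h1
  simp only [Measure.restrict_univ] at h1
  unfold condLMean
  rw [← h1]
  congr 2
  ext ω
  simp

/-- Under conditional independence, integrating over `Y` with `(X, Z)` frozen uses the conditional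
law of `Y` given `Z` alone, whose mean is `condMean Y Z P`. Hence the noise stays centred, with
unchanged conditional second moment, after `X` is added to the conditioning. -/
theorem isCenteredGiven_of_condIndep (P : ProbabilityMeasure Ω) {X : Ω → E} {Y : Ω → F}
    {Z : Ω → 𝒵} (hX : Measurable X) (hY : Measurable Y) (hZ : Measurable Z)
    (hYi : Integrable Y (P : Measure Ω))
    (hCI : ∀ A B, MeasurableSet A → MeasurableSet B →
      (P : Measure Ω)[fun ω => A.indicator (fun _ => (1 : ℝ)) (X ω) *
          B.indicator (fun _ => (1 : ℝ)) (Y ω) | mZ.comap Z] =ᵐ[(P : Measure Ω)]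
        (P : Measure Ω)[fun ω => A.indicator (fun _ => (1 : ℝ)) (X ω) | mZ.comap Z] *
          (P : Measure Ω)[fun ω => B.indicator (fun _ => (1 : ℝ)) (Y ω) | mZ.comap Z]) :
    IsCenteredGiven (P : Measure Ω) (fun ω => (X ω, Z ω)) (fun ω => Y ω - condMean Y Z P (Z ω))
      (fun u => condLMean (fun ω => ‖Y ω - condMean Y Z P (Z ω)‖ₑ ^ 2) Z P u.2) := by
  set μ : Measure Ω := (P : Measure Ω) with hμ
  set g := condMean Y Z P with hg
  have hgm : Measurable g := measurable_condMean P Y Z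
  have hlaw := compProd_condDistrib_of_condIndep μ hX hY hZ hCI
  set κ := condDistrib Y Z μ with hκ
  have := Measure.isProbabilityMeasure_map (μ := μ) (hX.prodMk hZ).aemeasurable
  have := Measure.isProbabilityMeasure_map (μ := μ) hZ.aemeasurable
  have hT : Measurable fun ω => ((X ω, Z ω), Y ω) := (hX.prodMk hZ).prodMk hY
  have hVm : Measurable fun ω => ‖Y ω - g (Z ω)‖ₑ ^ 2 := ((hY.sub (hgm.comp hZ)).enorm).pow_const 2
  set v := condLMean (fun ω => ‖Y ω - g (Z ω)‖ₑ ^ 2) Z P with hv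
  have hvm : Measurable v := measurable_condLMean _ _ _
  set W : 𝒵 → ℝ≥0∞ := fun z => ∫⁻ y, ‖y - g z‖ₑ ^ 2 ∂κ z with hW
  have hWm : Measurable W := by
    refine Measurable.lintegral_kernel_prod_right' (κ := κ)
      (f := fun q : 𝒵 × F => ‖q.2 - g q.1‖ₑ ^ 2) ?_
    exact ((measurable_snd.sub (hgm.comp measurable_fst)).enorm).pow_const 2
  have hsq : ∀ φ : E × 𝒵 → ℝ≥0∞, Measurable φ →
      ∫⁻ ω, φ (X ω, Z ω) * ‖Y ω - g (Z ω)‖ₑ ^ 2 ∂μ = ∫⁻ ω, φ (X ω, Z ω) * W (Z ω) ∂μ := by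
    intro φ hφ
    have hm : Measurable fun q : (E × 𝒵) × F => φ q.1 * ‖q.2 - g q.1.2‖ₑ ^ 2 :=
      (hφ.comp measurable_fst).mul
        (((measurable_snd.sub (hgm.comp (measurable_snd.comp measurable_fst))).enorm).pow_const 2)
    have h1 := Measure.lintegral_compProd (μ := μ.map fun ω => (X ω, Z ω))
      (κ := κ.comap Prod.snd measurable_snd) hm
    rw [hlaw, lintegral_map hm hT] at h1
    rw [h1]
    have h2 : ∀ u : E × 𝒵, ∫⁻ y, φ u * ‖y - g u.2‖ₑ ^ 2 ∂κ u.2 =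
        φ u * W u.2 := by
      intro u
      rw [lintegral_const_mul _ (by fun_prop)]
    simp only [Kernel.comap_apply, h2]
    exact lintegral_map (hφ.mul (hWm.comp measurable_snd)) (hX.prodMk hZ)
  -- `v` comes from the conditional law of the squared norm, `W` from that of `Y`. They agree almost
  -- surely because their integrals over every event `Z ∈ C` agree.
  have hWv : ∀ᵐ ω ∂μ, W (Z ω) = v (Z ω) := by
    refine ae_of_ae_map hZ.aemeasurable (ae_eq_of_forall_setLIntegral_eq_of_sigmaFinite hWm hvm
      fun C hC _ => ?_)
    rw [hv, setLIntegral_condLMean P hVm hZ hC, setLIntegral_map hC hWm hZ]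
    have := hsq (fun u => C.indicator (fun _ => 1) u.2)
      ((measurable_const.indicator hC).comp measurable_snd)
    have e : ∀ ω (f : Ω → ℝ≥0∞), C.indicator (fun _ => (1 : ℝ≥0∞)) (Z ω) * f ω =
        (Z ⁻¹' C).indicator f ω := by
      intro ω f
      by_cases h : Z ω ∈ C <;> simp [Set.indicator, h]
    simp only [e _ (fun ω => ‖Y ω - g (Z ω)‖ₑ ^ 2), e _ (fun ω => W (Z ω))] at this
    rw [lintegral_indicator (hZ hC), lintegral_indicator (hZ hC)] at this
    exact this.symm
  refine ⟨hX.prodMk hZ, hY.sub (hgm.comp hZ), hvm.comp measurable_snd, ?_, ?_⟩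
  · intro φ hφ
    rw [hsq φ hφ]
    refine lintegral_congr_ae ?_
    filter_upwards [hWv] with ω h
    rw [h]
  · intro φ hφ hi
    have hm : Measurable fun q : (E × 𝒵) × F => inner ℝ (φ q.1) (q.2 - g q.1.2) :=
      (hφ.comp measurable_fst).inner
        (measurable_snd.sub (hgm.comp (measurable_snd.comp measurable_fst)))
    have hi' : Integrable (fun q : (E × 𝒵) × F => inner ℝ (φ q.1) (q.2 - g q.1.2))
        (μ.map fun ω => ((X ω, Z ω), Y ω)) :=
      (integrable_map_measure hm.aestronglyMeasurable hT.aemeasurable).2 hi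
    have e1 : ∫ ω, inner ℝ (φ (X ω, Z ω)) (Y ω - g (Z ω)) ∂μ =
        ∫ q, inner ℝ (φ q.1) (q.2 - g q.1.2) ∂(μ.map fun ω => ((X ω, Z ω), Y ω)) :=
      (integral_map hT.aemeasurable hm.aestronglyMeasurable).symm
    rw [e1, ← hlaw, Measure.integral_compProd (hlaw ▸ hi')]
    -- Integrability of `Y` makes almost every conditional law have a mean; otherwise the Bochner
    -- integral defining `g` would be the default value zero.
    have hint : ∀ᵐ u ∂(μ.map fun ω => (X ω, Z ω)), Integrable (fun y => y) (κ u.2) := by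
      have h1 : Integrable (fun q : 𝒵 × F => q.2) (μ.map fun ω => (Z ω, Y ω)) :=
        (integrable_map_measure measurable_snd.aestronglyMeasurable
          (hZ.prodMk hY).aemeasurable).2 hYi
      have h2 := Integrable.condDistrib_ae_map (X := Z) hY.aemeasurable h1
      have h3 : (μ.map fun ω => (X ω, Z ω)).map Prod.snd = μ.map Z := by
        rw [Measure.map_map measurable_snd (hX.prodMk hZ)]
        rfl
      rw [← h3] at h2
      exact ae_of_ae_map measurable_snd.aemeasurable h2
    rw [integral_eq_zero_of_ae]
    filter_upwards [hint] with u hu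
    simp only [Kernel.comap_apply]
    have h4 : Integrable (fun y => y - g u.2) (κ u.2) := hu.sub (integrable_const _)
    rw [integral_inner h4, integral_sub hu (integrable_const _)]
    have h5 : ∫ y, y ∂κ u.2 = g u.2 := rfl
    rw [h5]
    simp

end CondIndep

/-! ### Weighted sums of conditionally centred noise over an i.i.d. sample -/

section WeightedSums

variable {Ω F G 𝒰 : Type*} [MeasurableSpace Ω] [MeasurableSpace 𝒰]
  [NormedAddCommGroup F] [InnerProductSpace ℝ F] [CompleteSpace F]
  [SecondCountableTopology F] [MeasurableSpace F] [BorelSpace F]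
  [NormedAddCommGroup G] [InnerProductSpace ℝ G] [CompleteSpace G]
  [SecondCountableTopology G] [MeasurableSpace G] [BorelSpace G]
  {μ : Measure Ω} [IsProbabilityMeasure μ] {U : Ω → 𝒰} {ξ : Ω → F} {v : 𝒰 → ℝ≥0∞} {n : ℕ}

theorem IsCenteredGiven.measurable_sample (h : IsCenteredGiven μ U ξ v) :
    Measurable fun (d : Fin n → Ω) k => U (d k) :=
  measurable_pi_iff.2 fun k => h.measurable_cov.comp (measurable_pi_apply k)

theorem sample_update (d : Fin n → Ω) (j : Fin n) (ω : Ω) :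
    (fun k => U (Function.update d j ω k)) = Function.update (fun k => U (d k)) j (U ω) :=
  Function.comp_update U d j ω

/-- Resampling coordinate `i` with the others frozen makes the weight a function of `U` at that
coordinate. The weight may therefore depend on the whole sample of `U`, as an in-sample regression
error does. -/
theorem IsCenteredGiven.lintegral_sample_sq (h : IsCenteredGiven μ U ξ v) (i : Fin n)
    {φ : (Fin n → 𝒰) → ℝ≥0∞} (hφ : Measurable φ) :
    ∫⁻ d : Fin n → Ω, φ (fun k => U (d k)) * ‖ξ (d i)‖ₑ ^ 2 ∂(Measure.pi fun _ => μ) =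
      ∫⁻ d : Fin n → Ω, φ (fun k => U (d k)) * v (U (d i)) ∂(Measure.pi fun _ => μ) := by
  have hmp := measurePreserving_update μ i
  have hUm := h.measurable_sample (n := n)
  have m1 : Measurable fun d : Fin n → Ω => φ (fun k => U (d k)) * ‖ξ (d i)‖ₑ ^ 2 :=
    (hφ.comp hUm).mul
      ((h.measurable_noise.comp (measurable_pi_apply i)).enorm.pow_const 2)
  have m2 : Measurable fun d : Fin n → Ω => φ (fun k => U (d k)) * v (U (d i)) :=
    (hφ.comp hUm).mul
      (h.measurable_var.comp (h.measurable_cov.comp (measurable_pi_apply i)))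
  have m1' : Measurable fun q : Ω × (Fin n → Ω) =>
      φ (fun k => U (Function.update q.2 i q.1 k)) * ‖ξ (Function.update q.2 i q.1 i)‖ₑ ^ 2 :=
    m1.comp hmp.measurable
  have m2' : Measurable fun q : Ω × (Fin n → Ω) =>
      φ (fun k => U (Function.update q.2 i q.1 k)) * v (U (Function.update q.2 i q.1 i)) :=
    m2.comp hmp.measurable
  rw [← hmp.lintegral_comp m1, ← hmp.lintegral_comp m2, lintegral_prod_symm' _ m1',
    lintegral_prod_symm' _ m2']
  refine lintegral_congr fun d => ?_
  simp only [sample_update, Function.update_self]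
  exact h.lintegral_sq (fun u => φ (Function.update (fun k => U (d k)) i u))
    (hφ.comp (measurable_update _))

/-- Resample coordinate `j` alone: `ξ (d i)` is frozen, so the integrand pairs `ξ` at `j` with a
vector that depends only on `U` there. -/
theorem IsCenteredGiven.integral_sample_cross (h : IsCenteredGiven μ U ξ v) {i j : Fin n}
    (hij : i ≠ j) {φ : (Fin n → 𝒰) → ℝ} (hφ : Measurable φ)
    (hi : Integrable (fun d : Fin n → Ω => φ (fun k => U (d k)) * inner ℝ (ξ (d i)) (ξ (d j)))
      (Measure.pi fun _ => μ)) :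
    ∫ d : Fin n → Ω, φ (fun k => U (d k)) * inner ℝ (ξ (d i)) (ξ (d j))
      ∂(Measure.pi fun _ => μ) = 0 := by
  have hmp := measurePreserving_update μ j
  have hi' := (hmp.integrable_comp hi.aestronglyMeasurable).2 hi
  have e := integral_map hmp.measurable.aemeasurable
    (f := fun d : Fin n → Ω => φ (fun k => U (d k)) * inner ℝ (ξ (d i)) (ξ (d j)))
    (hmp.map_eq.symm ▸ hi.aestronglyMeasurable)
  rw [hmp.map_eq] at e
  rw [e]
  change Integrable (fun q : Ω × (Fin n → Ω) => φ (fun k => U (Function.update q.2 j q.1 k)) *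
    inner ℝ (ξ (Function.update q.2 j q.1 i)) (ξ (Function.update q.2 j q.1 j))) _ at hi'
  rw [integral_prod_symm _ hi', integral_eq_zero_of_ae]
  filter_upwards [hi'.prod_left_ae] with d hd
  simp only [sample_update, Function.update_self, Function.update_of_ne hij] at hd ⊢
  have e2 : ∀ ω, φ (Function.update (fun k => U (d k)) j (U ω)) * inner ℝ (ξ (d i)) (ξ ω) =
      inner ℝ (φ (Function.update (fun k => U (d k)) j (U ω)) • ξ (d i)) (ξ ω) := fun ω => by
    rw [real_inner_smul_left]
  simp only [e2] at hd ⊢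
  exact h.integral_inner (fun u => φ (Function.update (fun k => U (d k)) j u) • ξ (d i))
    ((hφ.comp (measurable_update _)).smul_const _) hd

/-- In the Gram expansion of the squared norm the off-diagonal terms have mean zero, and each
diagonal term has the stated conditional second moment. -/
theorem IsCenteredGiven.lintegral_norm_sq_sum_outer_le (h : IsCenteredGiven μ U ξ v)
    {w : Fin n → (Fin n → 𝒰) → G} (hw : ∀ i, Measurable (w i)) :
    ∫⁻ d : Fin n → Ω, ENNReal.ofReal
        (‖∑ i, HilbertSchmidt.outer (w i fun k => U (d k)) (ξ (d i))‖ ^ 2)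
        ∂(Measure.pi fun _ => μ) ≤
      ∫⁻ d : Fin n → Ω, ∑ i, ‖w i fun k => U (d k)‖ₑ ^ 2 * v (U (d i))
        ∂(Measure.pi fun _ => μ) := by
  set π : Measure (Fin n → Ω) := Measure.pi fun _ => μ with hπ
  have hUm := h.measurable_sample (n := n)
  have hwm : ∀ i, Measurable fun d : Fin n → Ω => w i fun k => U (d k) :=
    fun i => (hw i).comp hUm
  have hξm : ∀ i, Measurable fun d : Fin n → Ω => ξ (d i) :=
    fun i => h.measurable_noise.comp (measurable_pi_apply i)
  have hvm : ∀ i, Measurable fun d : Fin n → Ω => v (U (d i)) :=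
    fun i => h.measurable_var.comp (h.measurable_cov.comp (measurable_pi_apply i))
  -- In the finite case the diagonal terms are integrable and dominate the cross terms, which is
  -- what makes the orthogonality available.
  by_cases htop : ∫⁻ d : Fin n → Ω, ∑ i, ‖w i fun k => U (d k)‖ₑ ^ 2 * v (U (d i)) ∂π = ∞
  · rw [htop]
    exact le_top
  have hsum : ∫⁻ d : Fin n → Ω, ∑ i, ‖w i fun k => U (d k)‖ₑ ^ 2 * v (U (d i)) ∂π =
      ∑ i, ∫⁻ d : Fin n → Ω, ‖w i fun k => U (d k)‖ₑ ^ 2 * ‖ξ (d i)‖ₑ ^ 2 ∂π := by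
    have hm : ∀ i, Measurable fun d : Fin n → Ω => ‖w i fun k => U (d k)‖ₑ ^ 2 * v (U (d i)) :=
      fun i => ((hwm i).enorm.pow_const 2).mul (hvm i)
    rw [lintegral_finsetSum _ fun i _ => hm i]
    exact Finset.sum_congr rfl fun i _ =>
      (h.lintegral_sample_sq i (φ := fun u => ‖w i u‖ₑ ^ 2) ((hw i).enorm.pow_const 2)).symm
  have hfin : ∀ i, ∫⁻ d : Fin n → Ω, ‖w i fun k => U (d k)‖ₑ ^ 2 * ‖ξ (d i)‖ₑ ^ 2 ∂π ≠ ∞ := by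
    intro i
    rw [hsum] at htop
    exact ne_top_of_le_ne_top htop (Finset.single_le_sum (f := fun i =>
      ∫⁻ d : Fin n → Ω, ‖w i fun k => U (d k)‖ₑ ^ 2 * ‖ξ (d i)‖ₑ ^ 2 ∂π)
      (fun _ _ => zero_le) (Finset.mem_univ i))
  set q : Fin n → (Fin n → Ω) → ℝ := fun i d => (‖w i fun k => U (d k)‖ * ‖ξ (d i)‖) ^ 2 with hq
  have hqm : ∀ i, Measurable (q i) := fun i => ((hwm i).norm.mul (hξm i).norm).pow_const 2
  have hqe : ∀ i d, ENNReal.ofReal (q i d) =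
      ‖w i fun k => U (d k)‖ₑ ^ 2 * ‖ξ (d i)‖ₑ ^ 2 := by
    intro i d
    change ENNReal.ofReal ((‖w i fun k => U (d k)‖ * ‖ξ (d i)‖) ^ 2) = _
    rw [ENNReal.ofReal_pow (by positivity), ENNReal.ofReal_mul (norm_nonneg _),
      ofReal_norm, ofReal_norm, mul_pow]
  have hqi : ∀ i, Integrable (q i) π := by
    intro i
    refine ⟨(hqm i).aestronglyMeasurable, ?_⟩
    refine (hasFiniteIntegral_iff_ofReal (ae_of_all _ fun d => sq_nonneg _)).2 ?_
    rw [lintegral_congr (hqe i)]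
    exact (hfin i).lt_top
  set t : Fin n → Fin n → (Fin n → Ω) → ℝ := fun i j d =>
    inner ℝ (w i fun k => U (d k)) (w j fun k => U (d k)) * inner ℝ (ξ (d i)) (ξ (d j)) with ht
  have htm : ∀ i j, Measurable (t i j) := fun i j =>
    ((hwm i).inner (hwm j)).mul ((hξm i).inner (hξm j))
  have hti : ∀ i j, Integrable (t i j) π := by
    intro i j
    refine ((hqi i).add (hqi j)).mono' (htm i j).aestronglyMeasurable (ae_of_all _ fun d => ?_)
    have b1 := abs_real_inner_le_norm (w i fun k => U (d k)) (w j fun k => U (d k))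
    have b2 := abs_real_inner_le_norm (ξ (d i)) (ξ (d j))
    rw [Real.norm_eq_abs, ht, abs_mul]
    refine (mul_le_mul b1 b2 (abs_nonneg _) (by positivity)).trans ?_
    simp only [Pi.add_apply, hq]
    nlinarith [sq_nonneg (‖w i fun k => U (d k)‖ * ‖ξ (d i)‖ - ‖w j fun k => U (d k)‖ * ‖ξ (d j)‖),
      sq_nonneg (‖w i fun k => U (d k)‖ * ‖ξ (d i)‖), sq_nonneg (‖w j fun k => U (d k)‖ * ‖ξ (d j)‖)]
  have htz : ∀ i j, i ≠ j → ∫ d, t i j d ∂π = 0 := fun i j hij =>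
    h.integral_sample_cross hij (φ := fun u => inner ℝ (w i u) (w j u)) ((hw i).inner (hw j))
      (hti i j)
  simp only [HilbertSchmidt.norm_sq_sum_outer]
  have hnn : ∀ d : Fin n → Ω, 0 ≤ ∑ i, ∑ j, t i j d := by
    intro d
    simp only [ht]
    rw [← HilbertSchmidt.norm_sq_sum_outer]
    positivity
  have hint : Integrable (fun d => ∑ i, ∑ j, t i j d) π :=
    integrable_finsetSum _ fun i _ => integrable_finsetSum _ fun j _ => hti i j
  change ∫⁻ d, ENNReal.ofReal (∑ i, ∑ j, t i j d) ∂π ≤ _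
  rw [← ofReal_integral_eq_lintegral_ofReal hint (ae_of_all _ hnn), hsum,
    integral_finsetSum _ fun i _ => integrable_finsetSum _ fun j _ => hti i j]
  have e1 : ∀ i, ∫ d, ∑ j, t i j d ∂π = ∫ d, q i d ∂π := by
    intro i
    rw [integral_finsetSum _ fun j _ => hti i j,
      Finset.sum_eq_single i (fun j _ hj => htz i j hj.symm) (by simp)]
    refine integral_congr_ae (ae_of_all _ fun d => ?_)
    simp only [ht, hq, real_inner_self_eq_norm_sq, mul_pow]
  simp only [e1]
  rw [ENNReal.ofReal_sum_of_nonneg fun i _ => integral_nonneg fun d => sq_nonneg _]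
  refine Finset.sum_le_sum fun i _ => ?_
  rw [ofReal_integral_eq_lintegral_ofReal (hqi i) (ae_of_all _ fun d => sq_nonneg _)]
  simp only [hqe]
  exact le_rfl

theorem IsCenteredGiven.lintegral_sum_sq_mul_sq (h : IsCenteredGiven μ U ξ v)
    {w : Fin n → (Fin n → 𝒰) → G} (hw : ∀ i, Measurable (w i)) :
    ∫⁻ d : Fin n → Ω, ∑ i, ‖w i fun k => U (d k)‖ₑ ^ 2 * ‖ξ (d i)‖ₑ ^ 2
        ∂(Measure.pi fun _ => μ) =
      ∫⁻ d : Fin n → Ω, ∑ i, ‖w i fun k => U (d k)‖ₑ ^ 2 * v (U (d i))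
        ∂(Measure.pi fun _ => μ) := by
  have hUm := h.measurable_sample (n := n)
  have m1 : ∀ i, Measurable fun d : Fin n → Ω =>
      ‖w i fun k => U (d k)‖ₑ ^ 2 * ‖ξ (d i)‖ₑ ^ 2 := fun i =>
    (((hw i).comp hUm).enorm.pow_const 2).mul
      ((h.measurable_noise.comp (measurable_pi_apply i)).enorm.pow_const 2)
  have m2 : ∀ i, Measurable fun d : Fin n → Ω => ‖w i fun k => U (d k)‖ₑ ^ 2 * v (U (d i)) :=
    fun i => (((hw i).comp hUm).enorm.pow_const 2).mul
      (h.measurable_var.comp (h.measurable_cov.comp (measurable_pi_apply i)))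
  rw [lintegral_finsetSum _ fun i _ => m1 i, lintegral_finsetSum _ fun i _ => m2 i]
  exact Finset.sum_congr rfl fun i _ =>
    h.lintegral_sample_sq i (φ := fun u => ‖w i u‖ₑ ^ 2) ((hw i).enorm.pow_const 2)

/-- Chebyshev bounds for weighted sums, after truncating the conditional variance at `c`. -/
theorem IsCenteredGiven.measure_weighted_le (h : IsCenteredGiven μ U ξ v)
    {w : Fin n → (Fin n → 𝒰) → G} (hw : ∀ i, Measurable (w i)) (c : ℝ≥0∞) {δ : ℝ≥0∞}
    (hδ : δ ≠ 0) (hδ' : δ ≠ ∞) :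
    (Measure.pi fun _ => μ) {d : Fin n → Ω | δ ≤ ENNReal.ofReal
        (‖∑ i, HilbertSchmidt.outer (w i fun k => U (d k)) (ξ (d i))‖ ^ 2)} ≤
      (Measure.pi fun _ => μ)
        {d : Fin n → Ω | c < ∑ i, ‖w i fun k => U (d k)‖ₑ ^ 2 * v (U (d i))} + c / δ ∧
    (Measure.pi fun _ => μ) {d : Fin n → Ω | δ ≤
        ∑ i, ‖w i fun k => U (d k)‖ₑ ^ 2 * ‖ξ (d i)‖ₑ ^ 2} ≤
      (Measure.pi fun _ => μ)
        {d : Fin n → Ω | c < ∑ i, ‖w i fun k => U (d k)‖ₑ ^ 2 * v (U (d i))} + c / δ := by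
  set π : Measure (Fin n → Ω) := Measure.pi fun _ => μ with hπ
  -- The truncation event depends on the `U` sample only, so the weights cut off outside it remain
  -- admissible and have conditional variance at most `c`. Markov's inequality then applies without
  -- any integrability of the original weights.
  set A : Set (Fin n → 𝒰) := {u | ∑ i, ‖w i u‖ₑ ^ 2 * v (u i) ≤ c} with hA
  have hAm : MeasurableSet A := measurableSet_le (Finset.measurable_fun_sum _ fun i _ =>
    ((hw i).enorm.pow_const 2).mul (h.measurable_var.comp (measurable_pi_apply i)))
    measurable_const
  set w' : Fin n → (Fin n → 𝒰) → G := fun i => A.indicator (w i) with hw'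
  have hwm' : ∀ i, Measurable (w' i) := fun i => (hw i).indicator hAm
  have hbound : ∫⁻ d : Fin n → Ω, ∑ i, ‖w' i fun k => U (d k)‖ₑ ^ 2 * v (U (d i)) ∂π ≤ c := by
    refine (lintegral_mono (g := fun _ => c) fun d => ?_).trans_eq (by simp)
    by_cases hd : (fun k => U (d k)) ∈ A
    · simp only [hw', Set.indicator_of_mem hd]
      exact hd
    · simp [hw', Set.indicator_of_notMem hd]
  have hUm := h.measurable_sample (n := n)
  have hξm : ∀ i, Measurable fun d : Fin n → Ω => ξ (d i) :=
    fun i => h.measurable_noise.comp (measurable_pi_apply i)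
  have main : ∀ Q : (Fin n → G) → (Fin n → Ω) → ℝ≥0∞,
      Measurable (fun d => Q (fun i => w' i fun k => U (d k)) d) →
      ∫⁻ d, Q (fun i => w' i fun k => U (d k)) d ∂π ≤ c →
      π {d | δ ≤ Q (fun i => w i fun k => U (d k)) d} ≤
        π {d : Fin n → Ω | c < ∑ i, ‖w i fun k => U (d k)‖ₑ ^ 2 * v (U (d i))} + c / δ := by
    intro Q hQm hQ
    have hsub : {d | δ ≤ Q (fun i => w i fun k => U (d k)) d} ⊆
        {d : Fin n → Ω | c < ∑ i, ‖w i fun k => U (d k)‖ₑ ^ 2 * v (U (d i))} ∪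
        {d | δ ≤ Q (fun i => w' i fun k => U (d k)) d} := by
      intro d hd
      by_cases hdA : (fun k => U (d k)) ∈ A
      · right
        simpa only [hw', Set.mem_ofPred_eq, Set.indicator_of_mem hdA] using hd
      · left
        have hdA' : ¬ ∑ i, ‖w i fun k => U (d k)‖ₑ ^ 2 * v (U (d i)) ≤ c := hdA
        exact not_le.1 hdA'
    refine (measure_mono hsub).trans ((measure_union_le _ _).trans (add_le_add le_rfl ?_))
    refine (meas_ge_le_lintegral_div hQm.aemeasurable hδ hδ').trans ?_
    exact ENNReal.div_le_div_right hQ _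
  refine ⟨main (fun y d => ENNReal.ofReal (‖∑ i, HilbertSchmidt.outer (y i) (ξ (d i))‖ ^ 2)) ?_
    ((h.lintegral_norm_sq_sum_outer_le hwm').trans hbound),
    main (fun y d => ∑ i, ‖y i‖ₑ ^ 2 * ‖ξ (d i)‖ₑ ^ 2) ?_
    ((h.lintegral_sum_sq_mul_sq hwm').trans_le hbound)⟩
  · refine ENNReal.measurable_ofReal.comp ?_
    simp only [HilbertSchmidt.norm_sq_sum_outer]
    exact Finset.measurable_fun_sum _ fun i _ => Finset.measurable_fun_sum _ fun j _ =>
      (((hwm' i).comp hUm).inner ((hwm' j).comp hUm)).mul ((hξm i).inner (hξm j))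
  · exact Finset.measurable_fun_sum _ fun i _ =>
      (((hwm' i).comp hUm).enorm.pow_const 2).mul ((hξm i).enorm.pow_const 2)

end WeightedSums

/-! ### Convergence to zero in probability along a filter -/

section SmallInProb

variable {𝒳 : ℕ → Type*} [∀ n, MeasurableSpace (𝒳 n)] {l l' : Filter ℕ}
  {π : ∀ n, Measure (𝒳 n)} {W W' : ∀ n, 𝒳 n → ℝ≥0∞}

/-- `W n → 0` in (outer) probability along `l`. -/
def SmallInProb (l : Filter ℕ) (π : ∀ n, Measure (𝒳 n)) (W : ∀ n, 𝒳 n → ℝ≥0∞) : Prop :=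
  ∀ δ : ℝ≥0∞, 0 < δ → Tendsto (fun n => π n {d | δ ≤ W n d}) l (𝓝 0)

theorem SmallInProb.mono_left (h : SmallInProb l π W) (hl : l' ≤ l) : SmallInProb l' π W :=
  fun δ hδ => (h δ hδ).mono_left hl

theorem SmallInProb.mono (h : SmallInProb l π W') (hW : ∀ᶠ n in l, ∀ d, W n d ≤ W' n d) :
    SmallInProb l π W := fun δ hδ =>
  tendsto_of_tendsto_of_tendsto_of_le_of_le' tendsto_const_nhds (h δ hδ)
    (Eventually.of_forall fun _ => zero_le)
    (hW.mono fun _ hn => measure_mono fun d hd => le_trans hd (hn d))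

theorem SmallInProb.of_subset_union (h : SmallInProb l π W) (h' : SmallInProb l π W')
    {δ δ' : ℝ≥0∞} (hδ : 0 < δ) (hδ' : 0 < δ') {s : ∀ n, Set (𝒳 n)}
    (hs : ∀ᶠ n in l, ∀ d ∈ s n, δ ≤ W n d ∨ δ' ≤ W' n d) :
    Tendsto (fun n => π n (s n)) l (𝓝 0) := by
  have := (h δ hδ).add (h' δ' hδ')
  rw [add_zero] at this
  exact tendsto_of_tendsto_of_tendsto_of_le_of_le' tendsto_const_nhds this
    (Eventually.of_forall fun _ => zero_le)
    (hs.mono fun n hn => (measure_mono fun d hd => hn d hd).trans (measure_union_le _ _))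

theorem SmallInProb.add (h : SmallInProb l π W) (h' : SmallInProb l π W') :
    SmallInProb l π fun n d => W n d + W' n d := by
  intro δ hδ
  refine h.of_subset_union h' (ENNReal.half_pos hδ.ne') (ENNReal.half_pos hδ.ne')
    (Eventually.of_forall fun n d hd => ?_)
  by_contra! hc
  have := ENNReal.add_lt_add hc.1 hc.2
  rw [ENNReal.add_halves] at this
  exact absurd hd (not_le.2 this)

theorem SmallInProb.const_mul (h : SmallInProb l π W) {c : ℝ≥0∞} (hc : c ≠ ∞) :
    SmallInProb l π fun n d => c * W n d := by
  intro δ hδ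
  refine tendsto_of_tendsto_of_tendsto_of_le_of_le tendsto_const_nhds
    (h (δ / c) (ENNReal.div_pos hδ.ne' hc)) (fun _ => zero_le) fun n => measure_mono fun d hd => ?_
  exact ENNReal.div_le_of_le_mul' hd

theorem SmallInProb.of_forall_pos
    (h : ∀ ε : ℝ≥0∞, 0 < ε → ε ≠ ∞ → ∃ W' : ∀ n, 𝒳 n → ℝ≥0∞, SmallInProb l π W' ∧
      ∀ᶠ n in l, ∀ d, W n d ≤ ε + W' n d) : SmallInProb l π W := by
  intro δ hδ
  obtain ⟨ε, hε, hεδ⟩ := exists_between hδ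
  obtain ⟨W', hW', hle⟩ := h ε hε hεδ.ne_top
  refine tendsto_of_tendsto_of_tendsto_of_le_of_le' tendsto_const_nhds
    (hW' (δ - ε) (tsub_pos_of_lt hεδ)) (Eventually.of_forall fun _ => zero_le)
    (hle.mono fun n hn => measure_mono fun d hd => ?_)
  exact tsub_le_iff_left.2 (le_trans hd (hn d))

theorem SmallInProb.of_lintegral (hm : ∀ n, AEMeasurable (W n) (π n))
    (h : Tendsto (fun n => ∫⁻ d, W n d ∂π n) l (𝓝 0)) : SmallInProb l π W := by
  have key : ∀ δ : ℝ≥0∞, 0 < δ → δ ≠ ∞ → Tendsto (fun n => π n {d | δ ≤ W n d}) l (𝓝 0) := by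
    intro δ hδ hδt
    have h2 := ENNReal.Tendsto.div_const h (b := δ) (Or.inr hδ.ne')
    rw [ENNReal.zero_div] at h2
    exact tendsto_of_tendsto_of_tendsto_of_le_of_le tendsto_const_nhds h2 (fun _ => zero_le)
      fun n => meas_ge_le_lintegral_div (hm n) hδ.ne' hδt
  intro δ hδ
  obtain ⟨ε, hε, hεδ⟩ := exists_between hδ
  exact tendsto_of_tendsto_of_tendsto_of_le_of_le tendsto_const_nhds (key ε hε hεδ.ne_top)
    (fun _ => zero_le) fun n => measure_mono fun d hd => hεδ.le.trans hd

end SmallInProb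

theorem UnifTendstoZeroInProb.smallInProb {Ω : Type*} [MeasurableSpace Ω]
    {S : Set (ProbabilityMeasure Ω)} {W : (n : ℕ) → ProbabilityMeasure Ω → (Fin n → Ω) → ℝ≥0∞}
    (h : UnifTendstoZeroInProb S W) {P : ℕ → ProbabilityMeasure Ω} (hP : ∀ n, P n ∈ S) :
    SmallInProb atTop (fun n => sampleLaw (P n) n) fun n => W n (P n) := fun δ hδ =>
  tendsto_of_tendsto_of_tendsto_of_le_of_le tendsto_const_nhds (h δ hδ) (fun _ => zero_le)
    fun n => le_iSup₂ (f := fun Q _ => sampleLaw Q n {d | δ ≤ W n Q d}) (P n) (hP n)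

/-! ### Weighted noise sums are negligible when their conditional variance is -/

section WeightedSmall

variable {Ω F G 𝒰 : Type*} [MeasurableSpace Ω] [MeasurableSpace 𝒰]
  [NormedAddCommGroup F] [InnerProductSpace ℝ F] [CompleteSpace F]
  [SecondCountableTopology F] [MeasurableSpace F] [BorelSpace F]
  [NormedAddCommGroup G] [InnerProductSpace ℝ G] [CompleteSpace G]
  [SecondCountableTopology G] [MeasurableSpace G] [BorelSpace G]
  {P : ℕ → ProbabilityMeasure Ω} {U : Ω → 𝒰} {ξ : ℕ → Ω → F} {v : ℕ → 𝒰 → ℝ≥0∞}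
  {w : ∀ n, Fin n → (Fin n → 𝒰) → G}

theorem smallInProb_of_weighted {X Y : ∀ n, (Fin n → Ω) → ℝ≥0∞}
    (hX : SmallInProb atTop (fun n => sampleLaw (P n) n) fun n d => (n : ℝ≥0∞)⁻¹ * X n d)
    (hb : ∀ n, ∀ c δ : ℝ≥0∞, δ ≠ 0 → δ ≠ ∞ → sampleLaw (P n) n {d | δ ≤ Y n d} ≤
      sampleLaw (P n) n {d | c < X n d} + c / δ) :
    SmallInProb atTop (fun n => sampleLaw (P n) n) fun n d => (n : ℝ≥0∞)⁻¹ * Y n d := by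
  intro δ hδ
  obtain ⟨δ', hδ', hlt⟩ := exists_between hδ
  have hδt : δ' ≠ ∞ := hlt.ne_top
  rw [ENNReal.tendsto_nhds_zero]
  intro ε hε
  obtain ⟨ε', hε', hεlt⟩ := exists_between hε
  have hεt : ε' ≠ ∞ := hεlt.ne_top
  -- With threshold `n * δ'` and truncation level `n * (δ' * (ε' / 2))` the Chebyshev term is `ε' /
  -- 2`; the other half pays for the truncation. The intermediate `δ'` and `ε'` are finite even if
  -- `δ` and `ε` are not.
  have hc : 0 < δ' * (ε' / 2) := ENNReal.mul_pos hδ'.ne' (ENNReal.half_pos hε'.ne').ne'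
  have h2 := (ENNReal.tendsto_nhds_zero.1 (hX _ hc)) (ε' / 2) (ENNReal.half_pos hε'.ne')
  filter_upwards [h2, eventually_gt_atTop 0] with n hn hn0
  have hn1 : (n : ℝ≥0∞) ≠ 0 := by exact_mod_cast hn0.ne'
  have hn2 : (n : ℝ≥0∞) ≠ ∞ := ENNReal.natCast_ne_top n
  refine (measure_mono (t := {d | n * δ' ≤ Y n d}) fun d hd => ?_).trans
    ((hb n (n * (δ' * (ε' / 2))) (n * δ') (mul_ne_zero hn1 hδ'.ne')
      (ENNReal.mul_ne_top hn2 hδt)).trans ?_)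
  · have hd' : δ' ≤ (n : ℝ≥0∞)⁻¹ * Y n d := hlt.le.trans hd
    calc (n : ℝ≥0∞) * δ' ≤ n * ((n : ℝ≥0∞)⁻¹ * Y n d) := by gcongr
      _ = Y n d := by rw [← mul_assoc, ENNReal.mul_inv_cancel hn1 hn2, one_mul]
  · have e1 : n * (δ' * (ε' / 2)) / (n * δ') = ε' / 2 := by
      rw [← mul_assoc, mul_comm, mul_div_assoc,
        ENNReal.div_self (mul_ne_zero hn1 hδ'.ne') (ENNReal.mul_ne_top hn2 hδt), mul_one]
    rw [e1]
    refine (add_le_add ((measure_mono fun d hd => ?_).trans hn) le_rfl).trans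
      ((ENNReal.add_halves ε').le.trans hεlt.le)
    have hd' : n * (δ' * (ε' / 2)) < X n d := hd
    calc δ' * (ε' / 2) = (n : ℝ≥0∞)⁻¹ * (n * (δ' * (ε' / 2))) := by
          rw [← mul_assoc, ENNReal.inv_mul_cancel hn1 hn2, one_mul]
      _ ≤ (n : ℝ≥0∞)⁻¹ * X n d := by gcongr

theorem smallInProb_weighted_sums
    (h : ∀ n, IsCenteredGiven (P n : Measure Ω) U (ξ n) (v n)) (hw : ∀ n i, Measurable (w n i))
    (hs : SmallInProb atTop (fun n => sampleLaw (P n) n) fun n d =>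
      (n : ℝ≥0∞)⁻¹ * ∑ i, ‖w n i fun k => U (d k)‖ₑ ^ 2 * v n (U (d i))) :
    (SmallInProb atTop (fun n => sampleLaw (P n) n) fun n d => (n : ℝ≥0∞)⁻¹ * ENNReal.ofReal
        (‖∑ i, HilbertSchmidt.outer (w n i fun k => U (d k)) (ξ n (d i))‖ ^ 2)) ∧
      SmallInProb atTop (fun n => sampleLaw (P n) n) fun n d =>
        (n : ℝ≥0∞)⁻¹ * ∑ i, ‖w n i fun k => U (d k)‖ₑ ^ 2 * ‖ξ n (d i)‖ₑ ^ 2 :=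
  ⟨smallInProb_of_weighted hs fun n c _ hδ hδ' => ((h n).measure_weighted_le (hw n) c hδ hδ').1,
    smallInProb_of_weighted hs fun n c _ hδ hδ' => ((h n).measure_weighted_le (hw n) c hδ hδ').2⟩

end WeightedSmall

/-! ### The residual products are close to the products of the noise -/

section Remainder

variable {E F 𝒵 : Type*}
  [NormedAddCommGroup E] [InnerProductSpace ℝ E] [CompleteSpace E] [SecondCountableTopology E]
  [MeasurableSpace E] [BorelSpace E]
  [NormedAddCommGroup F] [InnerProductSpace ℝ F] [CompleteSpace F] [SecondCountableTopology F]
  [MeasurableSpace F] [BorelSpace F]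
  [MeasurableSpace 𝒵]

theorem isCenteredGiven_noiseY {P : ProbabilityMeasure (E × F × 𝒵)}
    (hP : P ∈ condIndepNull E F 𝒵)
    (hY : Integrable (fun p : E × F × 𝒵 => p.2.1) (P : Measure (E × F × 𝒵))) :
    IsCenteredGiven (P : Measure (E × F × 𝒵)) (fun p => (p.1, p.2.2)) (noiseY P)
      (fun u => condVarY P u.2) := by
  refine isCenteredGiven_of_condIndep P measurable_fst measurable_snd.fst measurable_snd.snd hY
    fun A B hA hB => ?_
  exact hP (A.indicator fun _ => 1) (B.indicator fun _ => 1) (measurable_const.indicator hA)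
    (measurable_const.indicator hB)
    ⟨1, fun x => by by_cases h : x ∈ A <;> simp [h]⟩
    ⟨1, fun x => by by_cases h : x ∈ B <;> simp [h]⟩

theorem isCenteredGiven_noiseX {P : ProbabilityMeasure (E × F × 𝒵)}
    (hP : P ∈ condIndepNull E F 𝒵)
    (hX : Integrable (fun p : E × F × 𝒵 => p.1) (P : Measure (E × F × 𝒵))) :
    IsCenteredGiven (P : Measure (E × F × 𝒵)) (fun p => (p.2.1, p.2.2)) (noiseX P)
      (fun u => condVarX P u.2) := by
  refine isCenteredGiven_of_condIndep P measurable_snd.fst measurable_fst measurable_snd.snd hX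
    fun A B hA hB => ?_
  have := hP (B.indicator fun _ => 1) (A.indicator fun _ => 1) (measurable_const.indicator hB)
    (measurable_const.indicator hA)
    ⟨1, fun x => by by_cases h : x ∈ B <;> simp [h]⟩
    ⟨1, fun x => by by_cases h : x ∈ A <;> simp [h]⟩
  rw [mul_comm]
  simpa only [mul_comm] using this

/-- The product `ε_P ⊗ ξ_P` of the noise variables. -/
def noiseProd (P : ProbabilityMeasure (E × F × 𝒵)) (p : E × F × 𝒵) : HilbertSchmidt E F :=
  HilbertSchmidt.outer (noiseX P p) (noiseY P p)

/-- The residual products `R_i` as functions of the data. -/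
def sampleResidualProd (fhat : RegMethod E 𝒵) (ghat : RegMethod F 𝒵) (n : ℕ)
    (d : Fin n → E × F × 𝒵) : Fin n → HilbertSchmidt E F :=
  residualProd (fun i => (d i).1 - fitX fhat d i) (fun i => (d i).2.1 - fitY ghat d i)

theorem sampleResidualProd_sub_noiseProd (fhat : RegMethod E 𝒵) (ghat : RegMethod F 𝒵) (n : ℕ)
    (P : ProbabilityMeasure (E × F × 𝒵)) (d : Fin n → E × F × 𝒵) (i : Fin n) :
    sampleResidualProd fhat ghat n d i - noiseProd P (d i) =
      HilbertSchmidt.outer (regX P (d i).2.2 - fitX fhat d i) (noiseY P (d i)) +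
        HilbertSchmidt.outer (noiseX P (d i)) (regY P (d i).2.2 - fitY ghat d i) +
        HilbertSchmidt.outer (regX P (d i).2.2 - fitX fhat d i)
          (regY P (d i).2.2 - fitY ghat d i) := by
  have e1 : (d i).1 - fitX fhat d i = noiseX P (d i) + (regX P (d i).2.2 - fitX fhat d i) := by
    rw [noiseX]; abel
  have e2 : (d i).2.1 - fitY ghat d i = noiseY P (d i) + (regY P (d i).2.2 - fitY ghat d i) := by
    rw [noiseY]; abel
  rw [sampleResidualProd, residualProd, e1, e2, HilbertSchmidt.outer_add_left,
    HilbertSchmidt.outer_add_right, HilbertSchmidt.outer_add_right, noiseProd]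
  abel

theorem ofReal_norm_sq_add_three_le {H : Type*} [NormedAddCommGroup H] (x y z : H) :
    ENNReal.ofReal (‖x + y + z‖ ^ 2) ≤ 3 * (ENNReal.ofReal (‖x‖ ^ 2) + ENNReal.ofReal (‖y‖ ^ 2) +
      ENNReal.ofReal (‖z‖ ^ 2)) := by
  have h : ‖x + y + z‖ ^ 2 ≤ 3 * (‖x‖ ^ 2 + ‖y‖ ^ 2 + ‖z‖ ^ 2) := by
    have h1 := norm_add₃_le (a := x) (b := y) (c := z)
    have h2 := pow_le_pow_left₀ (norm_nonneg _) h1 2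
    nlinarith [sq_nonneg (‖x‖ - ‖y‖), sq_nonneg (‖x‖ - ‖z‖), sq_nonneg (‖y‖ - ‖z‖)]
  refine (ENNReal.ofReal_le_ofReal h).trans_eq ?_
  rw [ENNReal.ofReal_mul (by norm_num), ENNReal.ofReal_add (by positivity) (by positivity),
    ENNReal.ofReal_add (by positivity) (by positivity), ENNReal.ofReal_ofNat]

theorem ofReal_norm_sq_outer (a : E) (b : F) :
    ENNReal.ofReal (‖HilbertSchmidt.outer a b‖ ^ 2) = ‖a‖ₑ ^ 2 * ‖b‖ₑ ^ 2 := by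
  rw [HilbertSchmidt.norm_outer, ENNReal.ofReal_pow (by positivity),
    ENNReal.ofReal_mul (norm_nonneg _), ofReal_norm, ofReal_norm, mul_pow]

/-- The Gram formula is symmetric in the two factors, so a result with the noise in the second slot
also serves when it is in the first. -/
theorem norm_sum_outer_comm {n : ℕ} (a : Fin n → E) (b : Fin n → F) :
    ‖∑ i, HilbertSchmidt.outer (a i) (b i)‖ ^ 2 = ‖∑ i, HilbertSchmidt.outer (b i) (a i)‖ ^ 2 := by
  rw [HilbertSchmidt.norm_sq_sum_outer, HilbertSchmidt.norm_sq_sum_outer]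
  simp only [mul_comm]

theorem ofReal_norm_sq_sum_outer_le {n : ℕ} (a : Fin n → E) (b : Fin n → F) :
    ENNReal.ofReal (‖∑ i, HilbertSchmidt.outer (a i) (b i)‖ ^ 2) ≤
      (∑ i, ‖a i‖ₑ ^ 2) * ∑ i, ‖b i‖ₑ ^ 2 := by
  have h : ‖∑ i, HilbertSchmidt.outer (a i) (b i)‖ ^ 2 ≤ (∑ i, ‖a i‖ ^ 2) * ∑ i, ‖b i‖ ^ 2 := by
    refine (pow_le_pow_left₀ (norm_nonneg _) (norm_sum_le _ _) 2).trans ?_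
    simp only [HilbertSchmidt.norm_outer]
    exact Finset.sum_mul_sq_le_sq_mul_sq _ _ _
  refine (ENNReal.ofReal_le_ofReal h).trans_eq ?_
  rw [ENNReal.ofReal_mul (Finset.sum_nonneg fun i _ => sq_nonneg _),
    ENNReal.ofReal_sum_of_nonneg fun i _ => sq_nonneg _,
    ENNReal.ofReal_sum_of_nonneg fun i _ => sq_nonneg _]
  simp only [ENNReal.ofReal_pow (norm_nonneg _), ofReal_norm]

theorem sum_mul_le_sum_mul_sum {n : ℕ} (a b : Fin n → ℝ≥0∞) :
    ∑ i, a i * b i ≤ (∑ i, a i) * ∑ i, b i := by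
  rw [Finset.sum_mul]
  refine Finset.sum_le_sum fun i _ => ?_
  gcongr
  exact Finset.single_le_sum (f := b) (fun _ _ => zero_le) (Finset.mem_univ i)

variable {fhat : RegMethod E 𝒵} {ghat : RegMethod F 𝒵} {S : Set (ProbabilityMeasure (E × F × 𝒵))}

theorem measurable_regX (P : ProbabilityMeasure (E × F × 𝒵)) : Measurable (regX P) :=
  measurable_condMean _ _ _

theorem measurable_regY (P : ProbabilityMeasure (E × F × 𝒵)) : Measurable (regY P) :=
  measurable_condMean _ _ _

theorem measurable_regression_error {G : Type*} [NormedAddCommGroup G] [InnerProductSpace ℝ G]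
    [SecondCountableTopology G] [MeasurableSpace G] [BorelSpace G] {r : RegMethod G 𝒵}
    (hr : r.MeasurableFit) {m : 𝒵 → G} (hm : Measurable m) (n : ℕ) (i : Fin n) :
    Measurable fun u : Fin n → G × 𝒵 =>
      m (u i).2 - r n (fun j => (u j).1) (fun j => (u j).2) (u i).2 := by
  refine (hm.comp (measurable_pi_apply i).snd).sub ?_
  have h1 : Measurable fun u : Fin n → G × 𝒵 => ((fun j => (u j).1), fun j => (u j).2) :=
    (measurable_pi_iff.2 fun j => (measurable_pi_apply j).fst).prodMk
      (measurable_pi_iff.2 fun j => (measurable_pi_apply j).snd)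
  exact (hr n i).comp h1

/-- Of the three terms, `f`-error times `ξ` is handled by conditioning on `(X, Z)`, `ε` times
`g`-error by conditioning on `(Y, Z)`, and the product of both errors by Cauchy–Schwarz against `n
M^f M^g`. The first claim serves the statistic, the second the empirical covariance. -/
theorem smallInProb_remainders (hfhat : fhat.MeasurableFit) (hghat : ghat.MeasurableFit)
    (hnull : S ⊆ condIndepNull E F 𝒵)
    (hintX : ∀ P ∈ S, Integrable (fun p : E × F × 𝒵 => p.1) (P : Measure (E × F × 𝒵)))
    (hintY : ∀ P ∈ S, Integrable (fun p : E × F × 𝒵 => p.2.1) (P : Measure (E × F × 𝒵)))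
    (hcond : GHCMConditions fhat ghat S) {P : ℕ → ProbabilityMeasure (E × F × 𝒵)}
    (hP : ∀ n, P n ∈ S) :
    (SmallInProb atTop (fun n => sampleLaw (P n) n) fun n d => (n : ℝ≥0∞)⁻¹ * ENNReal.ofReal
        (‖∑ i, (sampleResidualProd fhat ghat n d i - noiseProd (P n) (d i))‖ ^ 2)) ∧
      SmallInProb atTop (fun n => sampleLaw (P n) n) fun n d => (n : ℝ≥0∞)⁻¹ *
        ∑ i, ENNReal.ofReal (‖sampleResidualProd fhat ghat n d i - noiseProd (P n) (d i)‖ ^ 2) := by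
  have hX := smallInProb_weighted_sums
    (fun n => isCenteredGiven_noiseY (hnull (hP n)) (hintY _ (hP n)))
    (fun n i => measurable_regression_error hfhat (measurable_regX (P n)) n i)
    (hcond.weighted_errorX.smallInProb hP)
  have hY := smallInProb_weighted_sums
    (fun n => isCenteredGiven_noiseX (hnull (hP n)) (hintX _ (hP n)))
    (fun n i => measurable_regression_error hghat (measurable_regY (P n)) n i)
    (hcond.weighted_errorY.smallInProb hP)
  have hXY := hcond.prod_error.smallInProb hP
  have hprod : ∀ n (d : Fin n → E × F × 𝒵), 0 < n →
      (n : ℝ≥0∞)⁻¹ * ((∑ i, ‖regX (P n) (d i).2.2 - fitX fhat d i‖ₑ ^ 2) *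
        ∑ i, ‖regY (P n) (d i).2.2 - fitY ghat d i‖ₑ ^ 2) =
      n * mspeX fhat n (P n) d * mspeY ghat n (P n) d := by
    intro n d hn
    have hn1 : (n : ℝ≥0∞) ≠ 0 := by exact_mod_cast hn.ne'
    rw [mspeX, mspeY, ← mul_assoc (n : ℝ≥0∞),
      ENNReal.mul_inv_cancel hn1 (ENNReal.natCast_ne_top n), one_mul, mul_left_comm]
  have hring : ∀ c x y z : ℝ≥0∞, c * (3 * (x + y + z)) = 3 * (c * x + c * y + c * z) := by
    intro c x y z
    ring
  constructor
  · refine (((hX.1.add hY.1).add hXY).const_mul (c := 3) (by norm_num)).mono ?_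
    filter_upwards [eventually_gt_atTop 0] with n hn d
    simp only [sampleResidualProd_sub_noiseProd, Finset.sum_add_distrib]
    calc _ ≤ (n : ℝ≥0∞)⁻¹ * (3 * _) := mul_le_mul' le_rfl (ofReal_norm_sq_add_three_le _ _ _)
      _ = 3 * ((n : ℝ≥0∞)⁻¹ * _ + (n : ℝ≥0∞)⁻¹ * _ + (n : ℝ≥0∞)⁻¹ * _) := by
        exact hring _ _ _ _
      _ ≤ _ := by
        refine mul_le_mul' le_rfl (add_le_add (add_le_add le_rfl ?_) ?_)
        · rw [norm_sum_outer_comm]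
          exact le_rfl
        · rw [← hprod n d hn]
          gcongr
          exact ofReal_norm_sq_sum_outer_le _ _
  · refine (((hX.2.add hY.2).add hXY).const_mul (c := 3) (by norm_num)).mono ?_
    filter_upwards [eventually_gt_atTop 0] with n hn d
    simp only [sampleResidualProd_sub_noiseProd]
    calc _ ≤ (n : ℝ≥0∞)⁻¹ * ∑ i, 3 * _ := mul_le_mul' le_rfl
            (Finset.sum_le_sum fun i _ => ofReal_norm_sq_add_three_le _ _ _)
      _ = 3 * ((n : ℝ≥0∞)⁻¹ * _ + (n : ℝ≥0∞)⁻¹ * _ + (n : ℝ≥0∞)⁻¹ * _) := by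
        rw [← Finset.mul_sum, Finset.sum_add_distrib, Finset.sum_add_distrib]
        exact hring _ _ _ _
      _ ≤ _ := by
        simp only [ofReal_norm_sq_outer]
        refine mul_le_mul' le_rfl (add_le_add (add_le_add le_rfl ?_) ?_)
        · simp only [mul_comm (‖noiseX _ _‖ₑ ^ 2)]
          exact le_rfl
        · rw [← hprod n d hn]
          gcongr
          exact sum_mul_le_sum_mul_sum _ _

end Remainder

/-! ### Perturbation of Gaussian multiplier sums -/

section Perturbation

variable {H : Type*} [NormedAddCommGroup H] [InnerProductSpace ℝ H]

theorem abs_expNegSq_sub_le (x y : H) : |expNegSq x - expNegSq y| ≤ 2 * ‖x - y‖ := by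
  have hd : ∀ t : ℝ, HasDerivAt (fun t : ℝ => Real.exp (-t ^ 2)) (-(2 * t) * Real.exp (-t ^ 2)) t := by
    intro t
    have h1 : HasDerivAt (fun t : ℝ => -t ^ 2) (-(2 * t)) t := by
      have h2 := (hasDerivAt_pow 2 t).fun_neg
      norm_num at h2
      exact h2
    simpa [mul_comm] using h1.exp
  have hb : ∀ t : ℝ, ‖-(2 * t) * Real.exp (-t ^ 2)‖ ≤ 2 := by
    intro t
    have h1 := mul_exp_neg_sq_le |t|
    rw [sq_abs] at h1
    rw [norm_mul, norm_neg, norm_mul, Real.norm_eq_abs, Real.norm_eq_abs, Real.norm_eq_abs,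
      abs_of_pos (Real.exp_pos _), abs_two]
    linarith
  have h := Convex.norm_image_sub_le_of_norm_hasDerivWithin_le (s := Set.univ)
    (fun t _ => (hd t).hasDerivWithinAt) (fun t _ => hb t) convex_univ (Set.mem_univ ‖y‖)
    (Set.mem_univ ‖x‖)
  refine h.trans (mul_le_mul_of_nonneg_left ?_ zero_le_two)
  exact abs_norm_sub_norm_le x y

theorem integrable_eval_mul_eval {n : ℕ} (i j : Fin n) :
    Integrable (fun g : Fin n → ℝ => g i * g j) (Measure.pi fun _ => gaussianReal 0 1) := by
  have h : ∀ i : Fin n, Integrable (fun g : Fin n → ℝ => g i ^ 2)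
      (Measure.pi fun _ => gaussianReal 0 1) := fun i =>
    (measurePreserving_eval (fun _ : Fin n => gaussianReal 0 1) i).integrable_comp_of_integrable
      integrable_sq_gaussianReal
  refine ((h i).add (h j)).mono' (by fun_prop) (ae_of_all _ fun g => ?_)
  rw [Real.norm_eq_abs, abs_mul, Pi.add_apply]
  nlinarith [sq_nonneg (|g i| - |g j|), sq_abs (g i), sq_abs (g j), sq_nonneg (g i),
    sq_nonneg (g j)]

theorem integral_eval_mul_eval {n : ℕ} (i j : Fin n) :
    ∫ g : Fin n → ℝ, g i * g j ∂(Measure.pi fun _ => gaussianReal 0 1) =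
      if i = j then 1 else 0 := by
  -- Writing `g i * g j` as a product over all coordinates covers the diagonal and off-diagonal
  -- cases at once.
  have h := integral_fintype_prod_eq_prod (𝕜 := ℝ) (μ := fun _ : Fin n => gaussianReal 0 1)
    (fun k t => (if k = i then t else 1) * (if k = j then t else 1))
  have e : ∀ g : Fin n → ℝ, ∏ k, (if k = i then g k else 1) * (if k = j then g k else 1) =
      g i * g j := fun g => by
    rw [Finset.prod_mul_distrib, Finset.prod_ite_eq' Finset.univ i g,
      Finset.prod_ite_eq' Finset.univ j g]
    simp
  simp only [e] at h
  rw [h]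
  by_cases hij : i = j
  · subst hij
    rw [if_pos rfl]
    refine Finset.prod_eq_one fun k _ => ?_
    by_cases hk : k = i
    · simp only [hk, if_true, ← sq]
      exact integral_sq_gaussianReal
    · simp [hk]
  · rw [if_neg hij]
    refine Finset.prod_eq_zero (Finset.mem_univ i) ?_
    simp [hij, integral_id_gaussianReal]

theorem integrable_norm_sq_multiplier {n : ℕ} (c : Fin n → H) :
    Integrable (fun g : Fin n → ℝ => ‖∑ i, g i • c i‖ ^ 2)
      (Measure.pi fun _ => gaussianReal 0 1) := by
  simp only [← real_inner_self_eq_norm_sq, sum_inner, inner_sum, real_inner_smul_left,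
    real_inner_smul_right, ← mul_assoc]
  exact integrable_finsetSum _ fun i _ => integrable_finsetSum _ fun j _ =>
    (integrable_eval_mul_eval _ _).mul_const _

theorem integral_norm_sq_multiplier {n : ℕ} (c : Fin n → H) :
    ∫ g : Fin n → ℝ, ‖∑ i, g i • c i‖ ^ 2 ∂(Measure.pi fun _ => gaussianReal 0 1) =
      ∑ i, ‖c i‖ ^ 2 := by
  simp only [← real_inner_self_eq_norm_sq, sum_inner, inner_sum, real_inner_smul_left,
    real_inner_smul_right, ← mul_assoc]
  rw [integral_finsetSum _ fun i _ => integrable_finsetSum _ fun j _ =>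
    (integrable_eval_mul_eval _ _).mul_const _]
  refine Finset.sum_congr rfl fun i _ => ?_
  rw [integral_finsetSum _ fun j _ => (integrable_eval_mul_eval _ _).mul_const _]
  simp only [integral_mul_const, integral_eval_mul_eval]
  simp

/-- The test function is `2`-Lipschitz, `2 t ≤ δ + t ^ 2 / δ`, and the multiplier sum of the
differences has second moment `∑ i, ‖a i - b i‖ ^ 2`. -/
theorem abs_multLaplace_sub_le {n : ℕ} (a b : Fin n → H) {δ : ℝ} (hδ : 0 < δ) :
    |multLaplace a - multLaplace b| ≤ δ + δ⁻¹ * ∑ i, ‖a i - b i‖ ^ 2 := by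
  have hint : ∀ c : Fin n → H, Integrable (fun g : Fin n → ℝ => expNegSq (∑ i, g i • c i))
      (Measure.pi fun _ => gaussianReal 0 1) := fun c =>
    (integrable_const (1 : ℝ)).mono' (by
      have : Continuous fun g : Fin n → ℝ => expNegSq (∑ i, g i • c i) :=
        continuous_expNegSq.comp (by fun_prop)
      exact this.aestronglyMeasurable) (ae_of_all _ fun _ => abs_expNegSq_le_one _)
  rw [multLaplace, multLaplace, ← integral_sub (hint a) (hint b), ← integral_norm_sq_multiplier]
  refine abs_integral_le_integral_abs.trans ?_
  have i2 := (integrable_norm_sq_multiplier fun i => a i - b i).const_mul δ⁻¹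
  calc _ ≤ ∫ g : Fin n → ℝ, (δ + δ⁻¹ * ‖∑ i, g i • (a i - b i)‖ ^ 2)
        ∂(Measure.pi fun _ => gaussianReal 0 1) := by
        refine integral_mono ((hint a).sub (hint b)).abs ((integrable_const δ).add i2) fun g => ?_
        refine (abs_expNegSq_sub_le _ _).trans ?_
        rw [← Finset.sum_sub_distrib]
        simp only [← smul_sub]
        set t := ‖∑ i, g i • (a i - b i)‖
        have : δ + δ⁻¹ * t ^ 2 - 2 * t = δ⁻¹ * (δ - t) ^ 2 := by
          field_simp
          ring
        have h2 : 0 ≤ δ⁻¹ * (δ - t) ^ 2 := by positivity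
        linarith
    _ = _ := by
        rw [integral_add (integrable_const δ) i2, integral_const_mul, integral_const,
          probReal_univ, one_smul]

/-- A power of the test function is a rescaling of it, so bounds for one Laplace transform give all
moments of `exp (-‖·‖ ^ 2)`. -/
theorem expNegSq_pow (x : H) (k : ℕ) : expNegSq x ^ k = expNegSq (√(k : ℝ) • x) := by
  rw [expNegSq, expNegSq, ← Real.exp_nat_mul, norm_smul, mul_pow, Real.norm_eq_abs, sq_abs,
    Real.sq_sqrt (Nat.cast_nonneg k)]
  congr 1
  ring

end Perturbation

/-! ### Sums that are close to sums of i.i.d. variables -/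

section SmallMore

variable {𝒳 : ℕ → Type*} [∀ n, MeasurableSpace (𝒳 n)] {l : Filter ℕ}
  {π : ∀ n, Measure (𝒳 n)} {W : ∀ n, 𝒳 n → ℝ≥0∞}

theorem SmallInProb.of_tendsto {r : ℕ → ℝ≥0∞} (h : Tendsto r l (𝓝 0)) :
    SmallInProb l π fun n _ => r n := by
  intro δ hδ
  refine tendsto_const_nhds.congr' ?_
  filter_upwards [h.eventually (gt_mem_nhds hδ)] with n hn
  simp [not_le.2 hn]

theorem SmallInProb.of_sq (h : SmallInProb l π fun n d => W n d ^ 2) : SmallInProb l π W := by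
  intro δ hδ
  refine tendsto_of_tendsto_of_tendsto_of_le_of_le tendsto_const_nhds
    (h (δ ^ 2) (pos_iff_ne_zero.2 (pow_ne_zero 2 hδ.ne'))) (fun _ => zero_le) fun n => measure_mono fun d hd => ?_
  exact pow_le_pow_left' (show δ ≤ W n d from hd) 2

theorem SmallInProb.inv_mul_of_lintegral_le {C : ℝ≥0∞} (hC : C ≠ ∞)
    (hm : ∀ n, AEMeasurable (W n) (π n)) (hW : ∀ n, ∫⁻ d, W n d ∂π n ≤ C) :
    SmallInProb atTop π fun n d => (n : ℝ≥0∞)⁻¹ * W n d := by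
  refine .of_lintegral (fun n => (hm n).const_mul _) ?_
  have h1 : Tendsto (fun n : ℕ => (n : ℝ≥0∞)⁻¹ * C) atTop (𝓝 0) := by
    have := ENNReal.Tendsto.mul_const ENNReal.tendsto_inv_nat_nhds_zero (b := C) (Or.inr hC)
    rwa [zero_mul] at this
  refine tendsto_of_tendsto_of_tendsto_of_le_of_le tendsto_const_nhds h1 (fun _ => zero_le)
    fun n => ?_
  simp only
  rw [lintegral_const_mul'' _ (hm n)]
  gcongr
  exact hW n

theorem SmallInProb.abs_sub_trans {f g h : ∀ n, 𝒳 n → ℝ}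
    (h1 : SmallInProb l π fun n d => ENNReal.ofReal |f n d - g n d|)
    (h2 : SmallInProb l π fun n d => ENNReal.ofReal |g n d - h n d|) :
    SmallInProb l π fun n d => ENNReal.ofReal |f n d - h n d| :=
  (h1.add h2).mono (Eventually.of_forall fun n d =>
    (ENNReal.ofReal_le_ofReal (abs_sub_le _ (g n d) _)).trans ENNReal.ofReal_add_le)

theorem SmallInProb.tendsto_integral [∀ n, IsProbabilityMeasure (π n)] {X : ∀ n, 𝒳 n → ℝ} {C : ℝ}
    (hC : ∀ n d, |X n d| ≤ C) (hm : ∀ n, Measurable (X n))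
    (h : SmallInProb l π fun n d => ENNReal.ofReal |X n d|) :
    Tendsto (fun n => ∫ d, X n d ∂π n) l (𝓝 0) := by
  rcases lt_or_ge C 0 with hC0 | hC0
  · have : ∀ n, ∫ d, X n d ∂π n = 0 := fun n =>
      integral_eq_zero_of_ae (ae_of_all _ fun d => absurd ((abs_nonneg _).trans (hC n d))
        (not_le.2 hC0))
    simp only [this]
    exact tendsto_const_nhds
  have key : ∀ δ : ℝ, 0 < δ → ∀ n, |∫ d, X n d ∂π n| ≤
      δ + C * (π n).real {d | ENNReal.ofReal δ ≤ ENNReal.ofReal |X n d|} := by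
    intro δ hδ n
    have hset : MeasurableSet {d | ENNReal.ofReal δ ≤ ENNReal.ofReal |X n d|} :=
      measurableSet_le measurable_const ((hm n).norm.ennreal_ofReal)
    refine abs_integral_le_integral_abs.trans ?_
    calc _ ≤ ∫ d, (δ + {d | ENNReal.ofReal δ ≤ ENNReal.ofReal |X n d|}.indicator (fun _ => C) d)
          ∂π n := by
          refine integral_mono_of_nonneg (ae_of_all _ fun d => abs_nonneg _)
            ((integrable_const δ).add ((integrable_const C).indicator hset))
            (ae_of_all _ fun d => ?_)
          by_cases hd : d ∈ {d | ENNReal.ofReal δ ≤ ENNReal.ofReal |X n d|}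
          · simp only [Set.indicator_of_mem hd]
            linarith [hC n d]
          · simp only [Set.indicator_of_notMem hd, add_zero]
            have hd' : ¬ ENNReal.ofReal δ ≤ ENNReal.ofReal |X n d| := hd
            by_contra! hlt
            exact hd' (ENNReal.ofReal_le_ofReal hlt.le)
      _ = _ := by
          rw [integral_add (integrable_const δ) ((integrable_const C).indicator hset),
            integral_indicator_const _ hset, integral_const, probReal_univ, one_smul, smul_eq_mul,
            mul_comm C]
  rw [Metric.tendsto_nhds]
  intro ε hε
  have h1 : Tendsto (fun n => ε / 2 + C *
      (π n).real {d | ENNReal.ofReal (ε / 2) ≤ ENNReal.ofReal |X n d|}) l (𝓝 (ε / 2)) := by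
    have h2 := (ENNReal.tendsto_toReal ENNReal.zero_ne_top).comp
      (h (ENNReal.ofReal (ε / 2)) (ENNReal.ofReal_pos.2 (half_pos hε)))
    have h3 := (h2.const_mul C).const_add (ε / 2)
    simpa [measureReal_def] using h3
  filter_upwards [h1.eventually (gt_mem_nhds (half_lt_self hε))] with n hn
  rw [Real.dist_eq, sub_zero]
  exact (key _ (half_pos hε) n).trans_lt hn

end SmallMore

/-! ### Triangular arrays close to i.i.d. sums: merging of conditional and unconditional transforms
-/

section NearlyIID

variable {Ω H : Type*} [MeasurableSpace Ω] [NormedAddCommGroup H] [InnerProductSpace ℝ H]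

/-- Triangular arrays `R n d i` that are close to i.i.d. centred `V n (d i)` with uniformly bounded
moments of some order larger than two and a direction of non-vanishing variance. -/
structure NearlyIID (μ : ℕ → Measure Ω) (V : ℕ → Ω → H) (R : ∀ n, (Fin n → Ω) → Fin n → H)
    (A : ℕ → H) (p B c : ℝ) : Prop where
  stronglyMeasurable : ∀ n, StronglyMeasurable (V n)
  exponent_mem : p ∈ Set.Ioc (2 : ℝ) 3
  integrable_rpow : ∀ n, Integrable (fun ω => ‖V n ω‖ ^ p) (μ n)
  integral_rpow_le : ∀ n, ∫ ω, ‖V n ω‖ ^ p ∂μ n ≤ B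
  integral_inner : ∀ n x, ∫ ω, inner ℝ x (V n ω) ∂μ n = 0
  -- Stated as a hypothesis; for noise products it comes from the orthogonality bound already proved
  -- for outer products.
  lintegral_sum_le : ∀ n : ℕ, ∫⁻ d : Fin n → Ω, ENNReal.ofReal (‖∑ i, V n (d i)‖ ^ 2)
    ∂(Measure.pi fun _ => μ n) ≤ n * ENNReal.ofReal (1 + B)
  sum_close : SmallInProb atTop (fun n => Measure.pi fun _ : Fin n => μ n) fun n d =>
    (n : ℝ≥0∞)⁻¹ * ENNReal.ofReal (‖∑ i, (R n d i - V n (d i))‖ ^ 2)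
  each_close : SmallInProb atTop (fun n => Measure.pi fun _ : Fin n => μ n) fun n d =>
    (n : ℝ≥0∞)⁻¹ * ∑ i, ENNReal.ofReal (‖R n d i - V n (d i)‖ ^ 2)
  measurable_stat : ∀ n, Measurable fun d : Fin n → Ω => ‖√(n : ℝ) • empMean (R n d)‖ ^ 2
  pos : 0 < c
  norm_le_one : ∀ n, ‖A n‖ ≤ 1
  le_integral_sq : ∀ n, c ≤ ∫ ω, inner ℝ (V n ω) (A n) ^ 2 ∂μ n

/-- The centred and scaled summands of the empirical covariance operator. -/
def covSummand {n : ℕ} (R : Fin n → H) (i : Fin n) : H := (√((n : ℝ) - 1))⁻¹ • (R i - empMean R)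

/-- Normalization by `√n`. -/
def scaled {n : ℕ} (v : Fin n → H) (i : Fin n) : H := (√(n : ℝ))⁻¹ • v i

theorem empCov_eq_sumOuterOp {n : ℕ} (hn : 2 ≤ n) (R : Fin n → H) :
    empCov R = sumOuterOp (covSummand R) := by
  have h : (0 : ℝ) ≤ (n : ℝ) - 1 := by
    have : (2 : ℝ) ≤ n := by exact_mod_cast hn
    linarith
  rw [empCov, sumOuterOp, Finset.smul_sum]
  refine Finset.sum_congr rfl fun i _ => ?_
  ext x
  simp only [outerOp, covSummand, smul_apply, InnerProductSpace.rankOne_apply,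
    real_inner_smul_left, smul_smul]
  congr 1
  rw [mul_assoc, mul_comm (inner ℝ _ x), ← mul_assoc, ← mul_inv, Real.mul_self_sqrt h]

theorem smul_empMean {n : ℕ} (R : Fin n → H) :
    √(n : ℝ) • empMean R = ∑ i, scaled R i := by
  simp only [scaled, ← Finset.smul_sum]
  rw [empMean, smul_smul]
  congr 1
  rcases Nat.eq_zero_or_pos n with rfl | hn
  · simp
  have hn' : (0 : ℝ) < n := by exact_mod_cast hn
  have hs := Real.sqrt_pos.2 hn'
  field_simp
  exact Real.sq_sqrt hn'.le

/-- The difference splits into the error `R i - v i`, the centring by the empirical mean, and the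
change of normalization from `√n` to `√(n - 1)`. The last is harmless since the two roots differ by
at most one. The constant is `6 = 3 * 2`, from the three terms and `(n - 1)⁻¹ ≤ 2 * n⁻¹`. -/
theorem sum_norm_sq_covSummand_sub_le {n : ℕ} (hn : 2 ≤ n) (R v : Fin n → H) :
    ∑ i, ‖covSummand R i - scaled v i‖ ^ 2 ≤ 6 * ((n : ℝ)⁻¹ * ∑ i, ‖R i - v i‖ ^ 2 +
      (n : ℝ)⁻¹ * ‖√(n : ℝ) • empMean R‖ ^ 2 + (n : ℝ)⁻¹ * ((n : ℝ)⁻¹ * ∑ i, ‖v i‖ ^ 2)) := by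
  have hn' : (2 : ℝ) ≤ n := by exact_mod_cast hn
  have hn0 : (0 : ℝ) < n := by linarith
  have hm0 : (0 : ℝ) < (n : ℝ) - 1 := by linarith
  set s := (√((n : ℝ) - 1))⁻¹ with hs
  set t := (√(n : ℝ))⁻¹ with ht
  have hs2 : s ^ 2 ≤ 2 * (n : ℝ)⁻¹ := by
    rw [hs, inv_pow, Real.sq_sqrt hm0.le, ← div_eq_mul_inv, inv_le_comm₀ hm0 (by positivity), inv_div]
    linarith
  have hst : (s - t) ^ 2 ≤ 2 * ((n : ℝ)⁻¹ * (n : ℝ)⁻¹) := by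
    set a := √((n : ℝ) - 1) with ha
    set b := √(n : ℝ) with hb
    have ha0 : 0 < a := Real.sqrt_pos.2 hm0
    have hb0 : 0 < b := Real.sqrt_pos.2 hn0
    have ha2 : a ^ 2 = (n : ℝ) - 1 := Real.sq_sqrt hm0.le
    have hb2 : b ^ 2 = (n : ℝ) := Real.sq_sqrt hn0.le
    have hab : a ≤ b := Real.sqrt_le_sqrt (by linarith)
    have hbn : (n : ℝ)⁻¹ = t ^ 2 := by rw [ht, inv_pow, hb2]
    have e1 : s - t = (b - a) * (s * t) := by
      rw [hs, ht]
      field_simp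
    have h1 : (b - a) ^ 2 ≤ 1 := by nlinarith
    rw [e1, mul_pow, mul_pow]
    calc (b - a) ^ 2 * (s ^ 2 * t ^ 2) ≤ 1 * (s ^ 2 * t ^ 2) := by gcongr
      _ ≤ 2 * (n : ℝ)⁻¹ * t ^ 2 := by rw [one_mul]; gcongr
      _ = _ := by rw [← hbn]; ring
  have hterm : ∀ i, ‖covSummand R i - scaled v i‖ ^ 2 ≤ 3 * (s ^ 2 * ‖R i - v i‖ ^ 2 +
      s ^ 2 * ‖empMean R‖ ^ 2 + (s - t) ^ 2 * ‖v i‖ ^ 2) := by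
    intro i
    have e : covSummand R i - scaled v i = s • (R i - v i) + s • (-empMean R) + (s - t) • v i := by
      rw [covSummand, scaled]
      module
    have h1 := norm_add₃_le (a := s • (R i - v i)) (b := s • (-empMean R)) (c := (s - t) • v i)
    have h2 := pow_le_pow_left₀ (norm_nonneg _) h1 2
    rw [e]
    refine h2.trans ?_
    have n1 : ‖s • (R i - v i)‖ ^ 2 = s ^ 2 * ‖R i - v i‖ ^ 2 := by
      rw [norm_smul, mul_pow, Real.norm_eq_abs, sq_abs]
    have n2 : ‖s • (-empMean R)‖ ^ 2 = s ^ 2 * ‖empMean R‖ ^ 2 := by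
      rw [norm_smul, mul_pow, Real.norm_eq_abs, sq_abs, norm_neg]
    have n3 : ‖(s - t) • v i‖ ^ 2 = (s - t) ^ 2 * ‖v i‖ ^ 2 := by
      rw [norm_smul, mul_pow, Real.norm_eq_abs, sq_abs]
    rw [← n1, ← n2, ← n3]
    nlinarith [sq_nonneg (‖s • (R i - v i)‖ - ‖s • (-empMean R)‖),
      sq_nonneg (‖s • (R i - v i)‖ - ‖(s - t) • v i‖),
      sq_nonneg (‖s • (-empMean R)‖ - ‖(s - t) • v i‖)]
  have hmean : ‖√(n : ℝ) • empMean R‖ ^ 2 = n * ‖empMean R‖ ^ 2 := by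
    rw [norm_smul, mul_pow, Real.norm_eq_abs, sq_abs, Real.sq_sqrt hn0.le]
  rw [hmean]
  calc _ ≤ ∑ i, 3 * (s ^ 2 * ‖R i - v i‖ ^ 2 + s ^ 2 * ‖empMean R‖ ^ 2 +
          (s - t) ^ 2 * ‖v i‖ ^ 2) := Finset.sum_le_sum fun i _ => hterm i
    _ = 3 * (s ^ 2 * ∑ i, ‖R i - v i‖ ^ 2 + s ^ 2 * (n * ‖empMean R‖ ^ 2) +
          (s - t) ^ 2 * ∑ i, ‖v i‖ ^ 2) := by
        rw [← Finset.mul_sum, Finset.sum_add_distrib, Finset.sum_add_distrib, ← Finset.mul_sum,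
          ← Finset.mul_sum, ← Finset.mul_sum, Finset.sum_const, Finset.card_univ, Fintype.card_fin, nsmul_eq_mul]
    _ ≤ 3 * (2 * (n : ℝ)⁻¹ * ∑ i, ‖R i - v i‖ ^ 2 + 2 * (n : ℝ)⁻¹ * (n * ‖empMean R‖ ^ 2) +
          2 * ((n : ℝ)⁻¹ * (n : ℝ)⁻¹) * ∑ i, ‖v i‖ ^ 2) := by gcongr
    _ = _ := by ring

namespace NearlyIID

variable {μ : ℕ → Measure Ω} [∀ n, IsProbabilityMeasure (μ n)] {V : ℕ → Ω → H}
  {R : ∀ n, (Fin n → Ω) → Fin n → H} {A : ℕ → H} {p B c : ℝ} (h : NearlyIID μ V R A p B c)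

include h

theorem integrable_norm_sq (n : ℕ) : Integrable (fun ω => ‖V n ω‖ ^ 2) (μ n) :=
  integrable_norm_sq_of_rpow (h.stronglyMeasurable n) h.exponent_mem.1.le (h.integrable_rpow n)

theorem integral_norm_sq_le (n : ℕ) : ∫ ω, ‖V n ω‖ ^ 2 ∂μ n ≤ 1 + B := by
  calc _ ≤ ∫ ω, (1 + ‖V n ω‖ ^ p) ∂μ n := integral_mono (h.integrable_norm_sq n)
        ((integrable_const _).add (h.integrable_rpow n))
        fun ω => sq_le_one_add_rpow (norm_nonneg _) h.exponent_mem.1.le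
    _ = 1 + ∫ ω, ‖V n ω‖ ^ p ∂μ n := by
        rw [integral_add (integrable_const _) (h.integrable_rpow n), integral_const, probReal_univ,
          one_smul]
    _ ≤ _ := by linarith [h.integral_rpow_le n]

theorem stronglyMeasurable_sum_scaled (n : ℕ) :
    StronglyMeasurable fun d : Fin n → Ω => ∑ i, scaled (fun j => V n (d j)) i :=
  stronglyMeasurable_sum_eval (((h.stronglyMeasurable n).const_smul (√(n : ℝ))⁻¹)) n

theorem lintegral_sum_scaled_le (n : ℕ) : ∫⁻ d : Fin n → Ω, ENNReal.ofReal
    (‖∑ i, scaled (fun j => V n (d j)) i‖ ^ 2) ∂(Measure.pi fun _ => μ n) ≤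
      ENNReal.ofReal (1 + B) := by
  rcases Nat.eq_zero_or_pos n with rfl | hn
  · simp
  have hn' : (0 : ℝ) < n := by exact_mod_cast hn
  have e : ∀ d : Fin n → Ω, ENNReal.ofReal (‖∑ i, scaled (fun j => V n (d j)) i‖ ^ 2) =
      (n : ℝ≥0∞)⁻¹ * ENNReal.ofReal (‖∑ i, V n (d i)‖ ^ 2) := by
    intro d
    simp only [scaled, ← Finset.smul_sum]
    rw [norm_smul, mul_pow, norm_inv, inv_pow, Real.norm_eq_abs, sq_abs, Real.sq_sqrt hn'.le,
      ENNReal.ofReal_mul (by positivity), ENNReal.ofReal_inv_of_pos hn', ENNReal.ofReal_natCast]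
  have hm : Measurable fun d : Fin n → Ω => ENNReal.ofReal (‖∑ i, V n (d i)‖ ^ 2) :=
    ((stronglyMeasurable_sum_eval (h.stronglyMeasurable n) n).norm.measurable.pow_const
      2).ennreal_ofReal
  simp only [e]
  rw [lintegral_const_mul _ hm]
  calc _ ≤ (n : ℝ≥0∞)⁻¹ * (n * ENNReal.ofReal (1 + B)) := by
        gcongr
        exact h.lintegral_sum_le n
    _ = _ := by
        rw [← mul_assoc, ENNReal.inv_mul_cancel (by exact_mod_cast hn.ne')
          (ENNReal.natCast_ne_top n), one_mul]

theorem small_sum_sub : SmallInProb atTop (fun n => Measure.pi fun _ : Fin n => μ n) fun n d =>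
    ENNReal.ofReal (‖√(n : ℝ) • empMean (R n d) - ∑ i, scaled (fun j => V n (d j)) i‖ ^ 2) := by
  refine h.sum_close.mono ?_
  filter_upwards [eventually_gt_atTop 0] with n hn d
  have hn' : (0 : ℝ) < n := by exact_mod_cast hn
  rw [smul_empMean]
  simp only [scaled, ← Finset.smul_sum, ← smul_sub]
  rw [← Finset.sum_sub_distrib, norm_smul, mul_pow, norm_inv, inv_pow, Real.norm_eq_abs, sq_abs,
    Real.sq_sqrt hn'.le, ENNReal.ofReal_mul (by positivity), ENNReal.ofReal_inv_of_pos hn',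
    ENNReal.ofReal_natCast]

/-- The three contributions vanish for different reasons: the first by assumption, while the
centring and normalization terms are `n⁻¹` times quantities that are bounded in mean up to the
negligible `T - U`. -/
theorem small_sum_norm_sq_sub :
    SmallInProb atTop (fun n => Measure.pi fun _ : Fin n => μ n) fun n d =>
      ENNReal.ofReal (∑ i, ‖covSummand (R n d) i - scaled (fun j => V n (d j)) i‖ ^ 2) := by
  have hB : ENNReal.ofReal (1 + B) ≠ ∞ := ENNReal.ofReal_ne_top
  have s1 := SmallInProb.inv_mul_of_lintegral_le hB
    (fun n => ((h.stronglyMeasurable_sum_scaled n).norm.measurable.pow_const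
      2).ennreal_ofReal.aemeasurable) h.lintegral_sum_scaled_le
  have hVm : ∀ n, Measurable fun ω => ENNReal.ofReal (‖V n ω‖ ^ 2) := fun n =>
    ((h.stronglyMeasurable n).norm.measurable.pow_const 2).ennreal_ofReal
  have hVdm : ∀ n i, Measurable fun d : Fin n → Ω => ENNReal.ofReal (‖V n (d i)‖ ^ 2) :=
    fun n i => (hVm n).comp (measurable_pi_apply i)
  have s2 := SmallInProb.inv_mul_of_lintegral_le (π := fun n => Measure.pi fun _ : Fin n => μ n)
    (W := fun n d => (n : ℝ≥0∞)⁻¹ * ∑ i, ENNReal.ofReal (‖V n (d i)‖ ^ 2)) hB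
    (fun n => ((Finset.measurable_fun_sum _ fun i _ => hVdm n i).const_mul _).aemeasurable)
    fun n => by
      rcases Nat.eq_zero_or_pos n with rfl | hn
      · simp
      rw [lintegral_const_mul _ (Finset.measurable_fun_sum _ fun i _ => hVdm n i),
        lintegral_finsetSum _ fun i _ => hVdm n i]
      have e : ∀ i : Fin n, ∫⁻ d : Fin n → Ω, ENNReal.ofReal (‖V n (d i)‖ ^ 2)
          ∂(Measure.pi fun _ => μ n) = ENNReal.ofReal (∫ ω, ‖V n ω‖ ^ 2 ∂μ n) := by
        intro i
        rw [(measurePreserving_eval (fun _ : Fin n => μ n) i).lintegral_comp (hVm n),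
          ofReal_integral_eq_lintegral_ofReal (h.integrable_norm_sq n)
            (ae_of_all _ fun ω => sq_nonneg _)]
      simp only [e, Finset.sum_const, Finset.card_univ, Fintype.card_fin, nsmul_eq_mul]
      rw [← mul_assoc, ENNReal.inv_mul_cancel (by exact_mod_cast hn.ne')
        (ENNReal.natCast_ne_top n), one_mul]
      exact ENNReal.ofReal_le_ofReal (h.integral_norm_sq_le n)
  have s3 := ((h.small_sum_sub.add s1).const_mul (c := 2) (by norm_num))
  refine (((h.each_close.add s3).add s2).const_mul (c := 6) (by norm_num)).mono ?_
  filter_upwards [eventually_ge_atTop 2] with n hn d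
  have hn' : (0 : ℝ) < n := by
    have : 0 < n := by omega
    exact_mod_cast this
  have hn1 : (n : ℝ)⁻¹ ≤ 1 := inv_le_one_of_one_le₀ (by exact_mod_cast (by omega : 1 ≤ n))
  have hcast : ENNReal.ofReal (n : ℝ)⁻¹ = (n : ℝ≥0∞)⁻¹ := by
    rw [ENNReal.ofReal_inv_of_pos hn', ENNReal.ofReal_natCast]
  set T := √(n : ℝ) • empMean (R n d)
  set U := ∑ i, scaled (fun j => V n (d j)) i
  have hTU : (n : ℝ)⁻¹ * ‖T‖ ^ 2 ≤ 2 * (‖T - U‖ ^ 2 + (n : ℝ)⁻¹ * ‖U‖ ^ 2) := by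
    have h1 : ‖T‖ ≤ ‖T - U‖ + ‖U‖ := by simpa using norm_add_le (T - U) U
    have h2 := pow_le_pow_left₀ (norm_nonneg _) h1 2
    have h3 : ‖T‖ ^ 2 ≤ 2 * (‖T - U‖ ^ 2 + ‖U‖ ^ 2) := by
      nlinarith [sq_nonneg (‖T - U‖ - ‖U‖)]
    have h4 : 0 < (n : ℝ)⁻¹ := by positivity
    calc _ ≤ (n : ℝ)⁻¹ * (2 * (‖T - U‖ ^ 2 + ‖U‖ ^ 2)) := by gcongr
      _ = 2 * ((n : ℝ)⁻¹ * ‖T - U‖ ^ 2 + (n : ℝ)⁻¹ * ‖U‖ ^ 2) := by ring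
      _ ≤ 2 * (1 * ‖T - U‖ ^ 2 + (n : ℝ)⁻¹ * ‖U‖ ^ 2) := by gcongr
      _ = _ := by ring
  have hle := (sum_norm_sq_covSummand_sub_le hn (R n d) fun j => V n (d j)).trans
    (mul_le_mul_of_nonneg_left (add_le_add (add_le_add le_rfl hTU) le_rfl) (by norm_num))
  refine (ENNReal.ofReal_le_ofReal hle).trans_eq ?_
  have hnn : ∀ f : Fin n → H, 0 ≤ ∑ i, ‖f i‖ ^ 2 := fun f => Finset.sum_nonneg fun i _ => sq_nonneg _
  have g1 := hnn fun i => R n d i - V n (d i)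
  have g2 := hnn fun i => V n (d i)
  rw [ENNReal.ofReal_mul (by norm_num), ENNReal.ofReal_add (by positivity) (by positivity),
    ENNReal.ofReal_add (by positivity) (by positivity), ENNReal.ofReal_mul (by positivity),
    ENNReal.ofReal_mul (by positivity), ENNReal.ofReal_add (by positivity) (by positivity),
    ENNReal.ofReal_mul (by positivity), ENNReal.ofReal_mul (by positivity),
    ENNReal.ofReal_mul (by positivity), hcast, ENNReal.ofReal_sum_of_nonneg fun i _ => sq_nonneg _,
    ENNReal.ofReal_sum_of_nonneg fun i _ => sq_nonneg _, ENNReal.ofReal_ofNat, ENNReal.ofReal_ofNat]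

theorem small_multLaplace_covSummand (k : ℕ) :
    SmallInProb atTop (fun n => Measure.pi fun _ : Fin n => μ n) fun n d => ENNReal.ofReal
      |multLaplace (fun i => √(k : ℝ) • covSummand (R n d) i) -
        multLaplace (fun i => √(k : ℝ) • scaled (fun j => V n (d j)) i)| := by
  refine .of_forall_pos fun ε hε hεt => ?_
  have hδ : 0 < ε.toReal := ENNReal.toReal_pos hε.ne' hεt
  refine ⟨_, h.small_sum_norm_sq_sub.const_mul
    (c := ENNReal.ofReal (ε.toReal⁻¹ * k)) ENNReal.ofReal_ne_top, Eventually.of_forall fun n d => ?_⟩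
  refine (ENNReal.ofReal_le_ofReal (abs_multLaplace_sub_le _ _ hδ)).trans ?_
  refine ENNReal.ofReal_add_le.trans ?_
  rw [ENNReal.ofReal_toReal hεt, ← ENNReal.ofReal_mul (by positivity)]
  refine add_le_add le_rfl (ENNReal.ofReal_le_ofReal (le_of_eq ?_))
  simp only [← smul_sub, norm_smul, mul_pow, Real.norm_eq_abs, sq_abs,
    Real.sq_sqrt (Nat.cast_nonneg (α := ℝ) k), ← Finset.mul_sum]
  ring

/-- The concentration bound applied to the summands `√k / √n • V` is of order `n * n ^ (-p / 2)`,
which vanishes because `p > 2`. -/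
theorem small_multLaplace_scaled (k : ℕ) :
    SmallInProb atTop (fun n => Measure.pi fun _ : Fin n => μ n) fun n d => ENNReal.ofReal
      |multLaplace (fun i => √(k : ℝ) • scaled (fun j => V n (d j)) i) -
        ∫ d : Fin n → Ω, expNegSq (√(k : ℝ) • ∑ i, scaled (fun j => V n (d j)) i)
          ∂(Measure.pi fun _ => μ n)| := by
  refine .of_sq ?_
  have hp : p ∈ Set.Icc (2 : ℝ) 3 := ⟨h.exponent_mem.1.le, h.exponent_mem.2⟩
  set s : ℕ → ℝ := fun n => √(k : ℝ) * (√(n : ℝ))⁻¹ with hs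
  set X : ℕ → Ω → H := fun n ω => s n • V n ω with hX
  have hs0 : ∀ n, 0 ≤ s n := fun n => by positivity
  have hXm : ∀ n, StronglyMeasurable (X n) := fun n => (h.stronglyMeasurable n).const_smul _
  have hXn : ∀ n ω, ‖X n ω‖ ^ p = s n ^ p * ‖V n ω‖ ^ p := fun n ω => by
    rw [hX, norm_smul, Real.norm_eq_abs, abs_of_nonneg (hs0 n),
      Real.mul_rpow (hs0 n) (norm_nonneg _)]
  have hXp : ∀ n, Integrable (fun ω => ‖X n ω‖ ^ p) (μ n) := fun n => by
    simp only [hXn]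
    exact (h.integrable_rpow n).const_mul _
  have hX0 : ∀ n x, ∫ ω, inner ℝ x (X n ω) ∂μ n = 0 := fun n x => by
    simp only [hX, real_inner_smul_right]
    rw [integral_const_mul, h.integral_inner, mul_zero]
  have hb := fun n => integral_multLaplace_sub_sq_le (hXm n) hp (hXp n) (hX0 n) n
  have e1 : ∀ n (d : Fin n → Ω), (fun i => √(k : ℝ) • scaled (fun j => V n (d j)) i) =
      fun i => X n (d i) := fun n d => by
    funext i
    rw [scaled, smul_smul]
  have e2 : ∀ n (d : Fin n → Ω), √(k : ℝ) • ∑ i, scaled (fun j => V n (d j)) i =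
      ∑ i, X n (d i) := fun n d => by
    rw [Finset.smul_sum]
    exact Finset.sum_congr rfl fun i _ => congrFun (e1 n d) i
  simp only [e1, e2]
  have hLm := fun n => stronglyMeasurable_multLaplace (hXm n) n
  have hm : ∀ n, Measurable fun d : Fin n → Ω => multLaplace (fun i => X n (d i)) -
      ∫ d : Fin n → Ω, expNegSq (∑ i, X n (d i)) ∂(Measure.pi fun _ => μ n) := fun n =>
    (hLm n).measurable.sub_const _
  refine .of_lintegral (fun n => ((hm n).norm.ennreal_ofReal.pow_const 2).aemeasurable) ?_
  have hC0 : 0 ≤ 360 * (1 + gaussMomentBound) := by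
    have := gaussMomentBound_nonneg
    positivity
  have hlim : Tendsto (fun n : ℕ => (n : ℝ) * (360 * (1 + gaussMomentBound) * (s n ^ p * B))) atTop
      (𝓝 0) := by
    have h1 : Tendsto (fun n : ℕ => (n : ℝ) ^ (-(p / 2 - 1))) atTop (𝓝 0) :=
      (tendsto_rpow_neg_atTop (by linarith [h.exponent_mem.1])).comp tendsto_natCast_atTop_atTop
    have h2 := h1.const_mul (360 * (1 + gaussMomentBound) * (√(k : ℝ) ^ p * B))
    rw [mul_zero] at h2
    refine h2.congr' ?_
    filter_upwards [eventually_gt_atTop 0] with n hn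
    have hn' : (0 : ℝ) < n := by exact_mod_cast hn
    have e3 : (n : ℝ) ^ (-(p / 2 - 1)) = n * ((√(n : ℝ))⁻¹ ^ p) := by
      rw [Real.sqrt_eq_rpow, ← Real.rpow_neg hn'.le, ← Real.rpow_mul hn'.le]
      nth_rewrite 2 [← Real.rpow_one (n : ℝ)]
      rw [← Real.rpow_add hn']
      congr 1
      ring
    rw [e3]
    simp only [hs]
    rw [Real.mul_rpow (by positivity) (by positivity)]
    ring
  have hlim' := ENNReal.tendsto_ofReal hlim
  rw [ENNReal.ofReal_zero] at hlim'
  refine tendsto_of_tendsto_of_tendsto_of_le_of_le tendsto_const_nhds hlim' (fun _ => zero_le)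
    fun n => ?_
  have e4 : ∀ x : ℝ, ENNReal.ofReal |x| ^ 2 = ENNReal.ofReal (x ^ 2) := fun x => by
    rw [← ENNReal.ofReal_pow (abs_nonneg x), sq_abs]
  simp only [e4]
  have hbd : ∀ d : Fin n → Ω, |multLaplace (fun i => X n (d i)) -
      ∫ d : Fin n → Ω, expNegSq (∑ i, X n (d i)) ∂(Measure.pi fun _ => μ n)| ≤ 2 := fun d => by
    have h1 := abs_multLaplace_le_one fun i => X n (d i)
    have h2 : |∫ d : Fin n → Ω, expNegSq (∑ i, X n (d i)) ∂(Measure.pi fun _ => μ n)| ≤ 1 :=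
      abs_integral_le_of_abs_le fun _ => abs_expNegSq_le_one _
    exact (abs_sub _ _).trans (by linarith)
  rw [← ofReal_integral_eq_lintegral_ofReal _ (ae_of_all _ fun d => sq_nonneg _)]
  · refine ENNReal.ofReal_le_ofReal ((hb n).trans ?_)
    simp only [hXn]
    rw [integral_const_mul]
    have := hs0 n
    gcongr
    exact h.integral_rpow_le n
  · refine (integrable_const (4 : ℝ)).mono' ((hm n).pow_const 2).aestronglyMeasurable
      (ae_of_all _ fun d => ?_)
    rw [Real.norm_eq_abs, abs_pow]
    nlinarith [hbd d, abs_nonneg (multLaplace (fun i => X n (d i)) -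
      ∫ d : Fin n → Ω, expNegSq (∑ i, X n (d i)) ∂(Measure.pi fun _ => μ n))]

theorem measurable_expNegSq_stat (k n : ℕ) :
    Measurable fun d : Fin n → Ω => expNegSq (√(k : ℝ) • √(n : ℝ) • empMean (R n d)) := by
  have h1 : Measurable fun d : Fin n → Ω => expNegSq (√(n : ℝ) • empMean (R n d)) ^ k :=
    (h.measurable_stat n).neg.exp.pow_const k
  simpa only [expNegSq_pow] using h1

/-- The statistic and the i.i.d. sum differ by a negligible vector and the test function is
Lipschitz and bounded, so bounded convergence in probability applies. -/
theorem tendsto_integral_expNegSq_sub (k : ℕ) : Tendsto (fun n =>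
    (∫ d : Fin n → Ω, expNegSq (√(k : ℝ) • ∑ i, scaled (fun j => V n (d j)) i)
        ∂(Measure.pi fun _ => μ n)) -
      ∫ d : Fin n → Ω, expNegSq (√(k : ℝ) • √(n : ℝ) • empMean (R n d))
        ∂(Measure.pi fun _ => μ n)) atTop (𝓝 0) := by
  have m1 : ∀ n, Measurable fun d : Fin n → Ω =>
      expNegSq (√(k : ℝ) • ∑ i, scaled (fun j => V n (d j)) i) := fun n =>
    (continuous_expNegSq.comp_stronglyMeasurable
      ((h.stronglyMeasurable_sum_scaled n).const_smul _)).measurable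
  have m2 := h.measurable_expNegSq_stat k
  have hi : ∀ {n} {f : (Fin n → Ω) → H}, Measurable (fun d => expNegSq (f d)) →
      Integrable (fun d => expNegSq (f d)) (Measure.pi fun _ => μ n) := fun hf =>
    (integrable_const (1 : ℝ)).mono' hf.aestronglyMeasurable
      (ae_of_all _ fun d => abs_expNegSq_le_one _)
  have hsm : SmallInProb atTop (fun n => Measure.pi fun _ : Fin n => μ n) fun n d => ENNReal.ofReal
      |expNegSq (√(k : ℝ) • ∑ i, scaled (fun j => V n (d j)) i) -
        expNegSq (√(k : ℝ) • √(n : ℝ) • empMean (R n d))| := by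
    refine .of_sq ((h.small_sum_sub.const_mul (c := ENNReal.ofReal (4 * k))
      ENNReal.ofReal_ne_top).mono (Eventually.of_forall fun n d => ?_))
    rw [← ENNReal.ofReal_mul (by positivity), ← ENNReal.ofReal_pow (abs_nonneg _)]
    refine ENNReal.ofReal_le_ofReal ((pow_le_pow_left₀ (abs_nonneg _)
      (abs_expNegSq_sub_le _ _) 2).trans_eq ?_)
    rw [← smul_sub, norm_smul, norm_sub_rev, mul_pow, mul_pow, Real.norm_eq_abs, sq_abs,
      Real.sq_sqrt (Nat.cast_nonneg k)]
    ring
  refine (hsm.tendsto_integral (C := 2) (fun n d => ?_) fun n => (m1 n).sub (m2 n)).congr fun n => ?_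
  · exact (abs_sub _ _).trans (by
      linarith [abs_expNegSq_le_one (√(k : ℝ) • ∑ i, scaled (fun j => V n (d j)) i),
        abs_expNegSq_le_one (√(k : ℝ) • √(n : ℝ) • empMean (R n d))])
  · exact integral_sub (hi (m1 n)) (hi (m2 n))

theorem small_moment_scaled (k : ℕ) :
    SmallInProb atTop (fun n => Measure.pi fun _ : Fin n => μ n) fun n d => ENNReal.ofReal
      |multLaplace (fun i => √(k : ℝ) • scaled (fun j => V n (d j)) i) -
        ∫ d : Fin n → Ω, expNegSq (√(k : ℝ) • √(n : ℝ) • empMean (R n d))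
          ∂(Measure.pi fun _ => μ n)| := by
  have h1 := (h.tendsto_integral_expNegSq_sub k).abs
  rw [abs_zero] at h1
  have h2 := ENNReal.tendsto_ofReal h1
  rw [ENNReal.ofReal_zero] at h2
  exact (h.small_multLaplace_scaled k).abs_sub_trans (SmallInProb.of_tendsto h2)

theorem small_moment_covSummand (k : ℕ) :
    SmallInProb atTop (fun n => Measure.pi fun _ : Fin n => μ n) fun n d => ENNReal.ofReal
      |multLaplace (fun i => √(k : ℝ) • covSummand (R n d) i) -
        ∫ d : Fin n → Ω, expNegSq (√(k : ℝ) • √(n : ℝ) • empMean (R n d))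
          ∂(Measure.pi fun _ => μ n)| :=
  (h.small_multLaplace_covSummand k).abs_sub_trans (h.small_moment_scaled k)

end NearlyIID

end NearlyIID

/-! ### From moments to continuous functions -/

section MomentsToContinuous

variable {𝒳 𝒴 : ℕ → Type*} [∀ n, MeasurableSpace (𝒳 n)] [∀ n, MeasurableSpace (𝒴 n)]
  {l : Filter ℕ} {π : ∀ n, Measure (𝒳 n)} [∀ n, IsProbabilityMeasure (π n)]
  {γ : ∀ n, Measure (𝒴 n)} [∀ n, IsProbabilityMeasure (γ n)]
  {e : ∀ n, 𝒳 n → 𝒴 n → ℝ} {e' : ∀ n, 𝒳 n → ℝ}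

theorem integrable_comp_of_mem_Icc {α : Type*} [MeasurableSpace α] {μ : Measure α}
    [IsFiniteMeasure μ] {f : α → ℝ} (hf : Measurable f) (h01 : ∀ x, f x ∈ Set.Icc (0 : ℝ) 1)
    {h : ℝ → ℝ} (hh : Continuous h) : Integrable (fun x => h (f x)) μ := by
  obtain ⟨C, hC⟩ := isCompact_Icc.exists_bound_of_continuousOn (hh.continuousOn (s := Set.Icc 0 1))
  exact (integrable_const C).mono' (hh.measurable.comp hf).aestronglyMeasurable
    (ae_of_all _ fun x => hC _ (h01 x))

theorem abs_integral_comp_sub_le {α : Type*} [MeasurableSpace α] {μ : Measure α}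
    [IsProbabilityMeasure μ] {f : α → ℝ} (hf : Measurable f) (h01 : ∀ x, f x ∈ Set.Icc (0 : ℝ) 1)
    {h k : ℝ → ℝ} (hh : Continuous h) (hk : Continuous k) {δ : ℝ}
    (hδ : ∀ t ∈ Set.Icc (0 : ℝ) 1, |h t - k t| ≤ δ) :
    |∫ x, h (f x) ∂μ - ∫ x, k (f x) ∂μ| ≤ δ := by
  rw [← integral_sub (integrable_comp_of_mem_Icc hf h01 hh) (integrable_comp_of_mem_Icc hf h01 hk)]
  exact abs_integral_le_of_abs_le fun x => hδ _ (h01 x)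

/-- Moment comparison extends to polynomials by linearity and to continuous functions on `[0, 1]` by
Weierstrass approximation, half of the tolerance being spent on each of the two integrals. -/
theorem smallInProb_integral_continuous_sub
    (he : ∀ n d, Measurable (e n d)) (he01 : ∀ n d y, e n d y ∈ Set.Icc (0 : ℝ) 1)
    (he' : ∀ n, Measurable (e' n)) (he01' : ∀ n d, e' n d ∈ Set.Icc (0 : ℝ) 1)
    (hmom : ∀ k : ℕ, SmallInProb l π fun n d => ENNReal.ofReal
      |∫ y, e n d y ^ k ∂γ n - ∫ d, e' n d ^ k ∂π n|)
    {h : ℝ → ℝ} (hh : Continuous h) :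
    SmallInProb l π fun n d => ENNReal.ofReal
      |∫ y, h (e n d y) ∂γ n - ∫ d, h (e' n d) ∂π n| := by
  have hpoly : ∀ q : Polynomial ℝ, SmallInProb l π fun n d => ENNReal.ofReal
      |∫ y, q.eval (e n d y) ∂γ n - ∫ d, q.eval (e' n d) ∂π n| := by
    intro q
    induction q using Polynomial.induction_on' with
    | add q r hq hr =>
      refine (hq.add hr).mono (Eventually.of_forall fun n d => ?_)
      refine le_trans (ENNReal.ofReal_le_ofReal ?_) ENNReal.ofReal_add_le
      simp only [Polynomial.eval_add]
      rw [integral_add (integrable_comp_of_mem_Icc (he n d) (he01 n d) q.continuous)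
          (integrable_comp_of_mem_Icc (he n d) (he01 n d) r.continuous),
        integral_add (integrable_comp_of_mem_Icc (he' n) (he01' n) q.continuous)
          (integrable_comp_of_mem_Icc (he' n) (he01' n) r.continuous), add_sub_add_comm]
      exact abs_add_le _ _
    | monomial k a =>
      refine ((hmom k).const_mul (c := ENNReal.ofReal |a|) ENNReal.ofReal_ne_top).mono
        (Eventually.of_forall fun n d => ?_)
      rw [← ENNReal.ofReal_mul (abs_nonneg _), ← abs_mul]
      simp only [Polynomial.eval_monomial, integral_const_mul, mul_sub]
      exact le_rfl
  refine .of_forall_pos fun ε hε hεt => ?_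
  have hδ : 0 < ε.toReal / 2 := half_pos (ENNReal.toReal_pos hε.ne' hεt)
  obtain ⟨q, hq⟩ := exists_polynomial_near_of_continuousOn 0 1 h hh.continuousOn _ hδ
  refine ⟨_, hpoly q, Eventually.of_forall fun n d => ?_⟩
  have hq' : ∀ t ∈ Set.Icc (0 : ℝ) 1, |h t - q.eval t| ≤ ε.toReal / 2 := fun t ht => by
    rw [abs_sub_comm]
    exact (hq t ht).le
  have h1 := abs_integral_comp_sub_le (μ := γ n) (he n d) (he01 n d) hh q.continuous hq'
  have h2 := abs_integral_comp_sub_le (μ := π n) (he' n) (he01' n) hh q.continuous hq'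
  have h3 : |∫ y, h (e n d y) ∂γ n - ∫ d, h (e' n d) ∂π n| ≤ ε.toReal +
      |∫ y, q.eval (e n d y) ∂γ n - ∫ d, q.eval (e' n d) ∂π n| := by
    have h4 := abs_sub_le (∫ y, h (e n d y) ∂γ n) (∫ y, q.eval (e n d y) ∂γ n)
      (∫ d, h (e' n d) ∂π n)
    have h5 := abs_sub_le (∫ y, q.eval (e n d y) ∂γ n) (∫ d, q.eval (e' n d) ∂π n)
      (∫ d, h (e' n d) ∂π n)
    rw [abs_sub_comm (∫ d, q.eval (e' n d) ∂π n)] at h5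
    linarith
  refine (ENNReal.ofReal_le_ofReal h3).trans (ENNReal.ofReal_add_le.trans_eq ?_)
  rw [ENNReal.ofReal_toReal hεt]

end MomentsToContinuous

/-! ### A direction of non-vanishing empirical variance -/

section NonDegenerate

variable {Ω H : Type*} [MeasurableSpace Ω] [NormedAddCommGroup H] [InnerProductSpace ℝ H]
  {μ : ℕ → Measure Ω} [∀ n, IsProbabilityMeasure (μ n)] {V : ℕ → Ω → H}
  {R : ∀ n, (Fin n → Ω) → Fin n → H} {A : ℕ → H} {p B c : ℝ}

/-- The excess lives on `|x| ≥ M`, where `|x| ^ (2 - p) ≤ M ^ (2 - p)`; a moment of order `p > 2`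
thus controls the truncation error. -/
theorem sq_sub_min_le {x r M p : ℝ} (hp : 2 ≤ p) (hM : 0 < M) (hxr : |x| ≤ r) :
    x ^ 2 - min (x ^ 2) (M ^ 2) ≤ M ^ (2 - p) * r ^ p := by
  have hr : 0 ≤ r := (abs_nonneg x).trans hxr
  rcases le_total (x ^ 2) (M ^ 2) with h | h
  · rw [min_eq_left h, sub_self]
    positivity
  · have hMx : M ≤ |x| := by
      rw [← sq_abs x] at h
      exact (pow_le_pow_iff_left₀ hM.le (abs_nonneg x) two_ne_zero).1 h
    have hx0 : 0 < |x| := hM.trans_le hMx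
    have h1 : x ^ 2 ≤ M ^ (2 - p) * |x| ^ p := by
      have e : x ^ 2 = |x| ^ (2 - p) * |x| ^ p := by
        rw [← Real.rpow_add hx0, sub_add_cancel, ← sq_abs]
        exact (Real.rpow_natCast _ 2).symm
      rw [e]
      gcongr ?_ * _
      exact Real.rpow_le_rpow_of_nonpos hM hMx (by linarith)
    have h2 : M ^ (2 - p) * |x| ^ p ≤ M ^ (2 - p) * r ^ p := by gcongr
    have h3 : 0 ≤ min (x ^ 2) (M ^ 2) := by positivity
    linarith

/-- A weak law of large numbers for `⟪V, A⟫ ^ 2`, whose variance may be infinite: truncation at `M ^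
2` costs at most `c / 4` of the mean, and Chebyshev with gap `c / 4` takes `3 c / 4` down to `c /
2`. -/
theorem NearlyIID.tendsto_measure_sum_inner_sq_le (h : NearlyIID μ V R A p B c) :
    Tendsto (fun n => (Measure.pi fun _ : Fin n => μ n)
      {d | ∑ i, inner ℝ (scaled (fun j => V n (d j)) i) (A n) ^ 2 ≤ c / 2}) atTop (𝓝 0) := by
  have hc := h.pos
  have hp2 : 0 < p - 2 := by linarith [h.exponent_mem.1]
  obtain ⟨M, hM, hM0⟩ : ∃ M : ℝ, M ^ (2 - p) * B ≤ c / 4 ∧ 0 < M := by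
    have h1 : Tendsto (fun M : ℝ => M ^ (-(p - 2)) * B) atTop (𝓝 0) := by
      simpa using (tendsto_rpow_neg_atTop hp2).mul_const B
    have h2 := (h1.eventually (gt_mem_nhds (show 0 < c / 4 by positivity))).and
      (eventually_gt_atTop 0)
    obtain ⟨M, hM, hM0⟩ := h2.exists
    refine ⟨M, ?_, hM0⟩
    rw [neg_sub] at hM
    exact hM.le
  set Y : ℕ → Ω → ℝ := fun n ω => min (inner ℝ (V n ω) (A n) ^ 2) (M ^ 2) with hY
  have hinner : ∀ n, StronglyMeasurable fun ω => inner ℝ (V n ω) (A n) := fun n =>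
    (h.stronglyMeasurable n).inner stronglyMeasurable_const
  have hYm : ∀ n, Measurable (Y n) := fun n =>
    ((hinner n).measurable.pow_const 2).min measurable_const
  have hY0 : ∀ n ω, 0 ≤ Y n ω := fun n ω => le_min (sq_nonneg _) (sq_nonneg _)
  have hYM : ∀ n ω, Y n ω ≤ M ^ 2 := fun n ω => min_le_right _ _
  have hYp : ∀ n, MemLp (Y n) 2 (μ n) := fun n =>
    MemLp.of_bound (hYm n).aestronglyMeasurable (M ^ 2) (ae_of_all _ fun ω => by
      rw [Real.norm_eq_abs, abs_of_nonneg (hY0 n ω)]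
      exact hYM n ω)
  have hYi : ∀ n, Integrable (Y n) (μ n) := fun n => (hYp n).integrable one_le_two
  have hmean : ∀ n, 3 * c / 4 ≤ ∫ ω, Y n ω ∂μ n := by
    intro n
    have hsqi : Integrable (fun ω => inner ℝ (V n ω) (A n) ^ 2) (μ n) := by
      have := integrable_inner_sq_of_norm_sq (h.stronglyMeasurable n) (h.integrable_norm_sq n) (A n)
      simpa only [real_inner_comm] using this
    have h1 : ∫ ω, (inner ℝ (V n ω) (A n) ^ 2 - Y n ω) ∂μ n ≤
        ∫ ω, M ^ (2 - p) * ‖V n ω‖ ^ p ∂μ n := by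
      refine integral_mono (hsqi.sub (hYi n)) ((h.integrable_rpow n).const_mul _) fun ω => ?_
      refine sq_sub_min_le h.exponent_mem.1.le hM0 ?_
      refine (abs_real_inner_le_norm _ _).trans ?_
      exact mul_le_of_le_one_right (norm_nonneg _) (h.norm_le_one n)
    rw [integral_sub hsqi (hYi n), integral_const_mul] at h1
    have h2 : M ^ (2 - p) * ∫ ω, ‖V n ω‖ ^ p ∂μ n ≤ M ^ (2 - p) * B := by
      have := h.integral_rpow_le n
      gcongr
    linarith [h.le_integral_sq n]
  have hvar : ∀ n, Var[Y n; μ n] ≤ M ^ 4 := by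
    intro n
    refine (variance_le_expectation_sq (hYm n).aestronglyMeasurable).trans ?_
    refine (le_abs_self _).trans (abs_integral_le_of_abs_le fun ω => ?_)
    simp only [Pi.pow_apply]
    rw [abs_of_nonneg (sq_nonneg _)]
    calc Y n ω ^ 2 ≤ (M ^ 2) ^ 2 := pow_le_pow_left₀ (hY0 n ω) (hYM n ω) 2
      _ = M ^ 4 := by ring
  have hlim : Tendsto (fun n : ℕ => ENNReal.ofReal (16 * M ^ 4 / c ^ 2 * (n : ℝ)⁻¹)) atTop (𝓝 0) := by
    have h1 := (tendsto_inv_atTop_nhds_zero_nat (𝕜 := ℝ)).const_mul (16 * M ^ 4 / c ^ 2)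
    rw [mul_zero] at h1
    simpa using ENNReal.tendsto_ofReal h1
  refine tendsto_of_tendsto_of_tendsto_of_le_of_le' tendsto_const_nhds hlim
    (Eventually.of_forall fun _ => zero_le) ?_
  filter_upwards [eventually_gt_atTop 0] with n hn
  have hn' : (0 : ℝ) < n := by exact_mod_cast hn
  set π : Measure (Fin n → Ω) := Measure.pi fun _ => μ n with hπ
  set X : Fin n → (Fin n → Ω) → ℝ := fun i d => Y n (d i) with hX
  have hXp : ∀ i, MemLp (X i) 2 π := fun i =>
    (hYp n).comp_measurePreserving (measurePreserving_eval (fun _ : Fin n => μ n) i)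
  have hvarsum : Var[∑ i, X i; π] = ∑ _i : Fin n, Var[Y n; μ n] :=
    variance_sum_pi (X := fun _ => Y n) fun _ => hYp n
  have hmeansum : ∫ d, (∑ i, X i) d ∂π = n * ∫ ω, Y n ω ∂μ n := by
    simp only [Finset.sum_apply]
    rw [integral_finsetSum _ fun i _ => (hXp i).integrable one_le_two]
    have : ∀ i, ∫ d, X i d ∂π = ∫ ω, Y n ω ∂μ n := fun i =>
      integral_comp_eval (μ := fun _ : Fin n => μ n) (f := Y n) (hYm n).aestronglyMeasurable
    simp [this]
  have hcheb := meas_ge_le_variance_div_sq (memLp_finsetSum' Finset.univ fun i _ => hXp i)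
    (show 0 < n * (c / 4) by positivity)
  refine (measure_mono fun d hd => ?_).trans (hcheb.trans (ENNReal.ofReal_le_ofReal ?_))
  · have hd' : ∑ i, inner ℝ (scaled (fun j => V n (d j)) i) (A n) ^ 2 ≤ c / 2 := hd
    simp only [scaled, real_inner_smul_left, mul_pow, inv_pow, Real.sq_sqrt hn'.le] at hd'
    rw [← Finset.mul_sum, inv_mul_le_iff₀ hn'] at hd'
    change n * (c / 4) ≤ |(∑ i, X i) d - ∫ d, (∑ i, X i) d ∂π|
    have h1 : (∑ i, X i) d ≤ n * (c / 2) := by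
      rw [Finset.sum_apply]
      exact (Finset.sum_le_sum fun i _ => min_le_left _ _).trans hd'
    have h2 : n * (3 * c / 4) ≤ ∫ d, (∑ i, X i) d ∂π := by
      rw [hmeansum]
      gcongr
      exact hmean n
    rw [abs_sub_comm]
    refine le_trans ?_ (le_abs_self _)
    linarith
  · rw [hvarsum, Finset.sum_const, Finset.card_univ, Fintype.card_fin, nsmul_eq_mul]
    have h1 := hvar n
    calc n * Var[Y n; μ n] / (n * (c / 4)) ^ 2 ≤ n * M ^ 4 / (n * (c / 4)) ^ 2 := by gcongr
      _ = _ := by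
        field_simp
        norm_num

end NonDegenerate

/-! ### Upper tails under weak convergence to a law without atoms -/

section Ramps

/-- The function that vanishes below `y`, equals one above `y + η` and is affine in between. -/
def ramp (y η t : ℝ) : ℝ := min 1 (max 0 ((t - y) / η))

/-- The function that equals one at `y`, vanishes outside `(y - η, y + η)` and is affine on either
side of `y`. -/
def tent (y η t : ℝ) : ℝ := max 0 (1 - |t - y| / η)

theorem continuous_ramp (y η : ℝ) : Continuous (ramp y η) := by
  unfold ramp
  fun_prop

theorem continuous_tent (y η : ℝ) : Continuous (tent y η) := by
  unfold tent
  fun_prop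

theorem ramp_nonneg (y η t : ℝ) : 0 ≤ ramp y η t := le_min zero_le_one (le_max_left _ _)

theorem ramp_le_one (y η t : ℝ) : ramp y η t ≤ 1 := min_le_left _ _

theorem ramp_eq_one {y η t : ℝ} (hη : 0 < η) (h : y + η ≤ t) : ramp y η t = 1 := by
  refine min_eq_left (le_max_of_le_right ?_)
  rw [le_div_iff₀ hη]
  linarith

theorem ramp_eq_zero {y η t : ℝ} (hη : 0 < η) (h : t ≤ y) : ramp y η t = 0 := by
  rw [ramp, max_eq_left (div_nonpos_of_nonpos_of_nonneg (by linarith) hη.le)]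
  exact min_eq_right zero_le_one

theorem tent_nonneg (y η t : ℝ) : 0 ≤ tent y η t := le_max_left _ _

theorem tent_le_one {y η : ℝ} (hη : 0 < η) (t : ℝ) : tent y η t ≤ 1 :=
  max_le zero_le_one (by linarith [div_nonneg (abs_nonneg (t - y)) hη.le])

theorem tent_self (y η : ℝ) : tent y η y = 1 := by simp [tent]

theorem tent_eq_zero {y η t : ℝ} (hη : 0 < η) (h : η ≤ |t - y|) : tent y η t = 0 :=
  max_eq_left (by linarith [(one_le_div hη).2 h])

theorem integral_le_measureReal {α : Type*} [MeasurableSpace α] {μ : Measure α}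
    [IsProbabilityMeasure μ] {f : α → ℝ} {s : Set α} (h0 : ∀ x, 0 ≤ f x)
    (h1 : ∀ x, f x ≤ 1) (hs : ∀ x, x ∉ s → f x = 0) (hm : MeasurableSet s) :
    ∫ x, f x ∂μ ≤ μ.real s := by
  rw [← integral_indicator_one hm]
  refine integral_mono_of_nonneg (ae_of_all _ h0) ((integrable_const (1 : ℝ)).indicator hm)
    (ae_of_all _ fun x => ?_)
  by_cases hx : x ∈ s
  · simpa [hx] using h1 x
  · simp [hx, hs x hx]

theorem measureReal_le_integral {α : Type*} [MeasurableSpace α] {μ : Measure α}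
    [IsProbabilityMeasure μ] {f : α → ℝ} {s : Set α} (hf : Measurable f) (h0 : ∀ x, 0 ≤ f x)
    (h1 : ∀ x, f x ≤ 1) (hs : ∀ x ∈ s, f x = 1) (hm : MeasurableSet s) :
    μ.real s ≤ ∫ x, f x ∂μ := by
  rw [← integral_indicator_one hm]
  refine integral_mono ((integrable_const (1 : ℝ)).indicator hm)
    ((integrable_const (1 : ℝ)).mono' hf.aestronglyMeasurable (ae_of_all _ fun x => ?_)) fun x => ?_
  · rw [Real.norm_eq_abs, abs_of_nonneg (h0 x)]
    exact h1 x
  · by_cases hx : x ∈ s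
    · simp [hx, hs x hx]
    · simpa [hx] using h0 x

theorem measureReal_ge_mem_Icc_ramp {α : Type*} [MeasurableSpace α] {μ : Measure α}
    [IsProbabilityMeasure μ] {f : α → ℝ} (hf : Measurable f) (y : ℝ) {η : ℝ} (hη : 0 < η) :
    μ.real {z | y ≤ f z} ∈
      Set.Icc (∫ z, ramp y η (f z) ∂μ) (∫ z, ramp (y - η) η (f z) ∂μ) := by
  have hm : MeasurableSet {z | y ≤ f z} := measurableSet_le measurable_const hf
  exact ⟨integral_le_measureReal (fun z => ramp_nonneg _ _ _) (fun z => ramp_le_one _ _ _)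
      (fun z hz => ramp_eq_zero hη (le_of_lt (not_le.1 (show ¬ y ≤ f z from hz)))) hm,
    measureReal_le_integral ((continuous_ramp _ _).measurable.comp hf)
      (fun z => ramp_nonneg _ _ _) (fun z => ramp_le_one _ _ _)
      (fun z hz => ramp_eq_one hη (by linarith [show y ≤ f z from hz])) hm⟩

variable {ν : Measure ℝ} [IsProbabilityMeasure ν]

/-- Outer regularity at the null set `{y}`. -/
theorem exists_measureReal_near_le [NullSingletonClass ν] (y : ℝ) {ε : ℝ} (hε : 0 < ε) :
    ∃ η > 0, ν.real {t | |t - y| ≤ η} ≤ ε := by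
  obtain ⟨U, hU, hUo, hUε⟩ := Set.exists_isOpen_lt_of_lt (μ := ν) {y} (ENNReal.ofReal ε)
    (by simpa using hε)
  obtain ⟨r, hr, hrU⟩ := Metric.isOpen_iff.1 hUo y (hU rfl)
  refine ⟨r / 2, half_pos hr, ?_⟩
  rw [measureReal_def]
  refine ENNReal.toReal_le_of_le_ofReal hε.le ((measure_mono fun t ht => hrU ?_).trans hUε.le)
  rw [Metric.mem_ball, Real.dist_eq]
  exact lt_of_le_of_lt ht (half_lt_self hr)

theorem continuous_measureReal_Ici [NullSingletonClass ν] : Continuous fun y => ν.real (Set.Ici y) := by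
  rw [Metric.continuous_iff]
  intro y ε hε
  obtain ⟨η, hη, hν⟩ := exists_measureReal_near_le (ν := ν) y (half_pos hε)
  refine ⟨η, hη, fun z hz => ?_⟩
  rw [Real.dist_eq] at hz ⊢
  have hz' := abs_lt.1 hz
  have h1 : ν.real (Set.Ici z) ≤ ν.real (Set.Ici y) + ν.real {t | |t - y| ≤ η} := by
    refine (measureReal_mono fun t ht => ?_).trans (measureReal_union_le _ _)
    rcases le_or_gt y t with h | h
    · exact Or.inl h
    · right
      have : z ≤ t := ht
      exact (abs_le.2 ⟨by linarith, by linarith⟩ : |t - y| ≤ η)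
  have h2 : ν.real (Set.Ici y) ≤ ν.real (Set.Ici z) + ν.real {t | |t - y| ≤ η} := by
    refine (measureReal_mono fun t ht => ?_).trans (measureReal_union_le _ _)
    rcases le_or_gt z t with h | h
    · exact Or.inl h
    · right
      have : y ≤ t := ht
      exact (abs_le.2 ⟨by linarith, by linarith⟩ : |t - y| ≤ η)
  exact (abs_le.2 ⟨by linarith, by linarith⟩ : _ ≤ ε / 2).trans_lt (half_lt_self hε)

/-- A portmanteau argument for random laws: the indicator of `[y, ∞)` lies between two ramps whose
`ν`-integrals differ by at most the mass near `y`. -/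
theorem smallInProb_measureReal_ge_sub [NullSingletonClass ν] {𝒳 𝒴 : ℕ → Type*} [∀ n, MeasurableSpace (𝒳 n)]
    [∀ n, MeasurableSpace (𝒴 n)] {l : Filter ℕ} {π : ∀ n, Measure (𝒳 n)} {γ : ∀ n, Measure (𝒴 n)}
    [∀ n, IsProbabilityMeasure (γ n)] {e : ∀ n, 𝒳 n → 𝒴 n → ℝ} (he : ∀ n d, Measurable (e n d))
    (hs : ∀ h : ℝ → ℝ, Continuous h → SmallInProb l π fun n d => ENNReal.ofReal
      |∫ y, h (e n d y) ∂γ n - ∫ t, h t ∂ν|) (y : ℝ) :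
    SmallInProb l π fun n d => ENNReal.ofReal
      |(γ n).real {z | y ≤ e n d z} - ν.real (Set.Ici y)| := by
  refine .of_forall_pos fun ε hε hεt => ?_
  obtain ⟨η, hη, hν⟩ := exists_measureReal_near_le (ν := ν) y (ENNReal.toReal_pos hε.ne' hεt)
  refine ⟨_, (hs _ (continuous_ramp y η)).add (hs _ (continuous_ramp (y - η) η)),
    Eventually.of_forall fun n d => ?_⟩
  have k1 := measureReal_ge_mem_Icc_ramp (μ := γ n) (he n d) y hη
  have k2 : ν.real (Set.Ici y) ∈ Set.Icc (∫ t, ramp y η t ∂ν) (∫ t, ramp (y - η) η t ∂ν) :=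
    measureReal_ge_mem_Icc_ramp (μ := ν) measurable_id y hη
  rw [Set.mem_Icc] at k1 k2
  have hir : ∀ a, Integrable (fun t => ramp a η t) ν := fun a =>
    (integrable_const (1 : ℝ)).mono' (continuous_ramp a η).aestronglyMeasurable
      (ae_of_all _ fun t => by
        rw [Real.norm_eq_abs, abs_of_nonneg (ramp_nonneg _ _ _)]
        exact ramp_le_one _ _ _)
  have k3 : ∫ t, ramp (y - η) η t ∂ν - ∫ t, ramp y η t ∂ν ≤ ε.toReal := by
    rw [← integral_sub (hir _) (hir _)]
    refine (integral_le_measureReal (s := {t | |t - y| ≤ η}) (fun t => ?_) (fun t => ?_)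
      (fun t ht => ?_) (measurableSet_le (by fun_prop) measurable_const)).trans hν
    · have : ramp y η t ≤ ramp (y - η) η t := by
        unfold ramp
        gcongr
        linarith
      linarith
    · linarith [ramp_nonneg y η t, ramp_le_one (y - η) η t]
    · have ht' : η < |t - y| := not_le.1 (show ¬ |t - y| ≤ η from ht)
      rcases lt_abs.1 ht' with h | h
      · rw [ramp_eq_one hη (by linarith), ramp_eq_one hη (by linarith), sub_self]
      · rw [ramp_eq_zero hη (by linarith), ramp_eq_zero hη (by linarith), sub_self]
  have a1 := abs_le.1 (le_refl |∫ z, ramp y η (e n d z) ∂γ n - ∫ t, ramp y η t ∂ν|)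
  have a2 := abs_le.1 (le_refl |∫ z, ramp (y - η) η (e n d z) ∂γ n - ∫ t, ramp (y - η) η t ∂ν|)
  have a3 := abs_nonneg (∫ z, ramp y η (e n d z) ∂γ n - ∫ t, ramp y η t ∂ν)
  have a4 := abs_nonneg (∫ z, ramp (y - η) η (e n d z) ∂γ n - ∫ t, ramp (y - η) η t ∂ν)
  have hle : |(γ n).real {z | y ≤ e n d z} - ν.real (Set.Ici y)| ≤ ε.toReal +
      (|∫ z, ramp y η (e n d z) ∂γ n - ∫ t, ramp y η t ∂ν| +
        |∫ z, ramp (y - η) η (e n d z) ∂γ n - ∫ t, ramp (y - η) η t ∂ν|) :=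
    abs_le.2 ⟨by linarith, by linarith⟩
  refine (ENNReal.ofReal_le_ofReal hle).trans (ENNReal.ofReal_add_le.trans
    (add_le_add (ENNReal.ofReal_toReal hεt).le ENNReal.ofReal_add_le))

end Ramps

/-! ### The critical value -/

section Critical

variable {H : Type*} [NormedAddCommGroup H] [InnerProductSpace ℝ H] [CompleteSpace H]

/-- Distribution function of the squared norm of a Gaussian multiplier sum. -/
def multCdf {n : ℕ} (a : Fin n → H) (x : ℝ) : ℝ :=
  (Measure.pi fun _ : Fin n => gaussianReal 0 1).real {g | ‖∑ i, g i • a i‖ ^ 2 ≤ x}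

theorem weightedChiSqQuantile_empCov {n : ℕ} (hn : 2 ≤ n) (R : Fin n → H) (q : ℝ) :
    weightedChiSqQuantile (fun k : NonzeroEigIndex (empCov R) => (k.1 : ℝ)) q =
      sInf {x | q ≤ multCdf (covSummand R) x} := by
  rw [empCov_eq_sumOuterOp hn]
  unfold weightedChiSqQuantile multCdf
  congr 1
  ext x
  exact iff_of_eq (congrArg (q ≤ ·) (infinitePi_chiSqOne_real_eq (covSummand R) x))

theorem multCdf_mono {n : ℕ} (a : Fin n → H) : Monotone (multCdf a) := fun _ _ hxy =>
  measureReal_mono fun _ hg => le_trans hg hxy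

theorem multCdf_of_neg {n : ℕ} (a : Fin n → H) {x : ℝ} (hx : x < 0) : multCdf a x = 0 := by
  have : {g : Fin n → ℝ | ‖∑ i, g i • a i‖ ^ 2 ≤ x} = ∅ :=
    Set.eq_empty_of_forall_notMem fun g hg =>
      absurd ((sq_nonneg ‖∑ i, g i • a i‖).trans hg) (not_le.2 hx)
  rw [multCdf, this, measureReal_empty]

/-- The quantile is an infimum over an up-closed set, so bracketing the distribution function
brackets it. Positivity of `q` bounds that set below by zero. -/
theorem weightedChiSqQuantile_empCov_mem_Icc {n : ℕ} (hn : 2 ≤ n) (R : Fin n → H) {q x₁ x₂ : ℝ}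
    (hq : 0 < q) (h1 : q ≤ multCdf (covSummand R) x₁) (h2 : multCdf (covSummand R) x₂ < q) :
    weightedChiSqQuantile (fun k : NonzeroEigIndex (empCov R) => (k.1 : ℝ)) q ∈ Set.Icc x₂ x₁ := by
  rw [weightedChiSqQuantile_empCov hn]
  refine ⟨le_csInf ⟨x₁, h1⟩ fun x hx => ?_, csInf_le ⟨0, fun x hx => ?_⟩ h1⟩
  · by_contra! hlt
    exact absurd (le_trans hx (multCdf_mono _ hlt.le)) (not_le.2 h2)
  · by_contra! hlt
    have hx' : q ≤ multCdf (covSummand R) x := hx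
    rw [multCdf_of_neg _ hlt] at hx'
    linarith

theorem multCdf_eq_measureReal_ge {n : ℕ} (a : Fin n → H) (x : ℝ) :
    multCdf a x = (Measure.pi fun _ : Fin n => gaussianReal 0 1).real
      {g | Real.exp (-x) ≤ expNegSq (∑ i, g i • a i)} := by
  simp only [expNegSq, Real.exp_le_exp, neg_le_neg_iff]
  rfl

end Critical

/-! ### Asymptotic level of the test for nearly i.i.d. arrays -/

theorem exists_notMem_of_measure_add_lt_one {α : Type*} [MeasurableSpace α] {μ : Measure α}
    [IsProbabilityMeasure μ] {s t : Set α} (h : μ s + μ t < 1) : ∃ x, x ∉ s ∧ x ∉ t := by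
  by_contra! hcon
  have huniv : μ Set.univ ≤ μ s + μ t :=
    (measure_mono fun x _ => or_iff_not_imp_left.2 (hcon x)).trans (measure_union_le _ _)
  rw [measure_univ] at huniv
  exact absurd h (not_lt.2 huniv)

namespace NearlyIID

variable {Ω H : Type*} [MeasurableSpace Ω] [NormedAddCommGroup H] [InnerProductSpace ℝ H]
  [CompleteSpace H] {μ : ℕ → Measure Ω} [∀ n, IsProbabilityMeasure (μ n)] {V : ℕ → Ω → H}
  {R : ∀ n, (Fin n → Ω) → Fin n → H} {A : ℕ → H} {p B c : ℝ} (h : NearlyIID μ V R A p B c)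

include h

theorem measurable_expNegSq_empMean (n : ℕ) :
    Measurable fun d : Fin n → Ω => expNegSq (√(n : ℝ) • empMean (R n d)) :=
  (h.measurable_stat n).neg.exp

/-- Laws on the compact interval form a compact space, so every ultrafilter has a limit. The
transform `exp (-T)` provides the compactness; mass of `T` at infinity would show up at `0`. -/
theorem exists_weak_limit (𝒰 : Ultrafilter ℕ) : ∃ ν : Measure ℝ, IsProbabilityMeasure ν ∧
    ν (Set.Icc 0 1)ᶜ = 0 ∧ ∀ k : ℝ → ℝ, Continuous k → Tendsto (fun n =>
      ∫ d : Fin n → Ω, k (expNegSq (√(n : ℝ) • empMean (R n d))) ∂(Measure.pi fun _ => μ n))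
        𝒰 (𝓝 (∫ t, k t ∂ν)) := by
  set T : ∀ n, (Fin n → Ω) → unitInterval := fun n d =>
    ⟨expNegSq (√(n : ℝ) • empMean (R n d)), (expNegSq_pos _).le, expNegSq_le_one _⟩ with hT
  have hTm : ∀ n, Measurable (T n) := fun n => (h.measurable_expNegSq_empMean n).subtype_mk
  set L : ℕ → ProbabilityMeasure unitInterval := fun n =>
    ⟨(Measure.pi fun _ : Fin n => μ n).map (T n),
      Measure.isProbabilityMeasure_map (hTm n).aemeasurable⟩ with hL
  have hlim : Tendsto L 𝒰 (𝓝 (𝒰.map L).lim) := (𝒰.map L).le_nhds_lim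
  set ν := (𝒰.map L).lim
  have hcm : Measurable ((↑) : unitInterval → ℝ) := measurable_subtype_coe
  refine ⟨(ν : Measure unitInterval).map (↑), Measure.isProbabilityMeasure_map hcm.aemeasurable,
    ?_, fun k hk => ?_⟩
  · rw [Measure.map_apply hcm measurableSet_Icc.compl]
    have : ((↑) : unitInterval → ℝ) ⁻¹' (Set.Icc 0 1)ᶜ = ∅ :=
      Set.eq_empty_of_forall_notMem fun t ht => ht t.2
    rw [this, measure_empty]
  · have h1 := (ProbabilityMeasure.tendsto_iff_forall_integral_tendsto.1 hlim)
      (BoundedContinuousFunction.mkOfCompact ⟨fun t : unitInterval => k t, by fun_prop⟩)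
    rw [integral_map hcm.aemeasurable hk.aestronglyMeasurable]
    refine h1.congr fun n => ?_
    have hk' : Continuous fun t : unitInterval => k t := by fun_prop
    change ∫ t, k (t : ℝ) ∂((Measure.pi fun _ : Fin n => μ n).map (T n)) = _
    rw [integral_map (hTm n).aemeasurable hk'.aestronglyMeasurable]

section Limit

variable {l : Filter ℕ} (hl : l ≤ atTop) {ν : Measure ℝ} [IsProbabilityMeasure ν]
  (hν : ∀ k : ℝ → ℝ, Continuous k → Tendsto (fun n =>
      ∫ d : Fin n → Ω, k (expNegSq (√(n : ℝ) • empMean (R n d))) ∂(Measure.pi fun _ => μ n))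
        l (𝓝 (∫ t, k t ∂ν)))

include hl hν

/-- Stated for general `b` because it is used twice: with the scaled noise to exclude atoms of `ν`,
and with the covariance summands for the critical value. -/
theorem small_integral_sub_limit {b : ∀ n, (Fin n → Ω) → Fin n → H}
    (hb : ∀ k : ℕ, SmallInProb atTop (fun n => Measure.pi fun _ : Fin n => μ n) fun n d =>
      ENNReal.ofReal |multLaplace (fun i => √(k : ℝ) • b n d i) -
        ∫ d : Fin n → Ω, expNegSq (√(k : ℝ) • √(n : ℝ) • empMean (R n d))
          ∂(Measure.pi fun _ => μ n)|) {k : ℝ → ℝ} (hk : Continuous k) :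
    SmallInProb l (fun n => Measure.pi fun _ : Fin n => μ n) fun n d => ENNReal.ofReal
      |∫ g : Fin n → ℝ, k (expNegSq (∑ i, g i • b n d i)) ∂(Measure.pi fun _ => gaussianReal 0 1) -
        ∫ t, k t ∂ν| := by
  have h1 := smallInProb_integral_continuous_sub (l := atTop) (π := fun n => Measure.pi fun _ : Fin n => μ n)
    (γ := fun n => Measure.pi fun _ : Fin n => gaussianReal 0 1)
    (e := fun n d g => expNegSq (∑ i, g i • b n d i))
    (e' := fun n d => expNegSq (√(n : ℝ) • empMean (R n d)))
    (fun n d => (continuous_expNegSq.comp (by fun_prop)).measurable)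
    (fun n d g => ⟨(expNegSq_pos _).le, expNegSq_le_one _⟩) h.measurable_expNegSq_empMean
    (fun n d => ⟨(expNegSq_pos _).le, expNegSq_le_one _⟩) (fun j => ?_) hk
  · have h2 := ((hν k hk).sub_const (∫ t, k t ∂ν)).abs
    rw [sub_self, abs_zero] at h2
    have h3 := ENNReal.tendsto_ofReal h2
    rw [ENNReal.ofReal_zero] at h3
    exact (h1.mono_left hl).abs_sub_trans (SmallInProb.of_tendsto h3)
  · convert hb j using 6 with n d
    · rw [multLaplace]
      refine integral_congr_ae (ae_of_all _ fun g => ?_)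
      simp only [expNegSq_pow, Finset.smul_sum]
      congr 1
      exact Finset.sum_congr rfl fun i _ => smul_comm _ _ _
    · simp only [expNegSq_pow]

/-- Since `ν` is not random, a single well-behaved sample suffices: one where the conditional
multiplier law is close to `ν` and the empirical variance along `A n` exceeds `c / 2`. There
Gaussian anti-concentration bounds the mass near `y`. -/
theorem exists_integral_tent_le_of_pos [NeBot l] {y : ℝ} (hy : 0 < y) {ε : ℝ} (hε : 0 < ε) :
    ∃ η > 0, ∫ t, tent y η t ∂ν ≤ ε := by
  have hc := h.pos
  obtain ⟨δ, hδ, hδε⟩ : ∃ δ > 0, 2 * √(2 * (δ / (c / 2))) ≤ ε / 2 := by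
    have h1 : Tendsto (fun δ : ℝ => 2 * √(2 * (δ / (c / 2)))) (𝓝[>] 0) (𝓝 0) := by
      have : Continuous fun δ : ℝ => 2 * √(2 * (δ / (c / 2))) := by fun_prop
      simpa using (this.tendsto 0).mono_left nhdsWithin_le_nhds
    obtain ⟨δ, h2, h3⟩ := ((h1.eventually (gt_mem_nhds (half_pos hε))).and
      self_mem_nhdsWithin).exists
    exact ⟨δ, h3, h2.le⟩
  -- Continuity of the logarithm at `y > 0` turns a window around `y` into one around `-log y` for
  -- the squared norm.
  obtain ⟨η, hη, hlog⟩ := Metric.continuousAt_iff.1 (Real.continuousAt_log hy.ne') δ hδ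
  refine ⟨η, hη, ?_⟩
  have s1 := h.small_integral_sub_limit hl hν h.small_moment_scaled (continuous_tent y η)
    (ENNReal.ofReal (ε / 2)) (ENNReal.ofReal_pos.2 (half_pos hε))
  have s2 := s1.add (h.tendsto_measure_sum_inner_sq_le.mono_left hl)
  rw [add_zero] at s2
  obtain ⟨n, hn⟩ := (s2.eventually (gt_mem_nhds one_pos)).exists
  obtain ⟨d, hd1, hd2⟩ : ∃ d : Fin n → Ω,
      ¬ ENNReal.ofReal (ε / 2) ≤ ENNReal.ofReal |∫ g : Fin n → ℝ, tent y η
        (expNegSq (∑ i, g i • scaled (fun j => V n (d j)) i)) ∂(Measure.pi fun _ => gaussianReal 0 1)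
          - ∫ t, tent y η t ∂ν| ∧
      ¬ ∑ i, inner ℝ (scaled (fun j => V n (d j)) i) (A n) ^ 2 ≤ c / 2 := by
    exact exists_notMem_of_measure_add_lt_one hn
  have hd1' : |∫ g : Fin n → ℝ, tent y η
        (expNegSq (∑ i, g i • scaled (fun j => V n (d j)) i)) ∂(Measure.pi fun _ => gaussianReal 0 1)
          - ∫ t, tent y η t ∂ν| < ε / 2 := by
    by_contra! hlt
    exact hd1 (ENNReal.ofReal_le_ofReal hlt)
  have hg : ∫ g : Fin n → ℝ, tent y η (expNegSq (∑ i, g i • scaled (fun j => V n (d j)) i))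
      ∂(Measure.pi fun _ => gaussianReal 0 1) ≤ ε / 2 := by
    set a := scaled fun j => V n (d j)
    have hm : MeasurableSet {g : Fin n → ℝ | |‖∑ i, g i • a i‖ ^ 2 - -Real.log y| ≤ δ} :=
      measurableSet_le (((continuous_norm_sq_multiplier a).sub continuous_const).abs.measurable)
        measurable_const
    refine (integral_le_measureReal (s := {g | |‖∑ i, g i • a i‖ ^ 2 - -Real.log y| ≤ δ})
      (fun g => tent_nonneg _ _ _) (fun g => tent_le_one hη _) (fun g hgs => ?_) hm).trans ?_
    · refine tent_eq_zero hη (not_lt.1 fun hlt => hgs ?_)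
      have h3 := hlog (x := expNegSq (∑ i, g i • a i)) (by rwa [Real.dist_eq])
      rw [Real.dist_eq, expNegSq, Real.log_exp] at h3
      have h4 : |‖∑ i, g i • a i‖ ^ 2 - -Real.log y| ≤ δ := by
        rw [← abs_neg]
        refine le_trans (le_of_eq ?_) h3.le
        congr 1
        ring
      exact h4
    · refine (ENNReal.toReal_le_of_le_ofReal (by positivity) (measure_norm_sq_multiplier_near_le a
        (half_pos hc) (h.norm_le_one n) (not_le.1 hd2).le (-Real.log y) hδ.le)).trans hδε
  linarith [(abs_lt.1 hd1').1]

omit hl in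
-- Near zero means a large statistic, which Markov's inequality for the i.i.d. sum excludes. The
-- exponent `4 * M` reflects `‖T‖ ^ 2 ≤ 2 (‖T - U‖ ^ 2 + ‖U‖ ^ 2)` with both squares below `M`.
theorem exists_integral_tent_zero_le [NeBot l] (hl : l ≤ atTop) {ε : ℝ} (hε : 0 < ε) :
    ∃ η > 0, ∫ t, tent 0 η t ∂ν ≤ ε := by
  obtain ⟨M, hM, hM1⟩ : ∃ M : ℝ, 0 < M ∧
      ENNReal.ofReal (1 + B) / ENNReal.ofReal M ≤ ENNReal.ofReal (ε / 2) := by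
    have h1 : Tendsto (fun M : ℝ => (1 + B) / M) atTop (𝓝 0) := tendsto_const_nhds.div_atTop tendsto_id
    obtain ⟨M, h2, h3⟩ := ((h1.eventually (gt_mem_nhds (half_pos hε))).and
      (eventually_gt_atTop 0)).exists
    refine ⟨M, h3, ?_⟩
    rw [← ENNReal.ofReal_div_of_pos h3]
    exact ENNReal.ofReal_le_ofReal h2.le
  refine ⟨Real.exp (-(4 * M)), Real.exp_pos _, ?_⟩
  refine le_of_tendsto (hν _ (continuous_tent 0 _)) ?_
  have s1 := (h.small_sum_sub.mono_left hl) (ENNReal.ofReal M) (ENNReal.ofReal_pos.2 hM)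
  filter_upwards [s1.eventually (gt_mem_nhds (ENNReal.ofReal_pos.2 (half_pos hε)))] with n hn
  have hm : MeasurableSet {d : Fin n → Ω | expNegSq (√(n : ℝ) • empMean (R n d)) <
      Real.exp (-(4 * M))} :=
    measurableSet_lt (h.measurable_expNegSq_empMean n) measurable_const
  refine (integral_le_measureReal (s := {d : Fin n → Ω | expNegSq (√(n : ℝ) • empMean (R n d)) <
      Real.exp (-(4 * M))}) (fun d => tent_nonneg _ _ _) (fun d => tent_le_one (Real.exp_pos _) _)
      (fun d hd => ?_) hm).trans ?_
  · refine tent_eq_zero (Real.exp_pos _) ?_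
    rw [sub_zero, abs_of_pos (expNegSq_pos _)]
    exact not_lt.1 hd
  have hmarkov := (meas_ge_le_lintegral_div (μ := Measure.pi fun _ : Fin n => μ n)
    ((h.stronglyMeasurable_sum_scaled n).norm.measurable.pow_const 2).ennreal_ofReal.aemeasurable
    (ENNReal.ofReal_pos.2 hM).ne' ENNReal.ofReal_ne_top).trans
    ((ENNReal.div_le_div_right (h.lintegral_sum_scaled_le n) _).trans hM1)
  rw [measureReal_def]
  refine ENNReal.toReal_le_of_le_ofReal hε.le ?_
  refine (measure_mono fun d hd => ?_).trans ((measure_union_le _ _).trans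
    ((add_le_add hn.le hmarkov).trans_eq ?_))
  · have hd' : expNegSq (√(n : ℝ) • empMean (R n d)) < Real.exp (-(4 * M)) := hd
    rw [expNegSq, Real.exp_lt_exp, neg_lt_neg_iff] at hd'
    by_contra hcon
    rw [Set.mem_union, not_or] at hcon
    set T := √(n : ℝ) • empMean (R n d)
    set U := ∑ i, scaled (fun j => V n (d j)) i
    have c1 : ‖T - U‖ ^ 2 < M := by
      by_contra! hlt
      exact hcon.1 (ENNReal.ofReal_le_ofReal hlt)
    have c2 : ‖U‖ ^ 2 < M := by
      by_contra! hlt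
      exact hcon.2 (ENNReal.ofReal_le_ofReal hlt)
    have h1 : ‖T‖ ≤ ‖T - U‖ + ‖U‖ := by simpa using norm_add_le (T - U) U
    have h2 := pow_le_pow_left₀ (norm_nonneg _) h1 2
    nlinarith [sq_nonneg (‖T - U‖ - ‖U‖)]
  · rw [← ENNReal.ofReal_add (half_pos hε).le (half_pos hε).le, add_halves]

theorem nullSingletonClass_limit [NeBot l] (h01 : ν (Set.Icc 0 1)ᶜ = 0) : NullSingletonClass ν := by
  refine ⟨fun y => ?_⟩
  rcases lt_or_ge y 0 with hy | hy
  · refine measure_mono_null (t := (Set.Icc 0 1)ᶜ) (Set.singleton_subset_iff.2 ?_) h01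
    exact fun hy' => absurd hy'.1 (not_le.2 hy)
  have key : ∀ ε > 0, ν.real {y} ≤ ε := by
    intro ε hε
    obtain ⟨η, hη, hle⟩ : ∃ η > 0, ∫ t, tent y η t ∂ν ≤ ε := by
      rcases hy.eq_or_lt with rfl | hy
      · exact h.exists_integral_tent_zero_le hν hl hε
      · exact h.exists_integral_tent_le_of_pos hl hν hy hε
    refine (measureReal_le_integral (f := tent y η) (continuous_tent y η).measurable
      (tent_nonneg _ _) (tent_le_one hη) (fun t ht => ?_) (measurableSet_singleton y)).trans hle
    rw [Set.mem_singleton_iff.1 ht, tent_self]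
  have h0 : ν.real {y} ≤ 0 := le_of_forall_pos_le_add fun ε hε => by simpa using key ε hε
  exact (measureReal_eq_zero_iff).1 (le_antisymm h0 measureReal_nonneg)

theorem small_multCdf_sub [NullSingletonClass ν] {y : ℝ} (hy : 0 < y) :
    SmallInProb l (fun n => Measure.pi fun _ : Fin n => μ n) fun n d => ENNReal.ofReal
      |multCdf (covSummand (R n d)) (-Real.log y) - ν.real (Set.Ici y)| := by
  simp only [multCdf_eq_measureReal_ge, neg_neg, Real.exp_log hy]
  exact smallInProb_measureReal_ge_sub (fun n d => (continuous_expNegSq.comp (by fun_prop)).measurable)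
    (fun k hk => h.small_integral_sub_limit hl hν h.small_moment_covSummand hk) y

omit hl in
theorem tendsto_measureReal_stat_le [NullSingletonClass ν] {y : ℝ} (hy : 0 < y) :
    Tendsto (fun n => (Measure.pi fun _ : Fin n => μ n).real
      {d | ‖√(n : ℝ) • empMean (R n d)‖ ^ 2 ≤ -Real.log y}) l (𝓝 (ν.real (Set.Ici y))) := by
  have hs := smallInProb_measureReal_ge_sub (𝒳 := fun _ => Unit) (ν := ν) (l := l)
    (π := fun _ => Measure.dirac ()) (γ := fun n => Measure.pi fun _ : Fin n => μ n)
    (e := fun n _ d => expNegSq (√(n : ℝ) • empMean (R n d)))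
    (fun n _ => h.measurable_expNegSq_empMean n) (fun k hk => by
      have h2 := ((hν k hk).sub_const (∫ t, k t ∂ν)).abs
      rw [sub_self, abs_zero] at h2
      have h3 := ENNReal.tendsto_ofReal h2
      rw [ENNReal.ofReal_zero] at h3
      exact SmallInProb.of_tendsto h3) y
  have hset : ∀ n, {d : Fin n → Ω | ‖√(n : ℝ) • empMean (R n d)‖ ^ 2 ≤ -Real.log y} =
      {d | y ≤ expNegSq (√(n : ℝ) • empMean (R n d))} := by
    intro n
    ext d
    have : y ≤ expNegSq (√(n : ℝ) • empMean (R n d)) ↔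
        Real.exp (- -Real.log y) ≤ expNegSq (√(n : ℝ) • empMean (R n d)) := by
      rw [neg_neg, Real.exp_log hy]
    change _ ↔ y ≤ expNegSq (√(n : ℝ) • empMean (R n d))
    rw [this, expNegSq, Real.exp_le_exp, neg_le_neg_iff]
    rfl
  simp only [hset]
  rw [Metric.tendsto_nhds]
  intro ε hε
  filter_upwards [(hs (ENNReal.ofReal ε) (ENNReal.ofReal_pos.2 hε)).eventually
    (gt_mem_nhds one_pos)] with n hn
  rw [Real.dist_eq]
  by_contra! hle
  have : {u : Unit | ENNReal.ofReal ε ≤ ENNReal.ofReal |(Measure.pi fun _ : Fin n => μ n).real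
      {d | y ≤ expNegSq (√(n : ℝ) • empMean (R n d))} - ν.real (Set.Ici y)|} = Set.univ :=
    Set.eq_univ_of_forall fun _ => ENNReal.ofReal_le_ofReal hle
  rw [this, measure_univ] at hn
  exact lt_irrefl _ hn

/-- `G y = ν [y, ∞)` is the limiting distribution function at `-log y` both of the statistic and, in
probability, of the multiplier law. As it is continuous and takes every value in `(0, 1)`, the
critical value is trapped between fixed levels close to the `1 - α` quantile. -/
theorem tendsto_measureReal_reject_of_limit [NullSingletonClass ν] (h01 : ν (Set.Icc 0 1)ᶜ = 0)
    {α : ℝ} (hα : α ∈ Set.Ioo (0 : ℝ) 1) :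
    Tendsto (fun n => (Measure.pi fun _ : Fin n => μ n).real
      {d | weightedChiSqQuantile
        (fun k : NonzeroEigIndex (empCov (R n d)) => (k.1 : ℝ)) (1 - α) ≤
          ‖√(n : ℝ) • empMean (R n d)‖ ^ 2}) l (𝓝 α) := by
  have hG := continuous_measureReal_Ici (ν := ν)
  set G : ℝ → ℝ := fun y => ν.real (Set.Ici y) with hGdef
  have hGanti : Antitone G := fun x y hxy => measureReal_mono (Set.Ici_subset_Ici.2 hxy)
  have hG0 : G 0 = 1 := by
    have h1 : ν (Set.Ici 0)ᶜ = 0 := measure_mono_null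
      (Set.compl_subset_compl.2 fun t ht => ht.1) h01
    have h2 := measureReal_compl (μ := ν) (s := Set.Ici (0 : ℝ)) measurableSet_Ici
    rw [measureReal_def, h1, probReal_univ, ENNReal.toReal_zero] at h2
    change ν.real (Set.Ici 0) = 1
    linarith
  have hG2 : G 2 = 0 := by
    have h1 : ν (Set.Ici 2) = 0 := by
      refine measure_mono_null (t := (Set.Icc 0 1)ᶜ) (fun t ht => ?_) h01
      have a1 : (2 : ℝ) ≤ t := ht
      exact fun ht' => by linarith [ht'.2]
    change (ν (Set.Ici 2)).toReal = 0
    rw [h1, ENNReal.toReal_zero]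
  have hex : ∀ r ∈ Set.Ioo (0 : ℝ) 1, ∃ y > 0, G y = r := by
    intro r hr
    obtain ⟨y, hy, hyr⟩ := intermediate_value_Icc' zero_le_two hG.continuousOn
      (show r ∈ Set.Icc (G 2) (G 0) by rw [hG0, hG2]; exact ⟨hr.1.le, hr.2.le⟩)
    refine ⟨y, lt_of_le_of_ne hy.1 fun h0 => ?_, hyr⟩
    rw [← h0, hG0] at hyr
    exact hr.2.ne' hyr
  rw [Metric.tendsto_nhds]
  intro ε hε
  -- The first two bounds keep all levels inside `(0, 1)`. The error is at most `2 δ` for the level,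
  -- `δ` for the law of the statistic and `δ` for the bad event.
  obtain ⟨δ, hδ, hδ1, hδ2, hδ3⟩ : ∃ δ > 0, δ < α ∧ 2 * δ < 1 - α ∧ 4 * δ ≤ ε := by
    refine ⟨min (α / 2) (min ((1 - α) / 4) (ε / 4)), ?_, ?_, ?_, ?_⟩
    · have := hα.1
      have := hα.2
      exact lt_min (by linarith) (lt_min (by linarith) (by linarith))
    · linarith [min_le_left (α / 2) (min ((1 - α) / 4) (ε / 4)), hα.1]
    · linarith [(min_le_right (α / 2) (min ((1 - α) / 4) (ε / 4))).trans (min_le_left _ _), hα.2]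
    · linarith [(min_le_right (α / 2) (min ((1 - α) / 4) (ε / 4))).trans (min_le_right _ _)]
  obtain ⟨y₁, hy₁, hGy₁⟩ := hex (1 - α + δ) ⟨by linarith [hα.2], by linarith⟩
  obtain ⟨y₂, hy₂, hGy₂⟩ := hex (1 - α - δ) ⟨by linarith, by linarith [hα.1]⟩
  -- The third level turns `-log y₂ ≤ T` into the strict `-log y₃ < T`, the complement of an event
  -- with known limit.
  obtain ⟨y₃, hy₃, hGy₃⟩ := hex (1 - α - 2 * δ) ⟨by linarith, by linarith [hα.1]⟩
  have hy23 : y₂ < y₃ := by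
    by_contra! hle
    have := hGanti hle
    linarith
  have hlog : -Real.log y₃ < -Real.log y₂ := neg_lt_neg (Real.log_lt_log hy₂ hy23)
  have t1 := h.tendsto_measureReal_stat_le hν hy₁
  have t3 := h.tendsto_measureReal_stat_le hν hy₃
  have hδ' : 0 < ENNReal.ofReal δ := ENNReal.ofReal_pos.2 hδ
  have sb := (h.small_multCdf_sub hl hν hy₁).of_subset_union (h.small_multCdf_sub hl hν hy₂)
    hδ' hδ' (Eventually.of_forall fun n d hd => hd)
  have sb' := (ENNReal.tendsto_toReal ENNReal.zero_ne_top).comp sb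
  rw [ENNReal.toReal_zero] at sb'
  filter_upwards [sb'.eventually (gt_mem_nhds hδ), (Metric.tendsto_nhds.1 t1) δ hδ,
    (Metric.tendsto_nhds.1 t3) δ hδ, hl (eventually_ge_atTop 2)] with n hn1 hn2 hn3 hn
  set π : Measure (Fin n → Ω) := Measure.pi fun _ => μ n with hπ
  set T : (Fin n → Ω) → ℝ := fun d => ‖√(n : ℝ) • empMean (R n d)‖ ^ 2 with hT
  set q : (Fin n → Ω) → ℝ := fun d => weightedChiSqQuantile
    (fun k : NonzeroEigIndex (empCov (R n d)) => (k.1 : ℝ)) (1 - α) with hq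
  set bad : Set (Fin n → Ω) := {d | ENNReal.ofReal δ ≤ ENNReal.ofReal
      |multCdf (covSummand (R n d)) (-Real.log y₁) - ν.real (Set.Ici y₁)| ∨
    ENNReal.ofReal δ ≤ ENNReal.ofReal
      |multCdf (covSummand (R n d)) (-Real.log y₂) - ν.real (Set.Ici y₂)|} with hbad
  have hbadm : π.real bad < δ := hn1
  have hgood : ∀ d ∉ bad, q d ∈ Set.Icc (-Real.log y₂) (-Real.log y₁) := by
    intro d hd
    have hd' : ¬ (_ ∨ _) := hd
    rw [not_or] at hd'
    have g1 : |multCdf (covSummand (R n d)) (-Real.log y₁) - G y₁| < δ := by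
      by_contra! hle
      exact hd'.1 (ENNReal.ofReal_le_ofReal hle)
    have g2 : |multCdf (covSummand (R n d)) (-Real.log y₂) - G y₂| < δ := by
      by_contra! hle
      exact hd'.2 (ENNReal.ofReal_le_ofReal hle)
    rw [hGy₁] at g1
    rw [hGy₂] at g2
    exact weightedChiSqQuantile_empCov_mem_Icc hn (R n d) (by linarith [hα.2])
      (by linarith [(abs_lt.1 g1).1]) (by linarith [(abs_lt.1 g2).2])
  have hTm : ∀ x, MeasurableSet {d | T d ≤ x} := fun x =>
    measurableSet_le (h.measurable_stat n) measurable_const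
  have hcompl : ∀ x, π.real {d | x < T d} = 1 - π.real {d | T d ≤ x} := by
    intro x
    have h1 := measureReal_compl (μ := π) (hTm x)
    rw [probReal_univ] at h1
    rw [← h1]
    congr 1
    ext d
    rw [Set.mem_compl_iff]
    exact (not_le (a := T d) (b := x)).symm
  have hup : π.real {d | q d ≤ T d} ≤ π.real {d | -Real.log y₃ < T d} + π.real bad := by
    refine (measureReal_mono fun d hd => ?_).trans (measureReal_union_le _ _)
    by_cases hdb : d ∈ bad
    · exact Or.inr hdb
    · exact Or.inl (hlog.trans_le ((hgood d hdb).1.trans hd))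
  have hlo : π.real {d | -Real.log y₁ < T d} ≤ π.real {d | q d ≤ T d} + π.real bad := by
    refine (measureReal_mono fun d hd => ?_).trans (measureReal_union_le _ _)
    by_cases hdb : d ∈ bad
    · exact Or.inr hdb
    · exact Or.inl ((hgood d hdb).2.trans (le_of_lt hd))
  rw [hcompl] at hup hlo
  have e1 : |π.real {d | T d ≤ -Real.log y₁} - G y₁| < δ := hn2
  have e3 : |π.real {d | T d ≤ -Real.log y₃} - G y₃| < δ := hn3
  rw [hGy₁] at e1
  rw [hGy₃] at e3
  have e1' := abs_lt.1 e1
  have e3' := abs_lt.1 e3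
  rw [Real.dist_eq]
  change |π.real {d | q d ≤ T d} - α| < ε
  exact abs_lt.2 ⟨by linarith, by linarith⟩

end Limit

theorem tendsto_measureReal_reject {α : ℝ} (hα : α ∈ Set.Ioo (0 : ℝ) 1) :
    Tendsto (fun n => (Measure.pi fun _ : Fin n => μ n).real
      {d | weightedChiSqQuantile
        (fun k : NonzeroEigIndex (empCov (R n d)) => (k.1 : ℝ)) (1 - α) ≤
          ‖√(n : ℝ) • empMean (R n d)‖ ^ 2}) atTop (𝓝 α) := by
  rw [tendsto_iff_ultrafilter]
  intro 𝒰 h𝒰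
  obtain ⟨ν, hp, h01, hν⟩ := h.exists_weak_limit 𝒰
  have := h.nullSingletonClass_limit h𝒰 hν h01
  exact h.tendsto_measureReal_reject_of_limit h𝒰 hν h01 hα

end NearlyIID

/-! ### The products of the noise variables satisfy the assumptions -/

section Instantiate

/-- A lower bound for the operator norm of a covariance operator yields a direction of large
variance. -/
theorem exists_direction_of_lt_norm_cov {Ω H : Type*} [MeasurableSpace Ω] [NormedAddCommGroup H]
    [InnerProductSpace ℝ H] {μ : Measure Ω} {V : Ω → H} (hV : StronglyMeasurable V)
    (h2 : Integrable (fun ω => ‖V ω‖ ^ 2) μ) {B c : ℝ} (hB : 0 < B) (hc : 0 < c)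
    (hVB : ∫ ω, ‖V ω‖ ^ 2 ∂μ ≤ B) (h : c < ‖∫ ω, outerOp (V ω) (V ω) ∂μ‖) :
    ∃ A : H, ‖A‖ ≤ 1 ∧ c ^ 2 / B ≤ ∫ ω, inner ℝ (V ω) A ^ 2 ∂μ := by
  -- A non-integrable integrand would give the zero operator, against the lower bound on the norm.
  have hi : Integrable (fun ω => outerOp (V ω) (V ω)) μ := by
    by_contra hni
    rw [integral_undef hni, norm_zero] at h
    linarith
  obtain ⟨A, hA, hcA⟩ := ContinuousLinearMap.exists_lt_apply_of_lt_opNorm _ h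
  refine ⟨A, hA.le, ?_⟩
  rw [ContinuousLinearMap.integral_apply hi] at hcA
  have hsq : Integrable (fun ω => inner ℝ (V ω) A ^ 2) μ := by
    simpa only [real_inner_comm] using integrable_inner_sq_of_norm_sq hV h2 A
  have hi2 := (hsq.const_mul (B / c)).add (h2.const_mul (c / B))
  -- The weights `B / c` and `c / B` in the inequality between means are chosen so that the `‖V‖ ^
  -- 2` part contributes at most `c / 2`, leaving the other half for the variance along `A`.
  have h3 : ‖∫ ω, outerOp (V ω) (V ω) A ∂μ‖ ≤
      ∫ ω, (B / c * inner ℝ (V ω) A ^ 2 + c / B * ‖V ω‖ ^ 2) / 2 ∂μ := by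
    refine norm_integral_le_of_norm_le (hi2.div_const 2) (ae_of_all _ fun ω => ?_)
    rw [outerOp, InnerProductSpace.rankOne_apply, norm_smul, Real.norm_eq_abs]
    have e : B / c * inner ℝ (V ω) A ^ 2 + c / B * ‖V ω‖ ^ 2 -
        2 * (|inner ℝ (V ω) A| * ‖V ω‖) =
        B / c * (|inner ℝ (V ω) A| - c / B * ‖V ω‖) ^ 2 := by
      rw [← sq_abs (inner ℝ (V ω) A)]
      field_simp
      ring
    have : 0 ≤ B / c * (|inner ℝ (V ω) A| - c / B * ‖V ω‖) ^ 2 := by positivity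
    linarith
  rw [integral_div, integral_add (hsq.const_mul _) (h2.const_mul _), integral_const_mul,
    integral_const_mul] at h3
  have h4 : c / B * ∫ ω, ‖V ω‖ ^ 2 ∂μ ≤ c := by
    calc c / B * ∫ ω, ‖V ω‖ ^ 2 ∂μ ≤ c / B * B := by gcongr
      _ = c := div_mul_cancel₀ _ hB.ne'
  have h5 : c ≤ B / c * ∫ ω, inner ℝ (V ω) A ^ 2 ∂μ := by linarith
  rw [div_le_iff₀ hB]
  rw [div_mul_eq_mul_div, le_div_iff₀ hc] at h5
  linarith

variable {E F 𝒵 : Type*}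
  [NormedAddCommGroup E] [InnerProductSpace ℝ E] [CompleteSpace E] [SecondCountableTopology E]
  [MeasurableSpace E] [BorelSpace E]
  [NormedAddCommGroup F] [InnerProductSpace ℝ F] [CompleteSpace F] [SecondCountableTopology F]
  [MeasurableSpace F] [BorelSpace F]
  [MeasurableSpace 𝒵]

theorem stronglyMeasurable_outer {α : Type*} [MeasurableSpace α] {f : α → E} {g : α → F}
    (hf : Measurable f) (hg : Measurable g) :
    StronglyMeasurable fun a => HilbertSchmidt.outer (f a) (g a) :=
  HilbertSchmidt.continuous_outer.comp_stronglyMeasurable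
    (hf.stronglyMeasurable.prodMk hg.stronglyMeasurable)

theorem measurable_noiseX (P : ProbabilityMeasure (E × F × 𝒵)) : Measurable (noiseX P) :=
  measurable_fst.sub ((measurable_regX P).comp measurable_snd.snd)

theorem measurable_noiseY (P : ProbabilityMeasure (E × F × 𝒵)) : Measurable (noiseY P) :=
  measurable_snd.fst.sub ((measurable_regY P).comp measurable_snd.snd)

theorem stronglyMeasurable_noiseProd (P : ProbabilityMeasure (E × F × 𝒵)) :
    StronglyMeasurable (noiseProd P) :=
  stronglyMeasurable_outer (measurable_noiseX P) (measurable_noiseY P)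

theorem rpow_le_one_add_rpow {r p q : ℝ} (hr : 0 ≤ r) (hp : 0 ≤ p) (hpq : p ≤ q) :
    r ^ p ≤ 1 + r ^ q := by
  rcases le_total r 1 with h | h
  · linarith [Real.rpow_le_one hr h hp, Real.rpow_nonneg hr q]
  · linarith [Real.rpow_le_rpow_of_exponent_le h hpq]

theorem integral_noiseProd_rpow_le {P : ProbabilityMeasure (E × F × 𝒵)} {p q : ℝ} (hp : 0 ≤ p)
    (hpq : p ≤ q) {M : ℝ≥0∞} (hM : M ≠ ∞)
    (h : ∫⁻ z, ‖noiseX P z‖ₑ ^ q * ‖noiseY P z‖ₑ ^ q ∂(P : Measure (E × F × 𝒵)) ≤ M) :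
    Integrable (fun z => ‖noiseProd P z‖ ^ p) (P : Measure (E × F × 𝒵)) ∧
      ∫ z, ‖noiseProd P z‖ ^ p ∂(P : Measure (E × F × 𝒵)) ≤ 1 + M.toReal := by
  have hq : 0 ≤ q := hp.trans hpq
  have hm : ∀ r : ℝ, Measurable fun z => ‖noiseProd P z‖ ^ r := fun r =>
    (stronglyMeasurable_noiseProd P).norm.measurable.pow_const r
  have e : ∀ z, ENNReal.ofReal (‖noiseProd P z‖ ^ q) =
      ‖noiseX P z‖ₑ ^ q * ‖noiseY P z‖ₑ ^ q := by
    intro z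
    rw [noiseProd, HilbertSchmidt.norm_outer, ← ENNReal.ofReal_rpow_of_nonneg (by positivity) hq,
      ENNReal.ofReal_mul (norm_nonneg _), ofReal_norm, ofReal_norm,
      ENNReal.mul_rpow_of_nonneg _ _ hq]
  have hq0 : ∀ z, 0 ≤ ‖noiseProd P z‖ ^ q := fun z => Real.rpow_nonneg (norm_nonneg _) _
  have hqi : Integrable (fun z => ‖noiseProd P z‖ ^ q) (P : Measure (E × F × 𝒵)) := by
    refine ⟨(hm q).aestronglyMeasurable, (hasFiniteIntegral_iff_ofReal (ae_of_all _ hq0)).2 ?_⟩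
    rw [lintegral_congr e]
    exact h.trans_lt hM.lt_top
  have hqM : ∫ z, ‖noiseProd P z‖ ^ q ∂(P : Measure (E × F × 𝒵)) ≤ M.toReal := by
    rw [integral_eq_lintegral_of_nonneg_ae (ae_of_all _ hq0) (hm q).aestronglyMeasurable,
      lintegral_congr e]
    exact ENNReal.toReal_mono hM h
  have hle : ∀ z, ‖noiseProd P z‖ ^ p ≤ 1 + ‖noiseProd P z‖ ^ q := fun z =>
    rpow_le_one_add_rpow (norm_nonneg _) hp hpq
  have hpi : Integrable (fun z => ‖noiseProd P z‖ ^ p) (P : Measure (E × F × 𝒵)) :=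
    ((integrable_const (1 : ℝ)).add hqi).mono' (hm p).aestronglyMeasurable (ae_of_all _ fun z => by
      rw [Real.norm_eq_abs, abs_of_nonneg (Real.rpow_nonneg (norm_nonneg _) _)]
      exact hle z)
  refine ⟨hpi, (integral_mono hpi ((integrable_const (1 : ℝ)).add hqi) hle).trans ?_⟩
  have := integral_add (integrable_const (1 : ℝ)) hqi (μ := (P : Measure (E × F × 𝒵)))
  rw [integral_const, probReal_univ, one_smul] at this
  exact this.le.trans (by linarith)

/-- The pairing equals `⟪A ε, ξ⟫`, where `A ε` is a function of `(X, Z)` and `ξ` is centred given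
`(X, Z)`. -/
theorem integral_inner_noiseProd {P : ProbabilityMeasure (E × F × 𝒵)}
    (hP : P ∈ condIndepNull E F 𝒵)
    (hY : Integrable (fun p : E × F × 𝒵 => p.2.1) (P : Measure (E × F × 𝒵)))
    (h2 : Integrable (fun z => ‖noiseProd P z‖ ^ 2) (P : Measure (E × F × 𝒵)))
    (A : HilbertSchmidt E F) :
    ∫ z, inner ℝ A (noiseProd P z) ∂(P : Measure (E × F × 𝒵)) = 0 := by
  have hi := integrable_inner_of_norm_sq (stronglyMeasurable_noiseProd P) h2 A
  simp only [noiseProd, HilbertSchmidt.inner_outer_right] at hi ⊢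
  exact (isCenteredGiven_noiseY hP hY).integral_inner
    (fun u => HilbertSchmidt.toCLM E F A (u.1 - regX P u.2))
    ((HilbertSchmidt.toCLM E F A).continuous.measurable.comp
      (measurable_fst.sub ((measurable_regX P).comp measurable_snd))) hi

theorem lintegral_norm_sq_sum_noiseProd_le {P : ProbabilityMeasure (E × F × 𝒵)}
    (hP : P ∈ condIndepNull E F 𝒵)
    (hY : Integrable (fun p : E × F × 𝒵 => p.2.1) (P : Measure (E × F × 𝒵)))
    (h2 : Integrable (fun z => ‖noiseProd P z‖ ^ 2) (P : Measure (E × F × 𝒵))) (n : ℕ) :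
    ∫⁻ d : Fin n → E × F × 𝒵, ENNReal.ofReal (‖∑ i, noiseProd P (d i)‖ ^ 2)
        ∂(Measure.pi fun _ => (P : Measure (E × F × 𝒵))) ≤
      n * ENNReal.ofReal (∫ z, ‖noiseProd P z‖ ^ 2 ∂(P : Measure (E × F × 𝒵))) := by
  have hw : ∀ i : Fin n, Measurable fun u : Fin n → E × 𝒵 => (u i).1 - regX P (u i).2 := fun i =>
    (measurable_pi_apply i).fst.sub ((measurable_regX P).comp (measurable_pi_apply i).snd)
  have hc := isCenteredGiven_noiseY hP hY
  have h1 := hc.lintegral_norm_sq_sum_outer_le hw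
  rw [← hc.lintegral_sum_sq_mul_sq hw] at h1
  refine h1.trans_eq ?_
  have e : ∀ z, ‖noiseX P z‖ₑ ^ 2 * ‖noiseY P z‖ₑ ^ 2 = ENNReal.ofReal (‖noiseProd P z‖ ^ 2) :=
    fun z => (ofReal_norm_sq_outer _ _).symm
  have hm : Measurable fun z => ENNReal.ofReal (‖noiseProd P z‖ ^ 2) :=
    ((stronglyMeasurable_noiseProd P).norm.measurable.pow_const 2).ennreal_ofReal
  change ∫⁻ d : Fin n → E × F × 𝒵, ∑ i, ‖noiseX P (d i)‖ₑ ^ 2 * ‖noiseY P (d i)‖ₑ ^ 2 ∂_ = _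
  simp only [e]
  have hmi : ∀ i : Fin n, Measurable fun d : Fin n → E × F × 𝒵 =>
      ENNReal.ofReal (‖noiseProd P (d i)‖ ^ 2) := fun i => hm.comp (measurable_pi_apply i)
  rw [lintegral_finsetSum _ fun i _ => hmi i]
  have e2 : ∀ i : Fin n, ∫⁻ d : Fin n → E × F × 𝒵, ENNReal.ofReal (‖noiseProd P (d i)‖ ^ 2)
      ∂(Measure.pi fun _ => (P : Measure (E × F × 𝒵))) =
      ENNReal.ofReal (∫ z, ‖noiseProd P z‖ ^ 2 ∂(P : Measure (E × F × 𝒵))) := by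
    intro i
    rw [(measurePreserving_eval (fun _ : Fin n => (P : Measure (E × F × 𝒵))) i).lintegral_comp hm,
      ofReal_integral_eq_lintegral_ofReal h2 (ae_of_all _ fun z => sq_nonneg _)]
  rw [Finset.sum_congr rfl fun i _ => e2 i, Finset.sum_const, Finset.card_univ, Fintype.card_fin,
    nsmul_eq_mul]

theorem measurable_ghcmStat {fhat : RegMethod E 𝒵} {ghat : RegMethod F 𝒵}
    (hfhat : fhat.MeasurableFit) (hghat : ghat.MeasurableFit) (n : ℕ) :
    Measurable fun d : Fin n → E × F × 𝒵 =>
      ‖√(n : ℝ) • empMean (sampleResidualProd fhat ghat n d)‖ ^ 2 := by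
  have hd : ∀ i : Fin n, Measurable fun d : Fin n → E × F × 𝒵 => d i := measurable_pi_apply
  have hf : ∀ i : Fin n, Measurable fun d : Fin n → E × F × 𝒵 => (d i).1 - fitX fhat d i :=
    fun i => (hd i).fst.sub ((hfhat n i).comp ((measurable_pi_iff.2 fun j => (hd j).fst).prodMk
      (measurable_pi_iff.2 fun j => (hd j).snd.snd)))
  have hg : ∀ i : Fin n, Measurable fun d : Fin n → E × F × 𝒵 => (d i).2.1 - fitY ghat d i :=
    fun i => (hd i).snd.fst.sub ((hghat n i).comp ((measurable_pi_iff.2 fun j =>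
      (hd j).snd.fst).prodMk (measurable_pi_iff.2 fun j => (hd j).snd.snd)))
  have hs : StronglyMeasurable fun d : Fin n → E × F × 𝒵 =>
      ∑ i, sampleResidualProd fhat ghat n d i :=
    Finset.stronglyMeasurable_fun_sum _ fun i _ => stronglyMeasurable_outer (hf i) (hg i)
  simp only [empMean, norm_smul]
  exact ((hs.norm.measurable.const_mul _).const_mul _).pow_const 2

theorem exists_nearlyIID {fhat : RegMethod E 𝒵} {ghat : RegMethod F 𝒵}
    {S : Set (ProbabilityMeasure (E × F × 𝒵))} (hfhat : fhat.MeasurableFit)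
    (hghat : ghat.MeasurableFit) (hnull : S ⊆ condIndepNull E F 𝒵)
    (hintX : ∀ P ∈ S, Integrable (fun p : E × F × 𝒵 => p.1) (P : Measure (E × F × 𝒵)))
    (hintY : ∀ P ∈ S, Integrable (fun p : E × F × 𝒵 => p.2.1) (P : Measure (E × F × 𝒵)))
    (hcond : GHCMConditions fhat ghat S) (hdegen : 0 < ⨅ P ∈ S, ‖covOp P‖ₑ)
    {P : ℕ → ProbabilityMeasure (E × F × 𝒵)} (hP : ∀ n, P n ∈ S) :
    ∃ (A : ℕ → HilbertSchmidt E F) (p B c : ℝ),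
      NearlyIID (fun n => (P n : Measure (E × F × 𝒵))) (fun n => noiseProd (P n))
        (sampleResidualProd fhat ghat) A p B c := by
  obtain ⟨η, hη, hM⟩ := hcond.moment_upper
  set M := ⨆ P ∈ S, ∫⁻ p, ‖noiseX P p‖ₑ ^ (2 + η) * ‖noiseY P p‖ₑ ^ (2 + η)
    ∂(P : Measure (E × F × 𝒵)) with hMdef
  have hMle : ∀ n, ∫⁻ p, ‖noiseX (P n) p‖ₑ ^ (2 + η) * ‖noiseY (P n) p‖ₑ ^ (2 + η)
      ∂(P n : Measure (E × F × 𝒵)) ≤ M := fun n =>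
    le_iSup₂ (f := fun (Q : ProbabilityMeasure (E × F × 𝒵)) _ => ∫⁻ p, ‖noiseX Q p‖ₑ ^ (2 + η) *
      ‖noiseY Q p‖ₑ ^ (2 + η) ∂(Q : Measure (E × F × 𝒵))) (P n) (hP n)
  have hmom : ∀ {r : ℝ}, 0 ≤ r → r ≤ 2 + η → ∀ n, _ := fun hr hr' n =>
    integral_noiseProd_rpow_le hr hr' hM.ne (hMle n)
  -- The exponent `2 + min η 1` is capped at three, the order of the Taylor remainder.
  have hp0 : 0 < min η 1 := lt_min hη one_pos
  have hpη : 2 + min η 1 ≤ 2 + η := by linarith [min_le_left η 1]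
  have h2 : ∀ n, Integrable (fun z => ‖noiseProd (P n) z‖ ^ 2) (P n : Measure (E × F × 𝒵)) ∧
      ∫ z, ‖noiseProd (P n) z‖ ^ 2 ∂(P n : Measure (E × F × 𝒵)) ≤ 1 + M.toReal := by
    intro n
    have := hmom (r := 2) zero_le_two (by linarith) n
    simpa only [Real.rpow_two] using this
  have hB : 0 < 1 + M.toReal := by positivity
  obtain ⟨c, hc, hclt⟩ := ENNReal.lt_iff_exists_real_btwn.1 hdegen
  have hc0 : 0 < c := ENNReal.ofReal_pos.1 hclt.1
  have hcn : ∀ n, c < ‖covOp (P n)‖ := by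
    intro n
    have h1 := hclt.2.trans_le (iInf₂_le (P n) (hP n))
    rw [← ofReal_norm] at h1
    exact (ENNReal.ofReal_lt_ofReal_iff_of_nonneg hc0.le).1 h1
  choose A hA hAc using fun n => exists_direction_of_lt_norm_cov
    (stronglyMeasurable_noiseProd (P n)) (h2 n).1 hB hc0 (h2 n).2 (hcn n)
  have hrem := smallInProb_remainders hfhat hghat hnull hintX hintY hcond hP
  exact ⟨A, 2 + min η 1, 1 + M.toReal, c ^ 2 / (1 + M.toReal),
    { stronglyMeasurable := fun n => stronglyMeasurable_noiseProd (P n)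
      exponent_mem := ⟨by linarith, by linarith [min_le_right η 1]⟩
      integrable_rpow := fun n => (hmom (by linarith) hpη n).1
      integral_rpow_le := fun n => (hmom (by linarith) hpη n).2
      integral_inner := fun n x =>
        integral_inner_noiseProd (hnull (hP n)) (hintY _ (hP n)) (h2 n).1 x
      lintegral_sum_le := fun n =>
        (lintegral_norm_sq_sum_noiseProd_le (hnull (hP n)) (hintY _ (hP n)) (h2 n).1 n).trans
          (mul_le_mul' le_rfl (ENNReal.ofReal_le_ofReal (by linarith [(h2 n).2])))
      sum_close := hrem.1
      each_close := hrem.2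
      measurable_stat := measurable_ghcmStat hfhat hghat
      pos := by positivity
      norm_le_one := hA
      le_integral_sq := hAc }⟩

theorem ghcmTest_eq_one_iff (α : ℝ) {n : ℕ} (e : Fin n → E) (x : Fin n → F) :
    ghcmTest α e x = 1 ↔ ghcmCritical α e x ≤ ghcmStat e x := by
  rw [ghcmTest]
  split_ifs with h <;> simp [h]

theorem tendsto_measureReal_ghcmTest {fhat : RegMethod E 𝒵} {ghat : RegMethod F 𝒵}
    {S : Set (ProbabilityMeasure (E × F × 𝒵))} (hfhat : fhat.MeasurableFit)
    (hghat : ghat.MeasurableFit) (hnull : S ⊆ condIndepNull E F 𝒵)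
    (hintX : ∀ P ∈ S, Integrable (fun p : E × F × 𝒵 => p.1) (P : Measure (E × F × 𝒵)))
    (hintY : ∀ P ∈ S, Integrable (fun p : E × F × 𝒵 => p.2.1) (P : Measure (E × F × 𝒵)))
    (hcond : GHCMConditions fhat ghat S) (hdegen : 0 < ⨅ P ∈ S, ‖covOp P‖ₑ)
    {P : ℕ → ProbabilityMeasure (E × F × 𝒵)} (hP : ∀ n, P n ∈ S) {α : ℝ}
    (hα : α ∈ Set.Ioo (0 : ℝ) 1) :
    Tendsto (fun n => (sampleLaw (P n) n).real
      {d | ghcmTest α (fun i => (d i).1 - fitX fhat d i)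
        (fun i => (d i).2.1 - fitY ghat d i) = 1}) atTop (𝓝 α) := by
  obtain ⟨A, p, B, c, h⟩ := exists_nearlyIID hfhat hghat hnull hintX hintY hcond hdegen hP
  simp only [ghcmTest_eq_one_iff]
  exact h.tendsto_measureReal_reject hα

end Instantiate

end

theorem mainTheorem3 {HX HY 𝒵 : Type*}
    [NormedAddCommGroup HX] [InnerProductSpace ℝ HX] [CompleteSpace HX]
    [SecondCountableTopology HX] [MeasurableSpace HX] [BorelSpace HX]
    [NormedAddCommGroup HY] [InnerProductSpace ℝ HY] [CompleteSpace HY]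
    [SecondCountableTopology HY] [MeasurableSpace HY] [BorelSpace HY]
    [MeasurableSpace 𝒵]
    (fhat : RegMethod HX 𝒵) (ghat : RegMethod HY 𝒵)
    (hfhat : fhat.MeasurableFit) (hghat : ghat.MeasurableFit)
    (S : Set (ProbabilityMeasure (HX × HY × 𝒵)))
    (hnull : S ⊆ condIndepNull HX HY 𝒵)
    (hintX : ∀ P ∈ S, Integrable (fun p : HX × HY × 𝒵 => p.1) (P : Measure (HX × HY × 𝒵)))
    (hintY : ∀ P ∈ S, Integrable (fun p : HX × HY × 𝒵 => p.2.1) (P : Measure (HX × HY × 𝒵)))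
    (hcond : GHCMConditions fhat ghat S)
    (hdegen : 0 < ⨅ P ∈ S, ‖covOp P‖ₑ)
    (α : ℝ) (hα : α ∈ Set.Ioo (0 : ℝ) 1) :
    Tendsto
      (fun n : ℕ => ⨆ P : S, |(sampleLaw P.1 n).real
        {d | ghcmTest α (fun i => (d i).1 - fitX fhat d i)
          (fun i => (d i).2.1 - fitY ghat d i) = 1} - α|)
      atTop (𝓝 0) := by
  rcases S.eq_empty_or_nonempty with rfl | ⟨P₀, hP₀⟩
  -- The real supremum over an empty family is zero.
  · simp only [Real.iSup_of_isEmpty]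
    exact tendsto_const_nhds
  have : Nonempty S := ⟨⟨P₀, hP₀⟩⟩
  set r : ∀ n : ℕ, S → ℝ := fun n P => |(sampleLaw P.1 n).real
    {d | ghcmTest α (fun i => (d i).1 - fitX fhat d i)
      (fun i => (d i).2.1 - fitY ghat d i) = 1} - α| with hr
  have hpos : ∀ n : ℕ, (0 : ℝ) < ((n : ℝ) + 1)⁻¹ := fun n => by positivity
  -- For each `n` a law within `1 / (n + 1)` of the supremum; pointwise convergence along this
  -- sequence is then uniform convergence over `S`.
  choose P hP using fun n : ℕ => exists_lt_of_lt_ciSup (sub_lt_self (⨆ P, r n P) (hpos n))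
  have h1 := tendsto_measureReal_ghcmTest hfhat hghat hnull hintX hintY hcond hdegen
    (fun n => (P n).2) hα
  have h2 := (h1.sub_const α).abs
  rw [sub_self, abs_zero] at h2
  have h3 : Tendsto (fun n : ℕ => ((n : ℝ) + 1)⁻¹) atTop (𝓝 0) := by
    simpa only [one_div] using tendsto_one_div_add_atTop_nhds_zero_nat (𝕜 := ℝ)
  have h4 := h2.add h3
  rw [add_zero] at h4
  refine squeeze_zero (fun n => Real.iSup_nonneg fun P => abs_nonneg _) (fun n => ?_) h4
  exact (sub_lt_iff_lt_add.1 (hP n)).le
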